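/- Let $N\ge 0$ be an integer, $\eta\in\mathbb C\setminus\{0\}$ and $\mathcal H=(\mathbb C^2)^{\otimes N}$. Put $$R(\lambda)=\begin{pmatrix}\lambda+\eta&0&0&0\\0&\lambda&\eta&0\\0&\eta&\lambda&0\\0&0&0&\lambda+\eta\end{pmatrix},\qquad K(\lambda;\zeta,\kappa,\tau)=\frac1\zeta\begin{pmatrix}\zeta+\lambda&2\kappa e^{\tau}\lambda\\2\kappa e^{-\tau}\lambda&\zeta-\lambda\end{pmatrix},$$ $K_\pm(\lambda)=K(\lambda\pm\eta/2;\zeta_\pm,\kappa_\pm,\tau_\pm)$, and, for $\xi=(\xi_1,\dots,\xi_N)\in\mathbb C^N$, $$M_0(\lambda)=R_{0N}(\lambda-\xi_N-\tfrac\eta2)\cdots R_{01}(\lambda-\xi_1-\tfrac\eta2),\quad \hat M_0(\lambda)=(-1)^N\sigma_0^y\,M_0^{t_0}(-\lambda)\,\sigma_0^y,$$ $$\mathcal T(\lambda)=\mathrm{tr}_0\{K_{0,+}(\lambda)M_0(\lambda)K_{0,-}(\lambda)\hat M_0(\lambda)\}\in\mathrm{End}(\mathcal H).$$ Let $a(\lambda)=\prod_n(\lambda-\xi_n+\frac\eta2)$,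 $d(\lambda)=\prod_n(\lambda-\xi_n-\frac\eta2)$, $\bar\zeta_\pm=\epsilon_\pm\zeta_\pm/\sqrt{1+4\kappa_\pm^2}$ with arbitrary fixed signs $\epsilon_\pm\in\{1,-1\}$, $$\mathsf A(\lambda)=(-1)^N\frac{2\lambda+\eta}{2\lambda}\,\frac{(\lambda-\frac\eta2+\bar\zeta_+)(\lambda-\frac\eta2+\bar\zeta_-)}{\bar\zeta_+\bar\zeta_-}\,a(\lambda)\,d(-\lambda),$$ $k_n=\frac{\xi_n+\eta}{\xi_n-\eta}$, $\xi_n^{(h)}=\xi_n+(1-2h)\frac\eta2$ for $h\in\{0,1\}$, $\widehat V(x_1,\dots,x_N)=\det_{1\le i,j\le N}[x_i^{2(j-1)}]$, and $$N_\xi=\widehat V(\xi_1,\dots,\xi_N)\,\frac{\widehat V(\xi_1^{(0)},\dots,\xi_N^{(0)})}{\widehat V(\xi_1^{(1)},\dots,\xi_N^{(1)})}.$$ For a covector $\langle S|$ on $\mathcal H$ and $\mathbf h\in\{0,1\}^N$ put $$\langle\mathbf h|=\langle S|\prod_{n=1}^N\Big(\frac{\mathcal T(\xi_n-\eta/2)}{\mathsf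 A(\eta/2-\xi_n)}\Big)^{1-h_n}.$$ Call $\xi$ generic if $\xi_j,\ \xi_j\pm\xi_k\notin\{0,-\eta,\eta\}$ for all $j\ne k$. **(i)** For Lebesgue-almost every choice of $\xi$, of the boundary parameters $(\zeta_\pm,\kappa_\pm,\tau_\pm)\in\mathbb C^6$ and of the covector $\langle S|$: if $\xi$ is generic and $K_-(\lambda)$, $K_+(\lambda)$ are not both proportional to the identity, then $\{\langle\mathbf h|\}_{\mathbf h\in\{0,1\}^N}$ is a basis of the space of covectors. The same holds, for each fixed $\kappa_\pm,\tau_\pm$ with $1+4\kappa_\pm^2\neq0$ (in particular for parallel or diagonal boundary fields), for almost every choice of $\xi,\zeta_+,\zeta_-,\langle S|$. **(ii)** Let $\xi$ be generic, $\zeta_\pm\ne0$, $1+4\kappa_\pm^2\ne0$, $\xi_n\neq\eta/2$ for all $n$, and suppose that the $\langle\mathbf h|$ form a basis. Then there is a unique vector $|R\rangle$ with $$\langle\mathbf h|R\rangle=\delta_{\mathbf h,\mathbf 0}\,\frac{\widehat V(\xi_1,\dots,\xi_N)}{\widehat V(\xi_1^{(1)},\dots,\xi_N^{(1)})}\qquad\text{for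 all }\mathbf h,$$ the vectors $$|\mathbf h\rangle=\prod_{n=1}^N\Big(\frac{\mathcal T(\xi_n+\eta/2)}{k_n\,\mathsf A(\eta/2-\xi_n)}\Big)^{h_n}|R\rangle,\qquad \mathbf h\in\{0,1\}^N,$$ form a basis of $\mathcal H$, and for the canonical pairing in the spin basis $$\langle\mathbf h'|\mathbf h\rangle=\delta_{\mathbf h,\mathbf h'}\,\frac{N_\xi}{\widehat V(\xi_1^{(h_1)},\dots,\xi_N^{(h_N)})}\qquad\text{for all }\mathbf h,\mathbf h'.$$ If $|R\rangle$ is instead normalized by $\langle\mathbf h|R\rangle=\delta_{\mathbf h,\mathbf 0}\,\widehat V(\xi_1,\dots,\xi_N)/\widehat V(\xi_1^{(0)},\dots,\xi_N^{(0)})$, the same conclusions (existence and uniqueness, basis, orthogonality) hold with $N_\xi$ replaced by $\widehat V(\xi_1,\dots,\xi_N)$. -/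

import Mathlib

open MeasureTheory

namespace OpenXXX

noncomputable section

/-- Spin configurations of a chain with `N` sites: they label the canonical (spin) basis of
`ℋ = (ℂ²)^{⊗ N}`. The same type labels the elements `𝐡 ∈ {0,1}^N` of the SoV bases. -/
abbrev Config (N : ℕ) : Type := Fin N → Fin 2

/-- The `2^N`-dimensional space of states (and, through coordinates in the dual spin basis, the
space of covectors). The coupling of a covector and a vector is `⬝ᵥ`. -/
abbrev State (N : ℕ) : Type := Config N → ℂ

/-- `End(ℋ)`, in the spin basis. -/
abbrev Op (N : ℕ) : Type := Matrix (Config N) (Config N) ℂ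

/-- `End(ℋ₀ ⊗ ℋ)`: `2 × 2` matrices over the auxiliary space `ℋ₀ = ℂ²` with entries in `End(ℋ)`. -/
abbrev AuxOp (N : ℕ) : Type := Matrix (Fin 2) (Fin 2) (Op N)

/-- The boundary parameters `(ζ, κ, τ)` of one end of the chain. -/
abbrev BoundaryParam : Type := ℂ × ℂ × ℂ

/-- The rational 6-vertex `R`-matrix in `End(ℂ² ⊗ ℂ²)`, the basis of `ℂ² ⊗ ℂ²` being ordered as
`(0,0), (0,1), (1,0), (1,1)`. -/
def rMatrix (η lam : ℂ) : Matrix (Fin 2 × Fin 2) (Fin 2 × Fin 2) ℂ :=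
  Matrix.submatrix
    (!![lam + η, 0, 0, 0;
        0, lam, η, 0;
        0, η, lam, 0;
        0, 0, 0, lam + η] : Matrix (Fin (2 * 2)) (Fin (2 * 2)) ℂ)
    finProdFinEquiv finProdFinEquiv

/-- `R_{0n}(λ)`: the `R`-matrix acting on the auxiliary space and on site `n`, and as the identity
on all the other sites. -/
def rSite (N : ℕ) (η : ℂ) (n : Fin N) (lam : ℂ) : AuxOp N :=
  Matrix.of fun a b => Matrix.of fun s t =>
    if ∀ m, m ≠ n → s m = t m then rMatrix η lam (a, s n) (b, t n) else 0

/-- A numerical `2 × 2` matrix acting on the auxiliary space only. -/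
def auxEmb (N : ℕ) (k : Matrix (Fin 2) (Fin 2) ℂ) : AuxOp N :=
  k.map fun c => c • (1 : Op N)

/-- The bulk monodromy matrix
`M₀(λ) = R_{0N}(λ - ξ_N - η/2) ⋯ R_{01}(λ - ξ_1 - η/2)`. -/
def bulkMonodromy (N : ℕ) (η : ℂ) (ξ : Fin N → ℂ) (lam : ℂ) : AuxOp N :=
  (List.ofFn fun n : Fin N => rSite N η n (lam - ξ n - η / 2)).reverse.prod

def sigmaY : Matrix (Fin 2) (Fin 2) ℂ := !![0, -Complex.I; Complex.I, 0]

/-- `M̂₀(λ) = (-1)^N σ₀^y M₀^{t₀}(-λ) σ₀^y`. `Matrix.transpose` of an `AuxOp` exchanges the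
auxiliary indices and leaves the entries in `End(ℋ)` as they are: it is the partial transposition
`t₀`. -/
def bulkMonodromyHat (N : ℕ) (η : ℂ) (ξ : Fin N → ℂ) (lam : ℂ) : AuxOp N :=
  (-1 : ℂ) ^ N •
    (auxEmb N sigmaY * (bulkMonodromy N η ξ (-lam)).transpose * auxEmb N sigmaY)

/-- The scalar solution `K(λ; ζ, κ, τ)` of the reflection equation. -/
def kMatrix (b : BoundaryParam) (lam : ℂ) : Matrix (Fin 2) (Fin 2) ℂ :=
  (1 / b.1) •
    !![b.1 + lam, 2 * b.2.1 * Complex.exp b.2.2 * lam;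
       2 * b.2.1 * Complex.exp (-b.2.2) * lam, b.1 - lam]

/-- `K₊(λ) = K(λ + η/2; ζ₊, κ₊, τ₊)`. -/
def kPlus (η : ℂ) (bp : BoundaryParam) (lam : ℂ) : Matrix (Fin 2) (Fin 2) ℂ :=
  kMatrix bp (lam + η / 2)

/-- `K₋(λ) = K(λ - η/2; ζ₋, κ₋, τ₋)`. -/
def kMinus (η : ℂ) (bm : BoundaryParam) (lam : ℂ) : Matrix (Fin 2) (Fin 2) ℂ :=
  kMatrix bm (lam - η / 2)

/-- The boundary transfer matrix
`𝒯(λ) = tr₀ {K₊(λ) M₀(λ) K₋(λ) M̂₀(λ)} ∈ End(ℋ)`. -/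
def transferMatrix (N : ℕ) (η : ℂ) (ξ : Fin N → ℂ) (bp bm : BoundaryParam) (lam : ℂ) : Op N :=
  Matrix.trace
    (auxEmb N (kPlus η bp lam) * bulkMonodromy N η ξ lam *
      auxEmb N (kMinus η bm lam) * bulkMonodromyHat N η ξ lam)

/-- `a(λ) = ∏ₙ (λ - ξₙ + η/2)`. -/
def aFun {N : ℕ} (η : ℂ) (ξ : Fin N → ℂ) (lam : ℂ) : ℂ := ∏ n, (lam - ξ n + η / 2)

/-- `d(λ) = ∏ₙ (λ - ξₙ - η/2)`. -/
def dFun {N : ℕ} (η : ℂ) (ξ : Fin N → ℂ) (lam : ℂ) : ℂ := ∏ n, (lam - ξ n - η / 2)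

/-- `ζ̄ = ε ζ / √(1 + 4κ²)`, with a sign `ε = ±1`. -/
def zetaBar (ε : ℤˣ) (b : BoundaryParam) : ℂ :=
  ((ε : ℤ) : ℂ) * b.1 / (1 + 4 * b.2.1 ^ 2) ^ (1 / 2 : ℂ)

/-- The function `𝖠_{ζ̄₊, ζ̄₋}(λ)`. -/
def coefA {N : ℕ} (η : ℂ) (ξ : Fin N → ℂ) (zp zm lam : ℂ) : ℂ :=
  (-1) ^ N * ((2 * lam + η) / (2 * lam)) *
    ((lam - η / 2 + zp) * (lam - η / 2 + zm) / (zp * zm)) * aFun η ξ lam * dFun η ξ (-lam)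

/-- `kₙ = (ξₙ + η) / (ξₙ - η)`, as a function of `ξₙ`. -/
def kCoef (η x : ℂ) : ℂ := (x + η) / (x - η)

/-- The shifted inhomogeneities `ξₙ^{(hₙ)} = ξₙ + (1 - 2 hₙ) η/2`. -/
def shifted {N : ℕ} (η : ℂ) (ξ : Fin N → ℂ) (h : Config N) : Fin N → ℂ :=
  fun n => ξ n + (1 - 2 * ((h n : ℕ) : ℂ)) * η / 2

/-- The Vandermonde determinant `V̂(x₁, …, x_N) = det [xᵢ^{2(j-1)}]` (the indices of `Fin N` start
at `0`). -/
def vHat {N : ℕ} (x : Fin N → ℂ) : ℂ :=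
  Matrix.det (Matrix.of fun i j : Fin N => x i ^ (2 * (j : ℕ)))

/-- `N_ξ = V̂(ξ) V̂(ξ^{(0)}) / V̂(ξ^{(1)})`. -/
def normXi {N : ℕ} (η : ℂ) (ξ : Fin N → ℂ) : ℂ :=
  vHat ξ * (vHat (shifted η ξ (fun _ => 0)) / vHat (shifted η ξ (fun _ => 1)))

/-- Genericity of the inhomogeneities:
`ξⱼ, ξⱼ + ξₖ, ξⱼ - ξₖ ∉ {0, -η, η}` for all `j ≠ k`. -/
def GenericInhom {N : ℕ} (η : ℂ) (ξ : Fin N → ℂ) : Prop :=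
  (∀ j, ξ j ∉ ({0, -η, η} : Set ℂ)) ∧
    ∀ j k, j ≠ k →
      ξ j + ξ k ∉ ({0, -η, η} : Set ℂ) ∧ ξ j - ξ k ∉ ({0, -η, η} : Set ℂ)

/-- The matrix function `K(λ)` is proportional to the identity. -/
def IsScalarFun (K : ℂ → Matrix (Fin 2) (Fin 2) ℂ) : Prop :=
  ∀ lam, ∃ c : ℂ, K lam = c • (1 : Matrix (Fin 2) (Fin 2) ℂ)

/-- The covector `⟨𝐡| = ⟨S| ∏ₙ (𝒯(ξₙ - η/2) / 𝖠(η/2 - ξₙ))^{1 - hₙ}`, the product being taken in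
the order `n = 1, …, N`. -/
def covector {N : ℕ} (η : ℂ) (ξ : Fin N → ℂ) (bp bm : BoundaryParam) (εp εm : ℤˣ)
    (S : State N) (h : Config N) : State N :=
  Matrix.vecMul S
    (List.ofFn fun n : Fin N =>
      ((coefA η ξ (zetaBar εp bp) (zetaBar εm bm) (η / 2 - ξ n))⁻¹ •
        transferMatrix N η ξ bp bm (ξ n - η / 2)) ^ (1 - (h n : ℕ))).prod

/-- The vector `|𝐡⟩ = ∏ₙ (𝒯(ξₙ + η/2) / (kₙ 𝖠(η/2 - ξₙ)))^{hₙ} |R⟩`, the product being taken in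
the order `n = 1, …, N`. -/
def vector {N : ℕ} (η : ℂ) (ξ : Fin N → ℂ) (bp bm : BoundaryParam) (εp εm : ℤˣ)
    (R : State N) (h : Config N) : State N :=
  Matrix.mulVec
    (List.ofFn fun n : Fin N =>
      ((kCoef η (ξ n) * coefA η ξ (zetaBar εp bp) (zetaBar εm bm) (η / 2 - ξ n))⁻¹ •
        transferMatrix N η ξ bp bm (ξ n + η / 2)) ^ (h n : ℕ)).prod R

/-- A family of elements of `ℂ^{2^N}` is a basis. -/
def IsBasisFamily {N : ℕ} (v : Config N → State N) : Prop :=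
  LinearIndependent ℂ v ∧ Submodule.span ℂ (Set.range v) = ⊤

/-- `⟨𝐡|R⟩ = δ_{𝐡,𝟎} c` for all `𝐡`, for a family of covectors `⟨𝐡|`. -/
def IsReference {N : ℕ} (cov : Config N → State N) (c : ℂ) (R : State N) : Prop :=
  ∀ h : Config N, cov h ⬝ᵥ R = if h = (fun _ => 0) then c else 0

end

end OpenXXX

/-! Duality of the two families. For `ζ± ≠ 0`, four facts about the transfer matrices 𝒯 carry the
argument. They commute (`transferMatrix_commute`). The product 𝒯(ξₙ - η/2) 𝒯(ξₙ + η/2) is a scalar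
(`transferMatrix_fused`). Their entries are even polynomials in λ of degree at most 2N + 2 whose
coefficient in that degree is a scalar operator (`transferMatrix_neg_aux`,
`transferMatrix_isPolyLE`). Finally 𝒯(η/2) is a scalar (`transferMatrix_half`). Modulo scalars, 𝒯(λ)
is therefore the Lagrange interpolation in λ² of its values at the N points ξₙ^{(hₙ)}
(`transferMatrix_interpolate`).

On the covectors, 𝒯(ξₙ - η/2) changes the label hₙ from 1 to 0 up to normalization, and by fusion
𝒯(ξₙ + η/2) changes it from 0 to a multiple of 1. When hₙ = 1, 𝒯(ξₙ + η/2) is expanded at the points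
ξ^{(𝐡)}. An induction on the number of labels 1 in the vector shows that only the n-th interpolation
term contributes to the pairing; its coefficient is kₙ times a ratio of Vandermonde determinants,
and these ratios telescope to the measure (`sov_orthogonality`).

The facts on 𝒯 are proved by dressing K₋ with one site after another (`dressed`). Each Lax operator
is u + ηP with P a permutation, so the Yang-Baxter relation, the quantum determinant and fusion
become identities between products of transpositions in S₃, together with the vanishing of the
antisymmetrizer on three copies of ℂ². Division by factors such as λ + μ - η is avoided at
exceptional parameters by continuity.

Basis property. After denominators are cleared, the determinant of the covectors is an entire
function of the parameters, and the zero set of a nonzero entire function is a null set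
(`ae_ne_zero_of_differentiable`). A point where it does not vanish comes from the limit ξₙ = cₙ/u,
ζ₊ = 1, ζ₋ = u⁻², u → 0. There 𝒯(ξₙ - η/2), suitably rescaled, tends to the boundary matrix K₊
acting on site n alone, and a product covector built on a non-eigenvector of that matrix generates a
tensor product basis (`exists_det_rawCovector_ne_zero`). -/

namespace OpenXXX
noncomputable section

/-! ### Two auxiliary spaces -/

section Legs

variable {A : Type*} [Ring A]

/-- `X₁`: a matrix acting on the first of two auxiliary spaces. -/
def leg1 (X : Matrix (Fin 2) (Fin 2) A) : Matrix (Fin 2 × Fin 2) (Fin 2 × Fin 2) A :=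
  Matrix.of fun i j => if i.2 = j.2 then X i.1 j.1 else 0

/-- `X₂`: a matrix acting on the second of two auxiliary spaces. -/
def leg2 (X : Matrix (Fin 2) (Fin 2) A) : Matrix (Fin 2 × Fin 2) (Fin 2 × Fin 2) A :=
  Matrix.of fun i j => if i.1 = j.1 then X i.2 j.2 else 0

/-- The permutation of the two auxiliary spaces. -/
def swapAux (A : Type*) [Ring A] : Matrix (Fin 2 × Fin 2) (Fin 2 × Fin 2) A :=
  Matrix.of fun i j => if i.1 = j.2 ∧ i.2 = j.1 then 1 else 0

theorem leg1_mul (X Y : Matrix (Fin 2) (Fin 2) A) : leg1 (X * Y) = leg1 X * leg1 Y := by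
  ext ⟨a, b⟩ ⟨c, d⟩
  fin_cases a <;> fin_cases b <;> fin_cases c <;> fin_cases d <;>
    simp [leg1, Matrix.mul_apply, Fintype.sum_prod_type]

theorem leg2_mul (X Y : Matrix (Fin 2) (Fin 2) A) : leg2 (X * Y) = leg2 X * leg2 Y := by
  ext ⟨a, b⟩ ⟨c, d⟩
  fin_cases a <;> fin_cases b <;> fin_cases c <;> fin_cases d <;>
    simp [leg2, Matrix.mul_apply, Fintype.sum_prod_type]

theorem leg1_add (X Y : Matrix (Fin 2) (Fin 2) A) : leg1 (X + Y) = leg1 X + leg1 Y := by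
  ext ⟨a, b⟩ ⟨c, d⟩
  simp only [leg1, Matrix.of_apply, Matrix.add_apply]; split_ifs <;> simp

theorem leg2_add (X Y : Matrix (Fin 2) (Fin 2) A) : leg2 (X + Y) = leg2 X + leg2 Y := by
  ext ⟨a, b⟩ ⟨c, d⟩
  simp only [leg2, Matrix.of_apply, Matrix.add_apply]; split_ifs <;> simp

theorem leg1_one : leg1 (1 : Matrix (Fin 2) (Fin 2) A) = 1 := by
  ext ⟨a, b⟩ ⟨c, d⟩
  fin_cases a <;> fin_cases b <;> fin_cases c <;> fin_cases d <;> simp [leg1, Matrix.one_apply]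

theorem leg2_one : leg2 (1 : Matrix (Fin 2) (Fin 2) A) = 1 := by
  ext ⟨a, b⟩ ⟨c, d⟩
  fin_cases a <;> fin_cases b <;> fin_cases c <;> fin_cases d <;> simp [leg2, Matrix.one_apply]

theorem leg1_smul {S : Type*} [Monoid S] [DistribMulAction S A] (c : S)
    (X : Matrix (Fin 2) (Fin 2) A) : leg1 (c • X) = c • leg1 X := by
  ext ⟨a, b⟩ ⟨c, d⟩
  simp only [leg1, Matrix.of_apply, Matrix.smul_apply]; split_ifs <;> simp

theorem leg2_smul {S : Type*} [Monoid S] [DistribMulAction S A] (c : S)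
    (X : Matrix (Fin 2) (Fin 2) A) : leg2 (c • X) = c • leg2 X := by
  ext ⟨a, b⟩ ⟨c, d⟩
  simp only [leg2, Matrix.of_apply, Matrix.smul_apply]; split_ifs <;> simp

theorem swapAux_mul_self : swapAux A * swapAux A = 1 := by
  ext ⟨a, b⟩ ⟨c, d⟩
  fin_cases a <;> fin_cases b <;> fin_cases c <;> fin_cases d <;>
    simp [swapAux, Matrix.mul_apply, Fintype.sum_prod_type]

theorem swapAux_mul_apply (X : Matrix (Fin 2 × Fin 2) (Fin 2 × Fin 2) A) (i j) :
    (swapAux A * X) i j = X (i.2, i.1) j := by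
  obtain ⟨a, b⟩ := i
  fin_cases a <;> fin_cases b <;>
    simp [swapAux, Matrix.mul_apply, Fintype.sum_prod_type]

theorem mul_swapAux_apply (X : Matrix (Fin 2 × Fin 2) (Fin 2 × Fin 2) A) (i j) :
    (X * swapAux A) i j = X i (j.2, j.1) := by
  obtain ⟨a, b⟩ := j
  fin_cases a <;> fin_cases b <;>
    simp [swapAux, Matrix.mul_apply, Fintype.sum_prod_type]

theorem swapAux_mul_leg1 (X : Matrix (Fin 2) (Fin 2) A) :
    swapAux A * leg1 X = leg2 X * swapAux A := by
  ext ⟨a, b⟩ ⟨c, d⟩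
  rw [swapAux_mul_apply, mul_swapAux_apply]; simp [leg1, leg2]

theorem swapAux_mul_leg2 (X : Matrix (Fin 2) (Fin 2) A) :
    swapAux A * leg2 X = leg1 X * swapAux A := by
  ext ⟨a, b⟩ ⟨c, d⟩
  rw [swapAux_mul_apply, mul_swapAux_apply]; simp [leg1, leg2]

theorem leg1_mul_leg2_apply (X Y : Matrix (Fin 2) (Fin 2) A) (i j) :
    (leg1 X * leg2 Y) i j = X i.1 j.1 * Y i.2 j.2 := by
  obtain ⟨a, b⟩ := i; obtain ⟨c, d⟩ := j
  fin_cases a <;> fin_cases b <;> fin_cases c <;> fin_cases d <;>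
    simp [leg1, leg2, Matrix.mul_apply, Fintype.sum_prod_type]

theorem leg2_mul_leg1_apply (X Y : Matrix (Fin 2) (Fin 2) A) (i j) :
    (leg2 Y * leg1 X) i j = Y i.2 j.2 * X i.1 j.1 := by
  obtain ⟨a, b⟩ := i; obtain ⟨c, d⟩ := j
  fin_cases a <;> fin_cases b <;> fin_cases c <;> fin_cases d <;>
    simp [leg1, leg2, Matrix.mul_apply, Fintype.sum_prod_type]

/-- All entries of `X` commute with all entries of `Y`. -/
def EntriesCommute {m n : Type*} (X : Matrix m m A) (Y : Matrix n n A) : Prop :=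
  ∀ a b c d, Commute (X a b) (Y c d)

theorem EntriesCommute.leg {X Y : Matrix (Fin 2) (Fin 2) A} (h : EntriesCommute X Y) :
    leg1 X * leg2 Y = leg2 Y * leg1 X := by
  ext i j
  rw [leg1_mul_leg2_apply, leg2_mul_leg1_apply]; exact h _ _ _ _

theorem EntriesCommute.symm {m n : Type*} {X : Matrix m m A} {Y : Matrix n n A}
    (h : EntriesCommute X Y) : EntriesCommute Y X := fun a b c d => (h c d a b).symm

theorem trace_leg1 (X : Matrix (Fin 2) (Fin 2) A) :
    (leg1 X).trace = X.trace + X.trace := by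
  simp [Matrix.trace, leg1, Fintype.sum_prod_type, two_mul]; abel

theorem trace_leg1_mul_leg2 (X Y : Matrix (Fin 2) (Fin 2) A) :
    (leg1 X * leg2 Y).trace = X.trace * Y.trace := by
  simp [Matrix.trace, leg1_mul_leg2_apply, Fintype.sum_prod_type, mul_add, add_mul]
  abel

theorem trace_swapAux_mul (X Y : Matrix (Fin 2) (Fin 2) A) :
    (swapAux A * (leg1 X * leg2 Y)).trace = (X * Y).trace := by
  simp only [Matrix.trace, Matrix.diag, swapAux_mul_apply, leg1_mul_leg2_apply,
    Fintype.sum_prod_type, Fin.sum_univ_two]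
  simp only [Matrix.mul_apply, Fin.sum_univ_two]
  abel

/-- The entries are operators on the chain, so cyclicity of the auxiliary trace can fail.
Commutation of the entries of one factor with those of the other restores it. -/
theorem trace_mul_comm_of_entriesCommute {n : Type*} [Fintype n] {X Y : Matrix n n A}
    (h : EntriesCommute X Y) : (X * Y).trace = (Y * X).trace := by
  simp only [Matrix.trace, Matrix.diag, Matrix.mul_apply]
  rw [Finset.sum_comm]
  exact Finset.sum_congr rfl fun i _ => Finset.sum_congr rfl fun j _ => h _ _ _ _

end Legs

section Embed

variable {A : Type*} [Ring A] [Algebra ℂ A]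

/-- A numerical matrix, with entries viewed in the algebra `A`. -/
def numMat (A : Type*) [Ring A] [Algebra ℂ A] {n : Type*} [Fintype n] [DecidableEq n] :
    Matrix n n ℂ →+* Matrix n n A := (algebraMap ℂ A).mapMatrix

theorem numMat_apply {n : Type*} [Fintype n] [DecidableEq n] (k : Matrix n n ℂ) (i j : n) :
    numMat A k i j = algebraMap ℂ A (k i j) := rfl

theorem numMat_smul {n : Type*} [Fintype n] [DecidableEq n] (c : ℂ) (k : Matrix n n ℂ) :
    numMat A (c • k) = c • numMat A k := by
  ext i j
  rw [numMat_apply, Matrix.smul_apply, Matrix.smul_apply, smul_eq_mul, map_mul, numMat_apply,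
    Algebra.smul_def]

end Embed

/-! ### The two-dimensional site -/

section Site

variable {A : Type*} [Ring A]

/-- The elements `e a b` of `A` multiply as the `2 × 2` matrix units. -/
structure IsMatrixUnits (e : Fin 2 → Fin 2 → A) : Prop where
  mul : ∀ a b c d, e a b * e c d = if b = c then e a d else 0
  sum : e 0 0 + e 1 1 = 1

/-- The permutation of the auxiliary space with the site whose matrix units are `e`. -/
def permSite (e : Fin 2 → Fin 2 → A) : Matrix (Fin 2) (Fin 2) A := Matrix.of fun a b => e b a

variable {e : Fin 2 → Fin 2 → A} (he : IsMatrixUnits e)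

include he in
theorem permSite_mul_self : permSite e * permSite e = 1 := by
  have h := he.sum
  have h' : e 1 1 + e 0 0 = 1 := by rw [add_comm, h]
  ext a b
  fin_cases a <;> fin_cases b <;> simp [permSite, Matrix.mul_apply, he.mul, h]

include he in
theorem leg1_mul_leg2_permSite :
    leg1 (permSite e) * leg2 (permSite e) = swapAux A * leg1 (permSite e) := by
  ext i j
  rw [leg1_mul_leg2_apply, swapAux_mul_apply]
  simp [permSite, leg1, he.mul]

include he in
theorem leg2_mul_leg1_permSite :
    leg2 (permSite e) * leg1 (permSite e) = swapAux A * leg2 (permSite e) := by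
  ext i j
  rw [leg2_mul_leg1_apply, swapAux_mul_apply]
  simp [permSite, leg2, he.mul, eq_comm]

include he in
-- This is the signed sum over S₃ acting on three copies of ℂ², which vanishes because there are no
-- nonzero antisymmetric tensors of rank 3 in dimension 2.
theorem antisymmetrizer_three :
    1 - swapAux A - leg1 (permSite e) - leg2 (permSite e) +
      leg1 (permSite e) * leg2 (permSite e) + leg2 (permSite e) * leg1 (permSite e) = 0 := by
  have h := he.sum
  have h' : e 1 1 = 1 - e 0 0 := by rw [← h]; abel
  ext ⟨a, b⟩ ⟨c, d⟩
  simp only [Matrix.add_apply, Matrix.sub_apply, leg1_mul_leg2_apply, leg2_mul_leg1_apply]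
  simp only [permSite, Matrix.of_apply, he.mul, leg1, leg2, swapAux, Matrix.one_apply]
  fin_cases a <;> fin_cases b <;> fin_cases c <;> fin_cases d <;> simp [h']
  abel

end Site

/-! ### Yang-Baxter relations as identities between transpositions. -/

section YangBaxter

variable {A : Type*} [Ring A] [Algebra ℂ A]

/-- The `R`-matrix `u + η P₁₂` on the two auxiliary spaces. -/
def rAux (A : Type*) [Ring A] [Algebra ℂ A] (η u : ℂ) :
    Matrix (Fin 2 × Fin 2) (Fin 2 × Fin 2) A := u • 1 + η • swapAux A

/-- The Lax operator `u + η P` of the site whose matrix units are `e`. -/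
def lax (η : ℂ) (e : Fin 2 → Fin 2 → A) (u : ℂ) : Matrix (Fin 2) (Fin 2) A :=
  u • 1 + η • permSite e

theorem leg1_lax (η : ℂ) (e : Fin 2 → Fin 2 → A) (u : ℂ) :
    leg1 (lax η e u) = u • 1 + η • leg1 (permSite e) := by
  rw [lax, leg1_add, leg1_smul, leg1_smul, leg1_one]

theorem leg2_lax (η : ℂ) (e : Fin 2 → Fin 2 → A) (u : ℂ) :
    leg2 (lax η e u) = u • 1 + η • leg2 (permSite e) := by
  rw [lax, leg2_add, leg2_smul, leg2_smul, leg2_one]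

/-- Products of the transpositions `p = (12)`, `a = (13)`, `b = (23)` of the symmetric group. -/
structure IsTranspositions {B : Type*} [Ring B] (p a b : B) : Prop where
  pp : p * p = 1
  aa : a * a = 1
  bb : b * b = 1
  ab : a * b = p * a
  ba : b * a = p * b
  ap : a * p = p * b
  bp : b * p = p * a

omit [Algebra ℂ A] in
theorem isTranspositions {e : Fin 2 → Fin 2 → A} (he : IsMatrixUnits e) :
    IsTranspositions (swapAux A) (leg1 (permSite e)) (leg2 (permSite e)) where
  pp := swapAux_mul_self
  aa := by rw [← leg1_mul, permSite_mul_self he, leg1_one]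
  bb := by rw [← leg2_mul, permSite_mul_self he, leg2_one]
  ab := leg1_mul_leg2_permSite he
  ba := leg2_mul_leg1_permSite he
  ap := (swapAux_mul_leg2 _).symm
  bp := (swapAux_mul_leg1 _).symm

section

variable {B : Type*} [Ring B] [Algebra ℂ B] {p a b : B} (h : IsTranspositions p a b)

include h in
-- The relations bring every word to one of 1, p, a, b, pa, pb; what remains is a comparison of
-- coefficients in the group algebra of S₃.
theorem IsTranspositions.yangBaxter (η u v : ℂ) :
    ((u - v) • 1 + η • p) * (u • 1 + η • a) * (v • 1 + η • b) =
      (v • 1 + η • b) * (u • 1 + η • a) * ((u - v) • 1 + η • p) := by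
  have h1 : ∀ x, p * (p * x) = x := fun x => by rw [← mul_assoc, h.pp, one_mul]
  simp only [add_mul, mul_add, smul_mul_assoc, mul_smul_comm, one_mul, mul_one,
    mul_assoc, h.ab, h.ba, h.ap, h.bp, h1]
  module

include h in
theorem IsTranspositions.yangBaxter' (η w z : ℂ) :
    (w • 1 + η • a) * ((w + z) • 1 + η • p) * (z • 1 + η • b) =
      (z • 1 + η • b) * ((w + z) • 1 + η • p) * (w • 1 + η • a) := by
  simp only [add_mul, mul_add, smul_mul_assoc, mul_smul_comm, one_mul, mul_one,
    mul_assoc, h.ab, h.ba, h.ap, h.bp, h.aa, h.bb]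
  module

end

variable {e : Fin 2 → Fin 2 → A} (he : IsMatrixUnits e)

include he in
theorem rAux_lax_lax (η : ℂ) {d u v : ℂ} (hd : d = u - v) :
    rAux A η d * leg1 (lax η e u) * leg2 (lax η e v) =
      leg2 (lax η e v) * leg1 (lax η e u) * rAux A η d := by
  subst hd
  rw [leg1_lax, leg2_lax]
  exact (isTranspositions he).yangBaxter η u v

include he in
theorem lax_rAux_lax (η : ℂ) {s w z : ℂ} (hs : s = w + z) :
    leg1 (lax η e w) * rAux A η s * leg2 (lax η e z) =
      leg2 (lax η e z) * rAux A η s * leg1 (lax η e w) := by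
  subst hs
  rw [leg1_lax, leg2_lax]
  exact (isTranspositions he).yangBaxter' η w z

end YangBaxter

/-! ### The reflection equation and its dressing -/

/-- The exchange of the two boundary operators `u`, `v`, dressed by `x, x'` and `y, y'`. -/
theorem reflection_product {B : Type*} [Monoid B] {x x' y y' s u v : B}
    (h1 : x' * s * y = y * s * x') (h2 : Commute u y) (h3 : Commute x' v) :
    x * u * x' * s * (y * v * y') = x * y * (u * s * v) * (x' * y') := by
  calc x * u * x' * s * (y * v * y') = x * u * (x' * s * y) * v * y' := by simp only [mul_assoc]
    _ = x * (u * y) * s * (x' * v) * y' := by rw [h1]; simp only [mul_assoc]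
    _ = x * y * (u * s * v) * (x' * y') := by rw [h2.eq, h3.eq]; simp only [mul_assoc]

/-- Sklyanin's dressing: the Yang-Baxter relations gather the four dressing factors outside, the
reflection equation is applied to the inner operators u, v, and the factors are put back in the
opposite order. -/
theorem reflection_dress {B : Type*} [Monoid B] {r x x' y y' s u v : B}
    (h : r * u * s * v = v * s * u * r)
    (hxy : r * x * y = y * x * r) (hxy' : r * x' * y' = y' * x' * r)
    (h1 : x' * s * y = y * s * x') (h1' : x * s * y' = y' * s * x)
    (h2 : Commute u y) (h3 : Commute x' v) (h2' : Commute v x) (h3' : Commute y' u) :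
    r * (x * u * x') * s * (y * v * y') = y * v * y' * s * (x * u * x') * r := by
  calc r * (x * u * x') * s * (y * v * y') = r * (x * u * x' * s * (y * v * y')) := by
        simp only [mul_assoc]
    _ = (r * x * y) * (u * s * v) * (x' * y') := by
        rw [reflection_product h1 h2 h3]; simp only [mul_assoc]
    _ = y * x * (r * u * s * v) * (x' * y') := by rw [hxy]; simp only [mul_assoc]
    _ = y * x * (v * s * u) * (r * x' * y') := by rw [h]; simp only [mul_assoc]
    _ = y * x * (v * s * u) * (y' * x') * r := by rw [hxy']; simp only [mul_assoc]
    _ = y * v * y' * s * (x * u * x') * r := by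
        rw [← reflection_product h1'.symm h2' h3']


/-! ### Commutativity, quantum determinant and parity of the boundary operators -/

section Scalar

variable {B : Type*} [Ring B] [Algebra ℂ B] {p k l : B} {c : ℂ}

/-- The reflection equation for `K(g) = 1 + g k` with `k² = c`. -/
theorem reflection_scalar (hp : p * p = 1) (hk : k * k = c • 1) (hl : l * l = c • 1)
    (hkl : l * k = k * l) (hkp : k * p = p * l) (hlp : l * p = p * k) (η g h : ℂ) :
    ((g - h) • 1 + η • p) * (1 + g • k) * ((g + h) • 1 + η • p) * (1 + h • l) =
      (1 + h • l) * ((g + h) • 1 + η • p) * (1 + g • k) * ((g - h) • 1 + η • p) := by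
  have h1 : ∀ x, p * (p * x) = x := fun x => by rw [← mul_assoc, hp, one_mul]
  have h2 : ∀ x, k * (p * x) = p * (l * x) := fun x => by rw [← mul_assoc, hkp, mul_assoc]
  simp only [add_mul, mul_add, smul_mul_assoc, mul_smul_comm, smul_smul, one_mul, mul_one,
    mul_assoc, hp, hk, hl, hkl, hkp, hlp, h1, h2]
  module

/-- Both (1 - p)p = -(1 - p) and (1 - p)kp = (1 - p)k hold, so the R-factor acts on the two terms by
the numbers 2g and 2(g + η). The terms linear in k and l then cancel, and kl contributes -c. This is
the quantum determinant of a boundary matrix. -/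
theorem antisymmetrizer_scalar (hp : p * p = 1) (hl : l * l = c • 1) (hkp : k * p = p * l)
    (hkl : (1 - p) * k = -((1 - p) * l)) (η g : ℂ) :
    (1 - p) * (1 + g • k) * ((2 * g + η) • 1 + η • p) * (1 + (g + η) • l) =
      (2 * g * (1 - (g + η) ^ 2 * c)) • (1 - p) := by
  have hap : (1 - p) * p = -(1 - p) := by rw [sub_mul, hp]; simp
  have hakp : (1 - p) * k * p = (1 - p) * k := by
    rw [mul_assoc, hkp, ← mul_assoc, hap, neg_mul, hkl]
  have hakl : (1 - p) * k * l = (-c) • (1 - p) := by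
    rw [hkl, neg_mul, mul_assoc, hl]; simp
  have key : (1 - p) * (1 + g • k) * ((2 * g + η) • 1 + η • p) =
      (2 * g) • (1 - p) + (2 * g * (g + η)) • ((1 - p) * k) := by
    simp only [mul_add, mul_one, add_mul, mul_smul_comm, smul_mul_assoc, hap, hakp]
    module
  rw [key]
  have hal : (1 - p) * l = -((1 - p) * k) := by rw [hkl, neg_neg]
  simp only [mul_add, mul_one, add_mul, mul_smul_comm, smul_mul_assoc, hakl, hal]
  module

/-- The quantum determinant of one Lax operator: `h3` eliminates the word pb, and at spectral
parameters differing by η all that is left is a multiple of 1 - p. -/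
theorem IsTranspositions.antisymmetrizer {a b : B} (h : IsTranspositions p a b)
    (h3 : 1 - p - a - b + a * b + b * a = 0) (η v : ℂ) :
    (1 - p) * (v • 1 + η • a) * ((v + η) • 1 + η • b) = (v * (v + 2 * η)) • (1 - p) := by
  have h1 : ∀ x, p * (p * x) = x := fun x => by rw [← mul_assoc, h.pp, one_mul]
  have hb : p * b = -(1 - p - a - b + p * a) := by
    rw [h.ab, h.ba] at h3; rw [← sub_eq_zero, ← h3]; abel
  simp only [sub_mul, add_mul, mul_add, smul_mul_assoc, mul_smul_comm, one_mul, mul_one,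
    mul_assoc, h.ab, h1, hb]
  module

/-- At argument 0 the second Lax operator is a pure permutation, and ab = bp moves the
antisymmetrizer to the right end of the product. This is the origin of fusion at an inhomogeneity.
-/
theorem IsTranspositions.antisymmetrizer_fused {a b : B} (h : IsTranspositions p a b) (η : ℂ) :
    ((-η) • 1 + η • a) * ((0 : ℂ) • 1 + η • b) = (-η ^ 2) • (b * (1 - p)) := by
  simp only [add_mul, mul_add, smul_mul_assoc, mul_smul_comm, one_mul, mul_one, mul_sub,
    h.ab, h.bp]
  module

end Scalar

section Abstract

variable {A : Type*} [Ring A] [Algebra ℂ A]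

/-- `X` is a matrix with central entries, of vanishing trace and with `X² = c`. -/
structure IsBoundary (k : Matrix (Fin 2) (Fin 2) A) (c : ℂ) : Prop where
  central : ∀ a b x, Commute (k a b) x
  trace : k 1 1 = -k 0 0
  sq : k * k = c • 1

variable {k : Matrix (Fin 2) (Fin 2) A} {c : ℂ}

theorem IsBoundary.entriesCommute {n : Type*} (hk : IsBoundary k c) (X : Matrix n n A) :
    EntriesCommute k X := fun _ _ _ _ => hk.central _ _ _

theorem IsBoundary.leg_comm (hk : IsBoundary k c) : leg2 k * leg1 k = leg1 k * leg2 k :=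
  (hk.entriesCommute k).leg.symm

theorem IsBoundary.leg1_sq (hk : IsBoundary k c) : leg1 k * leg1 k = c • 1 := by
  rw [← leg1_mul, hk.sq, leg1_smul, leg1_one]

theorem IsBoundary.leg2_sq (hk : IsBoundary k c) : leg2 k * leg2 k = c • 1 := by
  rw [← leg2_mul, hk.sq, leg2_smul, leg2_one]

theorem IsBoundary.antisymmetrizer (hk : IsBoundary k c) :
    (1 - swapAux A) * leg1 k = -((1 - swapAux A) * leg2 k) := by
  have h := hk.trace
  ext ⟨i, j⟩ ⟨m, n⟩
  simp only [sub_mul, one_mul, Matrix.sub_apply, Matrix.neg_apply, swapAux_mul_apply]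
  fin_cases i <;> fin_cases j <;> fin_cases m <;> fin_cases n <;> simp [leg1, leg2, h]

theorem leg1_one_add (g : ℂ) : leg1 (1 + g • k) = 1 + g • leg1 k := by
  rw [leg1_add, leg1_one, leg1_smul]

theorem leg2_one_add (g : ℂ) : leg2 (1 + g • k) = 1 + g • leg2 k := by
  rw [leg2_add, leg2_one, leg2_smul]

theorem IsBoundary.reflection (hk : IsBoundary k c) (η g h : ℂ) :
    rAux A η (g - h) * leg1 (1 + g • k) * rAux A η (g + h) * leg2 (1 + h • k) =
      leg2 (1 + h • k) * rAux A η (g + h) * leg1 (1 + g • k) * rAux A η (g - h) := by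
  rw [leg1_one_add, leg2_one_add]
  exact reflection_scalar swapAux_mul_self hk.leg1_sq hk.leg2_sq hk.leg_comm
    (swapAux_mul_leg2 _).symm (swapAux_mul_leg1 _).symm η g h

omit [Algebra ℂ A] in
theorem entriesCommute_swapAux {n : Type*} (X : Matrix n n A) : EntriesCommute (swapAux A) X := by
  intro a b c d
  simp only [swapAux, Matrix.of_apply]
  split_ifs
  exacts [Commute.one_left _, Commute.zero_left _]

theorem entriesCommute_rAux {n : Type*} (η u : ℂ) (X : Matrix n n A) :
    EntriesCommute (rAux A η u) X := by
  intro a b c d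
  simp only [rAux, Matrix.add_apply, Matrix.smul_apply, Matrix.one_apply]
  refine Commute.add_left (Commute.smul_left ?_ _)
    (Commute.smul_left (entriesCommute_swapAux X _ _ _ _) _)
  split_ifs
  exacts [Commute.one_left _, Commute.zero_left _]

omit [Algebra ℂ A] in
theorem trace_leg2 (X : Matrix (Fin 2) (Fin 2) A) :
    (leg2 X).trace = X.trace + X.trace := by
  have h := trace_leg1_mul_leg2 (1 : Matrix (Fin 2) (Fin 2) A) X
  rw [leg1_one, one_mul] at h
  rw [h, Matrix.trace_one]; simp [two_mul]

/-- The product of two boundary transfer matrices as a trace over two auxiliary spaces. -/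
theorem trace_mul_trace {G H U W : Matrix (Fin 2) (Fin 2) A}
    (hH : ∀ a b x, Commute (H a b) x) (η s : ℂ) :
    (leg2 H * rAux A (-η) (s + 2 * η) * leg1 G * (leg1 U * rAux A η s * leg2 W)).trace =
      (s * (s + 2 * η)) • ((G * U).trace * (H * W).trace) := by
  have hHG : EntriesCommute (G * U) H := fun a b c d => (hH c d _).symm
  have t1 : (leg2 H * (leg1 G * (leg1 U * leg2 W))).trace = (G * U).trace * (H * W).trace := by
    rw [← mul_assoc (leg1 G), ← leg1_mul, ← mul_assoc, ← hHG.leg, mul_assoc, ← leg2_mul,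
      trace_leg1_mul_leg2]
  have t2 : (leg2 H * (swapAux A * (leg1 G * (leg1 U * leg2 W)))).trace =
      (H * (G * (U * W))).trace := by
    rw [← mul_assoc (leg2 H), ← swapAux_mul_leg1, mul_assoc, ← mul_assoc (leg1 G), ← leg1_mul,
      ← mul_assoc (leg1 H), ← leg1_mul, trace_swapAux_mul]
    simp only [mul_assoc]
  have hUW : EntriesCommute (G * (U * W)) H := fun a b c d => (hH c d _).symm
  have t3 : (leg2 H * (leg1 G * (leg1 U * (swapAux A * leg2 W)))).trace =
      (H * (G * (U * W))).trace := by
    rw [swapAux_mul_leg2, ← mul_assoc (leg1 U), ← leg1_mul, ← mul_assoc (leg1 G), ← leg1_mul,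
      ← mul_assoc (leg2 H), ← hUW.leg,
      ← trace_mul_comm_of_entriesCommute (entriesCommute_swapAux _), trace_swapAux_mul,
      trace_mul_comm_of_entriesCommute hUW]
  have t4 : (leg2 H * (swapAux A * (leg1 G * (leg1 U * (swapAux A * leg2 W))))).trace =
      2 • (H * (G * (U * W))).trace := by
    rw [swapAux_mul_leg2, ← mul_assoc (leg1 U), ← leg1_mul, ← mul_assoc (leg1 G), ← leg1_mul,
      ← mul_assoc (leg2 H), ← swapAux_mul_leg1, mul_assoc, ← mul_assoc (leg1 H), ← leg1_mul,
      trace_mul_comm_of_entriesCommute (entriesCommute_swapAux _), mul_assoc, swapAux_mul_self,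
      mul_one, trace_leg1, two_smul]
  -- The total coefficient of tr(HGUW) is η(s + 2η) - ηs - 2η² = 0; the shift by 2η in the first
  -- R-matrix is chosen for this cancellation.
  simp only [rAux, add_mul, mul_add, smul_mul_assoc, mul_smul_comm, mul_one, mul_assoc,
    Matrix.trace_add, Matrix.trace_smul, t1, t2, t3, t4]
  module

/-- Conjugation by the permutation of the auxiliary spaces reduces this to `trace_mul_trace`. -/
theorem trace_mul_trace_swap {G H U W : Matrix (Fin 2) (Fin 2) A}
    (hG : ∀ a b x, Commute (G a b) x) (η s : ℂ) :
    (leg1 G * rAux A (-η) (s + 2 * η) * leg2 H * (leg2 W * rAux A η s * leg1 U)).trace =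
      (s * (s + 2 * η)) • ((H * W).trace * (G * U).trace) := by
  rw [← trace_mul_trace hG]
  have hr : ∀ η u, swapAux A * rAux A η u = rAux A η u * swapAux A := fun η u => by
    simp only [rAux, mul_add, add_mul, mul_smul_comm, smul_mul_assoc, mul_one, one_mul]
  have h : leg1 G * rAux A (-η) (s + 2 * η) * leg2 H * (leg2 W * rAux A η s * leg1 U) =
      leg1 G * rAux A (-η) (s + 2 * η) * leg2 H * (leg2 W * rAux A η s * leg1 U)
        * swapAux A * swapAux A := by rw [mul_assoc _ (swapAux A), swapAux_mul_self, mul_one]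
  rw [h, ← trace_mul_comm_of_entriesCommute (entriesCommute_swapAux _)]
  congr 1
  rw [← mul_assoc]
  have e1 : ∀ X Y, swapAux A * (leg1 X * Y) = leg2 X * (swapAux A * Y) := fun X Y => by
    rw [← mul_assoc, swapAux_mul_leg1, mul_assoc]
  have e2 : ∀ X Y, swapAux A * (leg2 X * Y) = leg1 X * (swapAux A * Y) := fun X Y => by
    rw [← mul_assoc, swapAux_mul_leg2, mul_assoc]
  have e3 : ∀ η u Y, swapAux A * (rAux A η u * Y) = rAux A η u * (swapAux A * Y) := fun η u Y => by
    rw [← mul_assoc, hr, mul_assoc]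
  simp only [mul_assoc, e1, e2, e3, swapAux_mul_self, mul_one]

theorem rAux_mul_rAux_neg (η d : ℂ) :
    rAux A (-η) d * rAux A η d = (d ^ 2 - η ^ 2) • 1 := by
  simp only [rAux, add_mul, mul_add, smul_mul_assoc, mul_smul_comm, one_mul, mul_one,
    swapAux_mul_self]
  module

/-- Two transfer matrices built on solutions of the reflection equation commute. -/
theorem transfer_commute (hk : IsBoundary k c) {U W : Matrix (Fin 2) (Fin 2) A} {η g h : ℂ}
    (hRE : rAux A η (g - h) * leg1 U * rAux A η (g + h - 2 * η) * leg2 W =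
      leg2 W * rAux A η (g + h - 2 * η) * leg1 U * rAux A η (g - h)) :
    (((g - h) ^ 2 - η ^ 2) * ((g + h - 2 * η) * (g + h))) •
        (((1 + g • k) * U).trace * ((1 + h • k) * W).trace) =
      (((g - h) ^ 2 - η ^ 2) * ((g + h - 2 * η) * (g + h))) •
        (((1 + h • k) * W).trace * ((1 + g • k) * U).trace) := by
  have hc : ∀ g : ℂ, ∀ a b x, Commute ((1 + g • k) a b) x := fun g a b x => by
    simp only [Matrix.add_apply, Matrix.smul_apply, Matrix.one_apply]
    refine Commute.add_left ?_ ((hk.central _ _ _).smul_left _)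
    split_ifs
    exacts [Commute.one_left _, Commute.zero_left _]
  -- The equation needed on the K₊ side is the reflection equation with η replaced by -η.
  have hdual := hk.reflection (-η) g h
  have h1 := trace_mul_trace (G := 1 + g • k) (hc h) η (g + h - 2 * η) (U := U) (W := W)
  have h2 := trace_mul_trace_swap (H := 1 + h • k) (hc g) η (g + h - 2 * η) (U := U) (W := W)
  rw [sub_add_cancel] at h1 h2
  rw [mul_smul ((g - h) ^ 2 - η ^ 2), mul_smul ((g - h) ^ 2 - η ^ 2), ← h1, ← h2]
  set C := leg2 (1 + h • k) * rAux A (-η) (g + h) * leg1 (1 + g • k) with hC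
  set C' := leg1 (1 + g • k) * rAux A (-η) (g + h) * leg2 (1 + h • k) with hC'
  have hCC : C * rAux A (-η) (g - h) = rAux A (-η) (g - h) * C' := by
    rw [hC, hC', ← hdual]; simp only [mul_assoc]
  set Y := leg1 U * rAux A η (g + h - 2 * η) * leg2 W with hY
  set Y' := leg2 W * rAux A η (g + h - 2 * η) * leg1 U with hY'
  have hYY : rAux A η (g - h) * Y = Y' * rAux A η (g - h) := by
    rw [hY, hY', ← hRE]; simp only [mul_assoc]
  have hr := rAux_mul_rAux_neg (A := A) η (g - h)
  have hr' : rAux A η (g - h) * rAux A (-η) (g - h) = ((g - h) ^ 2 - η ^ 2) • 1 := by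
    have := rAux_mul_rAux_neg (A := A) (-η) (g - h)
    rwa [neg_neg, neg_sq] at this
  clear_value C C' Y Y'
  -- Inserting the product of the two R-matrices costs a scalar. One of them is then carried through
  -- the K₊ part by the dual equation, the other through the dressed part by `hRE`, and they meet
  -- again by cyclicity.
  calc ((g - h) ^ 2 - η ^ 2) • (C * Y).trace
      = (C * (rAux A (-η) (g - h) * rAux A η (g - h)) * Y).trace := by
        rw [hr, ← Matrix.trace_smul]; simp
    _ = (rAux A (-η) (g - h) * (C' * Y' * rAux A η (g - h))).trace := by
        congr 1
        rw [← mul_assoc C, hCC]; simp only [mul_assoc, hYY]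
    _ = (C' * Y' * (rAux A η (g - h) * rAux A (-η) (g - h))).trace := by
        rw [trace_mul_comm_of_entriesCommute (entriesCommute_rAux _ _ _), mul_assoc]
    _ = ((g - h) ^ 2 - η ^ 2) • (C' * Y').trace := by
        rw [hr', ← Matrix.trace_smul]; simp

end Abstract


/-! ### Quantum determinants and fusion at an inhomogeneity. -/

section Fusion

variable {A : Type*} [Ring A] [Algebra ℂ A] {k : Matrix (Fin 2) (Fin 2) A} {c : ℂ}

/-- The antisymmetrizer (up to a factor `2`) of the two auxiliary spaces. -/
def asymAux (A : Type*) [Ring A] : Matrix (Fin 2 × Fin 2) (Fin 2 × Fin 2) A := 1 - swapAux A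

theorem entriesCommute_asymAux {n : Type*} (X : Matrix n n A) : EntriesCommute (asymAux A) X := by
  have h : asymAux A = rAux A (-1) 1 := by simp [asymAux, rAux, sub_eq_add_neg]
  rw [h]; exact entriesCommute_rAux _ _ _

theorem IsBoundary.qdet_minus (hk : IsBoundary k c) (η g : ℂ) :
    asymAux A * leg1 (1 + g • k) * rAux A η (2 * g + η) * leg2 (1 + (g + η) • k) =
      (2 * g * (1 - (g + η) ^ 2 * c)) • asymAux A := by
  rw [leg1_one_add, leg2_one_add]
  exact antisymmetrizer_scalar swapAux_mul_self hk.leg2_sq (swapAux_mul_leg2 _).symm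
    hk.antisymmetrizer η g

/-- The computation behind `qdet_minus`, with the legs exchanged, η replaced by -η and g by g + η.
-/
theorem IsBoundary.qdet_plus (hk : IsBoundary k c) (η g : ℂ) :
    asymAux A * (leg2 (1 + (g + η) • k) * rAux A (-η) (2 * g + η) * leg1 (1 + g • k)) =
      (2 * (g + η) * (1 - g ^ 2 * c)) • asymAux A := by
  have h := antisymmetrizer_scalar (p := swapAux A) (k := leg2 k) (l := leg1 k) (c := c)
    swapAux_mul_self hk.leg1_sq (swapAux_mul_leg1 _).symm
    (by rw [hk.antisymmetrizer, neg_neg]) (-η) (g + η)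
  rw [show g + η + -η = g by ring, show 2 * (g + η) + -η = 2 * g + η by ring] at h
  rw [leg1_one_add, leg2_one_add, ← mul_assoc, ← mul_assoc]
  exact h

variable {e : Fin 2 → Fin 2 → A} (he : IsMatrixUnits e)

include he in
theorem asymAux_lax (η v : ℂ) :
    asymAux A * (leg1 (lax η e v) * leg2 (lax η e (v + η))) =
      (v * (v + 2 * η)) • asymAux A := by
  rw [leg1_lax, leg2_lax, ← mul_assoc]
  exact (isTranspositions he).antisymmetrizer (antisymmetrizer_three he) η v

include he in
theorem lax_fused (η : ℂ) :
    leg1 (lax η e (-η)) * leg2 (lax η e 0) = (-η ^ 2) • (leg2 (permSite e) * asymAux A) := by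
  rw [leg1_lax, leg2_lax]
  exact (isTranspositions he).antisymmetrizer_fused η

omit [Algebra ℂ A] in
include he in
theorem trace_asymAux_permSite : (asymAux A * leg2 (permSite e)).trace = 1 := by
  have hp : (permSite e).trace = 1 := by
    rw [Matrix.trace_fin_two]; exact he.sum
  have h := trace_swapAux_mul (1 : Matrix (Fin 2) (Fin 2) A) (permSite e)
  rw [leg1_one, one_mul, one_mul] at h
  rw [asymAux, sub_mul, one_mul, Matrix.trace_sub, trace_leg2, h, hp]; abel

theorem entriesCommute_lax {n : Type*} {X : Matrix n n A}
    (h : ∀ a b i j, Commute (e a b) (X i j)) (η u : ℂ) : EntriesCommute (lax η e u) X := by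
  intro a b i j
  simp only [lax, Matrix.add_apply, Matrix.smul_apply, Matrix.one_apply, permSite, Matrix.of_apply]
  refine Commute.add_left (Commute.smul_left ?_ _) ((h _ _ _ _).smul_left _)
  split_ifs
  exacts [Commute.one_left _, Commute.zero_left _]

/-- Exchange of the dressed boundary operators at the spectral parameters `λ, μ`. -/
theorem dress_product (he : IsMatrixUnits e) {U W : Matrix (Fin 2) (Fin 2) A}
    (hU : ∀ a b i j, Commute (e a b) (U i j)) (hW : ∀ a b i j, Commute (e a b) (W i j))
    (η u u' v v' : ℂ) {s : ℂ} (hs : s = u' + v) :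
    leg1 (lax η e u * U * lax η e u') * rAux A η s * leg2 (lax η e v * W * lax η e v') =
      (leg1 (lax η e u) * leg2 (lax η e v)) * (leg1 U * rAux A η s * leg2 W) *
        (leg1 (lax η e u') * leg2 (lax η e v')) := by
  simp only [leg1_mul, leg2_mul]
  exact reflection_product (lax_rAux_lax he η hs)
    (entriesCommute_lax hU η v).symm.leg (entriesCommute_lax hW η u').leg

theorem reflection_dress_lax (he : IsMatrixUnits e) {U W : Matrix (Fin 2) (Fin 2) A}
    (hU : ∀ a b i j, Commute (e a b) (U i j)) (hW : ∀ a b i j, Commute (e a b) (W i j))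
    {η d s u u' v v' : ℂ} (hd : d = u - v) (hd' : d = u' - v') (hs : s = u' + v)
    (h : rAux A η d * leg1 U * rAux A η s * leg2 W = leg2 W * rAux A η s * leg1 U * rAux A η d) :
    rAux A η d * leg1 (lax η e u * U * lax η e u') * rAux A η s *
        leg2 (lax η e v * W * lax η e v') =
      leg2 (lax η e v * W * lax η e v') * rAux A η s * leg1 (lax η e u * U * lax η e u') *
        rAux A η d := by
  simp only [leg1_mul, leg2_mul]
  exact reflection_dress h (rAux_lax_lax he η hd) (rAux_lax_lax he η hd')
    (lax_rAux_lax he η hs)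
    (lax_rAux_lax he η (by rw [hs, ← sub_eq_zero]; linear_combination hd - hd'))
    (entriesCommute_lax hU η v).symm.leg (entriesCommute_lax hW η u').leg
    ((entriesCommute_lax hW η u).leg).symm ((entriesCommute_lax hU η v').symm.leg).symm

/-- Quantum determinants are multiplicative: the antisymmetrizer passes through the left Lax pair,
the inner operators and the right Lax pair, collecting one scalar from each. -/
theorem qdet_dress (he : IsMatrixUnits e) {U W : Matrix (Fin 2) (Fin 2) A}
    (hU : ∀ a b i j, Commute (e a b) (U i j)) (hW : ∀ a b i j, Commute (e a b) (W i j))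
    (η u u' : ℂ) {s q : ℂ} (hs : s = u' + (u + η))
    (h : asymAux A * (leg1 U * rAux A η s * leg2 W) = q • asymAux A) :
    asymAux A * (leg1 (lax η e u * U * lax η e u') * rAux A η s *
        leg2 (lax η e (u + η) * W * lax η e (u' + η))) =
      (u * (u + 2 * η) * q * (u' * (u' + 2 * η))) • asymAux A := by
  rw [dress_product he hU hW η u u' _ _ hs, ← mul_assoc (asymAux A),
    ← mul_assoc (asymAux A), asymAux_lax he,
    smul_mul_assoc, h, smul_mul_assoc, smul_mul_assoc, asymAux_lax he, smul_smul, smul_smul,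
    mul_assoc]

/-- The fusion structure at the inhomogeneity of the site with matrix units `f`. -/
def IsFused (f : Fin 2 → Fin 2 → A) (Y : Matrix (Fin 2 × Fin 2) (Fin 2 × Fin 2) A) : Prop :=
  ∃ (X : Matrix (Fin 2 × Fin 2) (Fin 2 × Fin 2) A) (q : ℂ),
    Y = X * leg2 (permSite f) * asymAux A ∧ asymAux A * X = q • asymAux A

/-- The left Lax pair of the site itself ends in the antisymmetrizer by `lax_fused`; the remaining
factors are then absorbed as quantum determinants. -/
theorem isFused_start (he : IsMatrixUnits e) {U W : Matrix (Fin 2) (Fin 2) A}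
    (hU : ∀ a b i j, Commute (e a b) (U i j)) (hW : ∀ a b i j, Commute (e a b) (W i j))
    (η u' : ℂ) {s q : ℂ} (hs : s = u')
    (h : asymAux A * (leg1 U * rAux A η s * leg2 W) = q • asymAux A) :
    IsFused e (leg1 (lax η e (-η) * U * lax η e u') * rAux A η s *
        leg2 (lax η e 0 * W * lax η e (u' + η))) := by
  refine ⟨(-η ^ 2 * q * (u' * (u' + 2 * η))) • 1, (-η ^ 2 * q * (u' * (u' + 2 * η))), ?_, ?_⟩
  · rw [dress_product he hU hW η _ u' _ _ (by rw [hs, add_zero]), lax_fused he]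
    rw [smul_mul_assoc, smul_mul_assoc, mul_assoc (leg2 _), h, mul_smul_comm, smul_mul_assoc,
      mul_assoc (leg2 _), asymAux_lax he, mul_smul_comm, smul_mul_assoc, one_mul, smul_mul_assoc,
      smul_smul, smul_smul]
  · simp

/-- Outer sites preserve the fused form: their right Lax pair is absorbed by the trailing
antisymmetrizer, and their left pair joins X, where a leading antisymmetrizer turns it into a
scalar. -/
theorem isFused_dress {f : Fin 2 → Fin 2 → A} (he : IsMatrixUnits e)
    {U W : Matrix (Fin 2) (Fin 2) A}
    (hU : ∀ a b i j, Commute (e a b) (U i j)) (hW : ∀ a b i j, Commute (e a b) (W i j))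
    (η u u' : ℂ) {s : ℂ} (hs : s = u' + (u + η))
    (h : IsFused f (leg1 U * rAux A η s * leg2 W)) :
    IsFused f (leg1 (lax η e u * U * lax η e u') * rAux A η s *
        leg2 (lax η e (u + η) * W * lax η e (u' + η))) := by
  obtain ⟨X, q, hX, hq⟩ := h
  refine ⟨(u' * (u' + 2 * η)) • (leg1 (lax η e u) * leg2 (lax η e (u + η)) * X),
    u' * (u' + 2 * η) * (u * (u + 2 * η)) * q, ?_, ?_⟩
  · rw [dress_product he hU hW η u u' _ _ hs, hX]
    simp only [smul_mul_assoc, mul_assoc]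
    rw [asymAux_lax he]
    simp only [mul_smul_comm]
  · rw [mul_smul_comm, ← mul_assoc, asymAux_lax he, smul_mul_assoc, hq, smul_smul, smul_smul,
      mul_assoc, mul_assoc, mul_assoc]

/-- The fused product of transfer matrices is a scalar. -/
theorem transfer_fused (hk : IsBoundary k c) (he : IsMatrixUnits e)
    {U W : Matrix (Fin 2) (Fin 2) A} {η g : ℂ} (h0 : (2 * g - η) * (2 * g + η) ≠ 0)
    (h : IsFused e (leg1 U * rAux A η (2 * g - η) * leg2 W)) :
    ∃ q : ℂ, ((1 + g • k) * U).trace * ((1 + (g + η) • k) * W).trace = q • 1 := by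
  have hc : ∀ g : ℂ, ∀ a b x, Commute ((1 + g • k) a b) x := fun g a b x => by
    simp only [Matrix.add_apply, Matrix.smul_apply, Matrix.one_apply]
    refine Commute.add_left ?_ ((hk.central _ _ _).smul_left _)
    split_ifs
    exacts [Commute.one_left _, Commute.zero_left _]
  have h1 := trace_mul_trace (G := 1 + g • k) (hc (g + η)) η (2 * g - η) (U := U) (W := W)
  obtain ⟨X, q, hX, hq⟩ := h
  have hs : 2 * g - η + 2 * η = 2 * g + η := by ring
  rw [hX, hs] at h1
  have h2 := hk.qdet_plus η g
  set C := leg2 (1 + (g + η) • k) * rAux A (-η) (2 * g + η) * leg1 (1 + g • k)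
  -- Cyclicity brings the trailing antisymmetrizer to the front. There it turns the K₊ part into a
  -- scalar, then X, and the leftover trace with the site permutation is 1.
  rw [← mul_assoc, ← trace_mul_comm_of_entriesCommute (entriesCommute_asymAux _), ← mul_assoc,
    h2, ← mul_assoc, smul_mul_assoc, hq, smul_mul_assoc, smul_mul_assoc, Matrix.trace_smul,
    Matrix.trace_smul, trace_asymAux_permSite he] at h1
  refine ⟨((2 * g - η) * (2 * g + η))⁻¹ * (2 * (g + η) * (1 - g ^ 2 * c) * q), ?_⟩
  rw [mul_smul, mul_smul _ q, h1, smul_smul, inv_mul_cancel₀ h0, one_smul]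

end Fusion

/-! ### Behaviour under λ → -λ. -/

section Parity

variable {A : Type*} [Ring A] [Algebra ℂ A] {e : Fin 2 → Fin 2 → A} (he : IsMatrixUnits e)
  {V : Matrix (Fin 2) (Fin 2) A} (hV : ∀ a b i j, Commute (e a b) (V i j))

omit [Algebra ℂ A] in
include he hV in
-- Conjugation by P moves V from the auxiliary space to the site, so the result is the identity on
-- the auxiliary space; the operator it defines on the chain is the partial trace of PV.
theorem permSite_mul_mul_permSite :
    permSite e * V * permSite e = Matrix.scalar (Fin 2) (permSite e * V).trace := by
  ext i j
  have h : ∀ a b c d m n, e a b * V m n * e c d = if b = c then e a d * V m n else 0 :=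
    fun a b c d m n => by
      rw [mul_assoc, ← (hV c d m n).eq, ← mul_assoc, he.mul]; split_ifs <;> simp
  fin_cases i <;> fin_cases j <;>
    simp [permSite, Matrix.mul_apply, Matrix.trace_fin_two, h, add_mul]

omit [Algebra ℂ A] in
include he hV in
-- The polarized Cayley-Hamilton identity XY + YX = tr(X)Y + tr(Y)X + tr(XY) - tr(X)tr(Y) of 2 × 2
-- matrices, with X = P of trace 1. Being bilinear, it only needs the entries of P to commute with
-- those of V.
theorem permSite_mul_add_mul_permSite :
    permSite e * V + V * permSite e =
      Matrix.scalar (Fin 2) V.trace * permSite e + V +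
        Matrix.scalar (Fin 2) (permSite e * V).trace - Matrix.scalar (Fin 2) V.trace := by
  have h' : e 1 1 = 1 - e 0 0 := by rw [← he.sum]; abel
  ext i j
  have h : ∀ a b m n, V m n * e a b = e a b * V m n := fun a b m n => (hV a b m n).eq.symm
  fin_cases i <;> fin_cases j <;>
    simp [permSite, Matrix.mul_apply, Matrix.trace_fin_two, add_mul, h, h', sub_mul, mul_sub] <;> abel

omit [Algebra ℂ A] in
theorem trace_mul_permSite (hV : ∀ a b i j, Commute (e a b) (V i j)) :
    (V * permSite e).trace = (permSite e * V).trace := by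
  have : EntriesCommute (permSite e) V := fun _ _ _ _ => hV _ _ _ _
  exact (trace_mul_comm_of_entriesCommute this).symm

theorem trace_scalar_two (w : A) : (Matrix.scalar (Fin 2) w).trace = (2 : ℂ) • w := by
  simp [two_smul]

/-- The trace of a dressed boundary operator. -/
theorem trace_lax_mul_mul_lax (he : IsMatrixUnits e)
    (hV : ∀ a b i j, Commute (e a b) (V i j)) (η u u' : ℂ) :
    (lax η e u * V * lax η e u').trace =
      (u * u') • V.trace + (η * (u + u') + 2 * η ^ 2) • (permSite e * V).trace := by
  simp only [lax, add_mul, mul_add, smul_mul_assoc, mul_smul_comm, one_mul, mul_one,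
    Matrix.trace_add, Matrix.trace_smul, permSite_mul_mul_permSite he hV, trace_mul_permSite hV,
    trace_scalar_two]
  module

/-- The linear relation between the boundary operators at `λ` and `-λ` survives dressing. -/
theorem parity_dress (he : IsMatrixUnits e) {U : Matrix (Fin 2) (Fin 2) A}
    (hV : ∀ a b i j, Commute (e a b) (V i j)) (η lam x : ℂ)
    (h : (2 * lam - η) • U + (2 * lam + η) • V =
      (2 * lam) • Matrix.scalar (Fin 2) V.trace) :
    (2 * lam - η) • (lax η e (-lam - x - η / 2) * U * lax η e (-lam + x - η / 2)) +
        (2 * lam + η) • (lax η e (lam - x - η / 2) * V * lax η e (lam + x - η / 2)) =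
      (2 * lam) • Matrix.scalar (Fin 2)
        (lax η e (lam - x - η / 2) * V * lax η e (lam + x - η / 2)).trace := by
  have hU : (2 * lam - η) • U = (2 * lam) • Matrix.scalar (Fin 2) V.trace
      - (2 * lam + η) • V := by rw [← h]; abel
  have hw : permSite e * Matrix.scalar (Fin 2) V.trace =
      Matrix.scalar (Fin 2) V.trace * permSite e := by
    ext i j
    simp only [Matrix.scalar_apply, Matrix.mul_diagonal, Matrix.diagonal_mul]
    exact Commute.sum_right _ _ _ fun m _ => hV _ _ _ _
  have hsc : ∀ (c : ℂ) (w : A), Matrix.scalar (Fin 2) (c • w) = c • Matrix.scalar (Fin 2) w :=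
    fun c w => by ext i j; by_cases hij : i = j <;> simp [hij]
  have h1 := permSite_mul_mul_permSite he hV
  have h2 : V * permSite e = Matrix.scalar (Fin 2) V.trace * permSite e + V +
        Matrix.scalar (Fin 2) (permSite e * V).trace - Matrix.scalar (Fin 2) V.trace
        - permSite e * V := by
    rw [← permSite_mul_add_mul_permSite he hV]; abel
  -- U occurs only multiplied by 2λ - η, so it is eliminated without a division; the rest is an
  -- identity linear in V.
  rw [← smul_mul_assoc, ← mul_smul_comm, hU, trace_lax_mul_mul_lax he hV, map_add, hsc, hsc]
  simp only [lax, add_mul, mul_add, mul_sub, sub_mul, smul_mul_assoc, mul_smul_comm, one_mul,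
    mul_one, h1, h2, hw]
  simp only [mul_assoc, permSite_mul_self he, mul_one]
  module

/-- The boundary transfer matrix is an even function of the spectral parameter. -/
theorem parity_trace {k : Matrix (Fin 2) (Fin 2) A} {c : ℂ} (hk : IsBoundary k c)
    {U V : Matrix (Fin 2) (Fin 2) A} (η lam : ℂ)
    (h : (2 * lam - η) • U + (2 * lam + η) • V =
      (2 * lam) • Matrix.scalar (Fin 2) V.trace) :
    (2 * lam - η) • ((1 + (-lam + η / 2) • k) * U).trace =
      (2 * lam - η) • ((1 + (lam + η / 2) • k) * V).trace := by
  have hU : (2 * lam - η) • U = (2 * lam) • Matrix.scalar (Fin 2) V.trace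
      - (2 * lam + η) • V := by rw [← h]; abel
  have ht : (k * Matrix.scalar (Fin 2) V.trace).trace = 0 := by
    simp [Matrix.trace_fin_two, hk.trace]
  rw [← Matrix.trace_smul, ← mul_smul_comm, hU]
  simp only [add_mul, mul_sub, one_mul, mul_smul_comm, smul_mul_assoc, Matrix.trace_add,
    Matrix.trace_sub, Matrix.trace_smul, trace_scalar_two, ht]
  module

end Parity


/-! ### The chain -/

section Chain

variable {N : ℕ}

/-- The matrix unit `E_{ab}` acting on site `n`. -/
def siteUnit (N : ℕ) (n : Fin N) (a b : Fin 2) : Op N :=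
  Matrix.of fun s t => if s n = a ∧ t = Function.update s n b then 1 else 0

theorem siteUnit_mul_apply (n : Fin N) (a b : Fin 2) (X : Op N) (s t : Config N) :
    (siteUnit N n a b * X) s t = if s n = a then X (Function.update s n b) t else 0 := by
  simp only [Matrix.mul_apply, siteUnit, Matrix.of_apply, ite_and, ite_mul, one_mul, zero_mul]
  by_cases h : s n = a <;> simp [h]

theorem isMatrixUnits_siteUnit (n : Fin N) : IsMatrixUnits (siteUnit N n) where
  mul a b c d := by
    ext s t
    rw [siteUnit_mul_apply]
    by_cases hbc : b = c <;> by_cases hs : s n = a <;> simp [siteUnit, hbc, hs]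
  sum := by
    ext s t
    have h : ∀ i : Fin 2, i = 0 ∨ i = 1 := by decide
    by_cases hst : s = t
    · subst hst
      rcases h (s n) with h0 | h0
      · have : Function.update s n 0 = s := by rw [← h0, Function.update_eq_self]
        simp [siteUnit, h0, this]
      · have : Function.update s n 1 = s := by rw [← h0, Function.update_eq_self]
        simp [siteUnit, h0, this]
    · have h' : ∀ i, s n = i → t ≠ Function.update s n i := by
        rintro i rfl; rw [Function.update_eq_self]; exact Ne.symm hst
      have h0 := h' 0
      have h1 := h' 1
      simp only [Matrix.add_apply, siteUnit, Matrix.of_apply, Matrix.one_apply, hst, if_false]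
      rw [if_neg fun h => h0 h.1 h.2, if_neg fun h => h1 h.1 h.2, add_zero]

theorem siteUnit_commute {n m : Fin N} (h : n ≠ m) (a b c d : Fin 2) :
    Commute (siteUnit N n a b) (siteUnit N m c d) := by
  ext s t
  rw [siteUnit_mul_apply, siteUnit_mul_apply]
  simp only [siteUnit, Matrix.of_apply, Function.update_of_ne h, Function.update_of_ne h.symm,
    Function.update_comm h]
  by_cases h1 : s n = a <;> by_cases h2 : s m = c <;> simp [h1, h2]

theorem rMatrix_apply (η u : ℂ) (a b s t : Fin 2) :
    rMatrix η u (a, s) (b, t) =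
      u * (if a = b ∧ s = t then 1 else 0) + η * (if s = b ∧ t = a then 1 else 0) := by
  fin_cases a <;> fin_cases b <;> fin_cases s <;> fin_cases t <;>
    simp [rMatrix, finProdFinEquiv]

theorem rSite_eq_lax (η : ℂ) (n : Fin N) (u : ℂ) :
    rSite N η n u = lax η (siteUnit N n) u := by
  ext a b s t
  have key : t = Function.update s n (t n) ↔ ∀ m, m ≠ n → s m = t m := by
    constructor
    · intro h m hm; rw [h, Function.update_of_ne hm]
    · intro h; ext m
      by_cases hm : m = n
      · subst hm; simp
      · rw [Function.update_of_ne hm, h m hm]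
  have h1 : s = t ↔ (∀ m, m ≠ n → s m = t m) ∧ s n = t n := by
    rw [← key]; constructor
    · rintro rfl; simp
    · rintro ⟨h, h'⟩; rw [h, ← h', Function.update_eq_self]
  have h2 : t = Function.update s n a ↔ (∀ m, m ≠ n → s m = t m) ∧ t n = a := by
    rw [← key]; constructor
    · intro h
      have : t n = a := by rw [h]; simp
      exact ⟨by rw [this]; exact h, this⟩
    · rintro ⟨h, h'⟩; rw [← h']; exact h
  simp only [rSite, Matrix.of_apply, rMatrix_apply, lax, permSite, Matrix.add_apply,
    Matrix.smul_apply, siteUnit, smul_eq_mul, h2]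
  by_cases hc : ∀ m, m ≠ n → s m = t m
  · rw [if_pos hc]
    have h1' : s = t ↔ s n = t n := h1.trans (and_iff_right hc)
    have h2' := and_iff_right (b := t n = a) hc
    simp only [h2']
    by_cases hab : a = b <;> simp [hab, Matrix.one_apply, h1']
  · rw [if_neg hc]
    have h1' : ¬ s = t := fun h => hc (h1.1 h).1
    have h2' : ¬ ((∀ m, m ≠ n → s m = t m) ∧ t n = a) := fun h => hc h.1
    simp only [h2', and_false, if_false]
    by_cases hab : a = b <;> simp [hab, Matrix.one_apply, h1']

theorem auxEmb_eq_numMat (k : Matrix (Fin 2) (Fin 2) ℂ) : auxEmb N k = numMat (Op N) k := by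
  ext a b : 1
  simp [auxEmb, numMat_apply, Algebra.algebraMap_eq_smul_one]

/-- All entries of `X` commute with the operators of site `n`. -/
def CommutesWithSite {n : Type*} (m : Fin N) (X : Matrix n n (Op N)) : Prop :=
  ∀ a b i j, Commute (siteUnit N m a b) (X i j)

theorem CommutesWithSite.mul {n : Type*} [Fintype n] {m : Fin N} {X Y : Matrix n n (Op N)}
    (hX : CommutesWithSite m X) (hY : CommutesWithSite m Y) : CommutesWithSite m (X * Y) :=
  fun a b _ _ => Commute.sum_right _ _ _ fun _ _ => (hX a b _ _).mul_right (hY a b _ _)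

theorem commutesWithSite_one (m : Fin N) : CommutesWithSite m (1 : AuxOp N) := by
  intro a b i j
  rw [Matrix.one_apply]
  split_ifs
  exacts [Commute.one_right _, Commute.zero_right _]

theorem commutesWithSite_lax {n m : Fin N} (h : m ≠ n) (η u : ℂ) :
    CommutesWithSite m (lax η (siteUnit N n) u) := fun a b i j =>
  (entriesCommute_lax (X := Matrix.of fun _ _ : Fin 1 => siteUnit N m a b)
    (fun _ _ _ _ => siteUnit_commute h.symm _ _ _ _) η u i j 0 0).symm

theorem commutesWithSite_list_prod {m : Fin N} (η : ℂ) (u : Fin N → ℂ) {l : List (Fin N)}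
    (h : m ∉ l) : CommutesWithSite m (l.map fun n => lax η (siteUnit N n) (u n)).prod := by
  induction l with
  | nil => simpa using commutesWithSite_one m
  | cons n l ih =>
    rw [List.mem_cons, not_or] at h
    rw [List.map_cons, List.prod_cons]
    exact (commutesWithSite_lax h.1 η _).mul (ih h.2)

theorem sigmaY_mul_self : auxEmb N sigmaY * auxEmb N sigmaY = 1 := by
  rw [auxEmb_eq_numMat, ← map_mul]
  have : sigmaY * sigmaY = 1 := by
    ext i j; fin_cases i <;> fin_cases j <;> simp [sigmaY]
  rw [this, map_one]

/-- Crossing symmetry: in dimension 2, conjugating the partial transpose of P by σ^y gives 1 - P,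
and u + η(1 - P) = -((-u - η) + ηP). -/
theorem sigmaY_lax (η : ℂ) (n : Fin N) (u : ℂ) :
    auxEmb N sigmaY * (lax η (siteUnit N n) u).transpose * auxEmb N sigmaY =
      -lax η (siteUnit N n) (-u - η) := by
  have h := (isMatrixUnits_siteUnit n).sum
  have h' : siteUnit N n 1 1 = 1 - siteUnit N n 0 0 := by rw [← h]; abel
  have hI : ∀ X : Op N, Complex.I • Complex.I • X = -X := fun X => by
    rw [smul_smul, Complex.I_mul_I, neg_one_smul]
  ext i j : 1
  fin_cases i <;> fin_cases j <;>
    simp [auxEmb, sigmaY, Matrix.mul_apply, lax, permSite, h', hI, smul_sub] <;> module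

/-- Partial transposition reverses a product only when the operator entries of the two factors
commute; here the factors act on different sites. -/
theorem transpose_mul_of_entriesCommute {X Y : AuxOp N} (h : EntriesCommute X Y) :
    (X * Y).transpose = Y.transpose * X.transpose := by
  ext i j : 1
  simp only [Matrix.transpose_apply, Matrix.mul_apply]
  exact Finset.sum_congr rfl fun _ _ => h _ _ _ _

theorem sigmaY_prod (η : ℂ) (u : Fin N → ℂ) {l : List (Fin N)} (hl : l.Nodup) :
    auxEmb N sigmaY *
        ((l.map fun n => lax η (siteUnit N n) (u n)).reverse.prod).transpose * auxEmb N sigmaY =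
      (-1 : ℂ) ^ l.length • (l.map fun n => lax η (siteUnit N n) (-u n - η)).prod := by
  induction l with
  | nil => simp [sigmaY_mul_self]
  | cons n l ih =>
    rw [List.nodup_cons] at hl
    have hc : CommutesWithSite n (l.map fun n => lax η (siteUnit N n) (u n)).reverse.prod := by
      rw [← List.map_reverse]
      exact commutesWithSite_list_prod η u (by simpa using hl.1)
    have hcc : EntriesCommute (l.map fun n => lax η (siteUnit N n) (u n)).reverse.prod
        (lax η (siteUnit N n) (u n)) := (entriesCommute_lax hc η _).symm
    rw [List.map_cons, List.reverse_cons, List.prod_append, List.prod_singleton,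
      transpose_mul_of_entriesCommute hcc, List.map_cons, List.prod_cons, List.length_cons,
      pow_succ', mul_smul, ← mul_smul_comm, ← ih hl.2, neg_one_smul, ← neg_mul, ← sigmaY_lax]
    simp only [mul_assoc]
    rw [← mul_assoc (auxEmb N sigmaY) (auxEmb N sigmaY), sigmaY_mul_self, one_mul]

theorem bulkMonodromy_eq (η : ℂ) (ξ : Fin N → ℂ) (lam : ℂ) :
    bulkMonodromy N η ξ lam =
      ((List.finRange N).reverse.map fun n => lax η (siteUnit N n) (lam - ξ n - η / 2)).prod := by
  rw [bulkMonodromy, List.map_reverse, List.ofFn_eq_map]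
  simp only [rSite_eq_lax]

theorem bulkMonodromyHat_eq (η : ℂ) (ξ : Fin N → ℂ) (lam : ℂ) :
    bulkMonodromyHat N η ξ lam =
      ((List.finRange N).map fun n => lax η (siteUnit N n) (lam + ξ n - η / 2)).prod := by
  rw [bulkMonodromyHat, bulkMonodromy, List.ofFn_eq_map]
  simp only [rSite_eq_lax]
  rw [sigmaY_prod η (fun n => -lam - ξ n - η / 2) (List.nodup_finRange N), smul_smul,
    List.length_finRange, ← mul_pow, neg_one_mul, neg_neg, one_pow, one_smul]
  congr 2
  funext n; congr 1; ring

/-- The boundary operator `K₋`, dressed by the sites of a list, the head of the list being the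
outermost site. -/
def dressed (η : ℂ) (ξ : Fin N → ℂ) (k : AuxOp N) : List (Fin N) → ℂ → AuxOp N
  | [], lam => 1 + (lam - η / 2) • k
  | n :: l, lam => lax η (siteUnit N n) (lam - ξ n - η / 2) * dressed η ξ k l lam *
      lax η (siteUnit N n) (lam + ξ n - η / 2)

theorem dressed_eq (η : ℂ) (ξ : Fin N → ℂ) (k : AuxOp N) (l : List (Fin N)) (lam : ℂ) :
    dressed η ξ k l lam =
      (l.map fun n => lax η (siteUnit N n) (lam - ξ n - η / 2)).prod * (1 + (lam - η / 2) • k) *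
        (l.reverse.map fun n => lax η (siteUnit N n) (lam + ξ n - η / 2)).prod := by
  induction l with
  | nil => simp [dressed]
  | cons n l ih =>
    rw [dressed, ih]
    simp [mul_assoc]

variable {k : AuxOp N} {c : ℂ}

theorem commutesWithSite_dressed (hk : IsBoundary k c) (η : ℂ) (ξ : Fin N → ℂ) {m : Fin N}
    {l : List (Fin N)} (h : m ∉ l) (lam : ℂ) : CommutesWithSite m (dressed η ξ k l lam) := by
  have h0 : CommutesWithSite m (1 + (lam - η / 2) • k) := by
    intro a b i j
    rw [Matrix.add_apply, Matrix.smul_apply]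
    exact (commutesWithSite_one m a b i j).add_right ((hk.central i j _).symm.smul_right _)
  rw [dressed_eq]
  exact ((commutesWithSite_list_prod η (fun n => lam - ξ n - η / 2) h).mul h0).mul
    (commutesWithSite_list_prod η (fun n => lam + ξ n - η / 2) (by simpa using h))

theorem dressed_reflection (hk : IsBoundary k c) (η : ℂ) (ξ : Fin N → ℂ)
    {l : List (Fin N)} (hl : l.Nodup) (lam mu : ℂ) :
    rAux (Op N) η (lam - mu) * leg1 (dressed η ξ k l lam) * rAux (Op N) η (lam + mu - η) *
        leg2 (dressed η ξ k l mu) =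
      leg2 (dressed η ξ k l mu) * rAux (Op N) η (lam + mu - η) * leg1 (dressed η ξ k l lam) *
        rAux (Op N) η (lam - mu) := by
  induction l with
  | nil =>
    have h := hk.reflection η (lam - η / 2) (mu - η / 2)
    rw [show lam - η / 2 - (mu - η / 2) = lam - mu by ring,
      show lam - η / 2 + (mu - η / 2) = lam + mu - η by ring] at h
    exact h
  | cons n l ih =>
    rw [List.nodup_cons] at hl
    exact reflection_dress_lax (isMatrixUnits_siteUnit n)
      (commutesWithSite_dressed hk η ξ hl.1 lam) (commutesWithSite_dressed hk η ξ hl.1 mu)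
      (by ring) (by ring) (by ring) (ih hl.2)

theorem dressed_parity (hk : IsBoundary k c) (η : ℂ) (ξ : Fin N → ℂ)
    {l : List (Fin N)} (hl : l.Nodup) (lam : ℂ) :
    (2 * lam - η) • dressed η ξ k l (-lam) + (2 * lam + η) • dressed η ξ k l lam =
      (2 * lam) • Matrix.scalar (Fin 2) (dressed η ξ k l lam).trace := by
  induction l with
  | nil =>
    have h : (dressed η ξ k [] lam).trace = (2 : ℂ) • 1 := by
      rw [dressed, Matrix.trace_add, Matrix.trace_smul, Matrix.trace_fin_two k, hk.trace]
      simp [two_smul, one_add_one_eq_two]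
    have h' : Matrix.scalar (Fin 2) ((2 : ℂ) • (1 : Op N)) = (2 : ℂ) • (1 : AuxOp N) := by
      ext i j : 1; by_cases hij : i = j <;> simp [hij]
    rw [h, h', dressed, dressed]
    module
  | cons n l ih =>
    rw [List.nodup_cons] at hl
    exact parity_dress (isMatrixUnits_siteUnit n)
      (commutesWithSite_dressed hk η ξ hl.1 lam) η lam (ξ n) (ih hl.2)

theorem dressed_qdet (hk : IsBoundary k c) (η : ℂ) (ξ : Fin N → ℂ)
    {l : List (Fin N)} (hl : l.Nodup) (lam : ℂ) :
    ∃ q : ℂ, asymAux (Op N) * (leg1 (dressed η ξ k l lam) * rAux (Op N) η (2 * lam) *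
      leg2 (dressed η ξ k l (lam + η))) = q • asymAux (Op N) := by
  induction l with
  | nil =>
    have h := hk.qdet_minus η (lam - η / 2)
    rw [show 2 * (lam - η / 2) + η = 2 * lam by ring,
      show lam - η / 2 + η = lam + η - η / 2 by ring] at h
    refine ⟨2 * (lam - η / 2) * (1 - (lam + η - η / 2) ^ 2 * c), ?_⟩
    rw [dressed, dressed, ← mul_assoc, ← mul_assoc]
    exact h
  | cons n l ih =>
    rw [List.nodup_cons] at hl
    obtain ⟨q, hq⟩ := ih hl.2
    have h := qdet_dress (isMatrixUnits_siteUnit n)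
      (commutesWithSite_dressed hk η ξ hl.1 lam) (commutesWithSite_dressed hk η ξ hl.1 (lam + η))
      η (lam - ξ n - η / 2) (lam + ξ n - η / 2) (s := 2 * lam) (by ring) hq
    rw [show lam - ξ n - η / 2 + η = lam + η - ξ n - η / 2 by ring,
      show lam + ξ n - η / 2 + η = lam + η + ξ n - η / 2 by ring] at h
    exact ⟨_, h⟩

/-- Sites closer to K₋ than m enter only through their quantum determinant, site m creates the fused
form, and the sites outside it preserve this form. -/
theorem dressed_isFused (hk : IsBoundary k c) (η : ℂ) (ξ : Fin N → ℂ)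
    {l : List (Fin N)} (hl : l.Nodup) {m : Fin N} (hm : m ∈ l) :
    IsFused (siteUnit N m) (leg1 (dressed η ξ k l (ξ m - η / 2)) *
      rAux (Op N) η (2 * (ξ m - η / 2)) * leg2 (dressed η ξ k l (ξ m + η / 2))) := by
  induction l with
  | nil => simp at hm
  | cons n l ih =>
    rw [List.nodup_cons] at hl
    have hμ : ξ m + η / 2 = ξ m - η / 2 + η := by ring
    rcases List.mem_cons.mp hm with rfl | hm
    · obtain ⟨q, hq⟩ := dressed_qdet hk η ξ hl.2 (ξ m - η / 2)
      rw [← hμ] at hq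
      have h := isFused_start (isMatrixUnits_siteUnit m)
        (commutesWithSite_dressed hk η ξ hl.1 (ξ m - η / 2))
        (commutesWithSite_dressed hk η ξ hl.1 (ξ m + η / 2)) η (2 * (ξ m - η / 2)) rfl hq
      rw [dressed, dressed]
      rw [show ξ m - η / 2 - ξ m - η / 2 = -η by ring,
        show ξ m - η / 2 + ξ m - η / 2 = 2 * (ξ m - η / 2) by ring,
        show ξ m + η / 2 - ξ m - η / 2 = 0 by ring,
        show ξ m + η / 2 + ξ m - η / 2 = 2 * (ξ m - η / 2) + η by ring]
      exact h
    · have h := isFused_dress (isMatrixUnits_siteUnit n)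
        (commutesWithSite_dressed hk η ξ hl.1 (ξ m - η / 2))
        (commutesWithSite_dressed hk η ξ hl.1 (ξ m + η / 2)) η
        (ξ m - η / 2 - ξ n - η / 2) (ξ m - η / 2 + ξ n - η / 2) (by ring) (ih hl.2 hm)
      rw [show ξ m - η / 2 - ξ n - η / 2 + η = ξ m + η / 2 - ξ n - η / 2 by ring,
        show ξ m - η / 2 + ξ n - η / 2 + η = ξ m + η / 2 + ξ n - η / 2 by ring] at h
      exact h

/-- At η/2 the boundary matrix is 1 and the two Lax operators of a site have opposite arguments, so
(-ξₙ + ηP)(ξₙ + ηP) = η² - ξₙ² collapses the dressing site by site. -/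
theorem dressed_half (k : AuxOp N) (η : ℂ) (ξ : Fin N → ℂ) (l : List (Fin N)) :
    ∃ q : ℂ, dressed η ξ k l (η / 2) = q • 1 := by
  induction l with
  | nil => exact ⟨1, by simp [dressed]⟩
  | cons n l ih =>
    obtain ⟨q, hq⟩ := ih
    refine ⟨q * (η ^ 2 - ξ n ^ 2), ?_⟩
    rw [dressed, hq, mul_smul_comm, smul_mul_assoc, mul_one, mul_smul]
    congr 1
    simp only [lax, add_mul, mul_add, smul_mul_assoc, mul_smul_comm, one_mul, mul_one,
      permSite_mul_self (isMatrixUnits_siteUnit n)]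
    module

/-- The direction of the boundary field: `K(λ; ζ, κ, τ) = 1 + λ k`. -/
def boundaryDir (b : BoundaryParam) : Matrix (Fin 2) (Fin 2) ℂ :=
  (1 / b.1) • !![1, 2 * b.2.1 * Complex.exp b.2.2; 2 * b.2.1 * Complex.exp (-b.2.2), -1]

theorem kMatrix_eq {b : BoundaryParam} (hb : b.1 ≠ 0) (lam : ℂ) :
    kMatrix b lam = 1 + lam • boundaryDir b := by
  ext i j
  fin_cases i <;> fin_cases j <;> simp [kMatrix, boundaryDir] <;> field_simp <;> ring

theorem isBoundary_boundaryDir (b : BoundaryParam) :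
    IsBoundary (numMat (Op N) (boundaryDir b)) ((1 + 4 * b.2.1 ^ 2) / b.1 ^ 2) where
  central a b x := by rw [numMat_apply]; exact Algebra.commutes _ _
  trace := by
    rw [numMat_apply, numMat_apply, ← (algebraMap ℂ (Op N)).map_neg]; congr 1; simp [boundaryDir]
  sq := by
    have h : boundaryDir b * boundaryDir b = ((1 + 4 * b.2.1 ^ 2) / b.1 ^ 2) • 1 := by
      have he := Complex.exp_neg b.2.2
      have he' := Complex.exp_ne_zero b.2.2
      ext i j
      fin_cases i <;> fin_cases j <;> simp [boundaryDir, Matrix.mul_apply, he] <;>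
        field_simp <;> ring
    rw [← map_mul, h, numMat_smul, map_one]

variable {bp bm : BoundaryParam}

theorem transferMatrix_eq (hp : bp.1 ≠ 0) (hm : bm.1 ≠ 0) (η : ℂ) (ξ : Fin N → ℂ) (lam : ℂ) :
    transferMatrix N η ξ bp bm lam =
      ((1 + (lam + η / 2) • numMat (Op N) (boundaryDir bp)) *
        dressed η ξ (numMat (Op N) (boundaryDir bm)) (List.finRange N).reverse lam).trace := by
  rw [transferMatrix, bulkMonodromy_eq, bulkMonodromyHat_eq, dressed_eq, List.reverse_reverse,
    auxEmb_eq_numMat, auxEmb_eq_numMat, kPlus, kMinus, kMatrix_eq hp, kMatrix_eq hm,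
    map_add, map_add, map_one, numMat_smul, numMat_smul]
  simp only [mul_assoc]

theorem nodup_sites : (List.finRange N).reverse.Nodup :=
  List.nodup_reverse.mpr (List.nodup_finRange N)

theorem transferMatrix_commute_aux (hp : bp.1 ≠ 0) (hm : bm.1 ≠ 0) (η : ℂ) (ξ : Fin N → ℂ)
    {lam mu : ℂ}
    (h : ((lam - mu) ^ 2 - η ^ 2) * ((lam + mu - η) * (lam + mu + η)) ≠ 0) :
    Commute (transferMatrix N η ξ bp bm lam) (transferMatrix N η ξ bp bm mu) := by
  have h1 := transfer_commute (η := η) (g := lam + η / 2) (h := mu + η / 2)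
    (isBoundary_boundaryDir (N := N) bp)
    (U := dressed η ξ (numMat (Op N) (boundaryDir bm)) (List.finRange N).reverse lam)
    (W := dressed η ξ (numMat (Op N) (boundaryDir bm)) (List.finRange N).reverse mu) (by
      rw [show lam + η / 2 - (mu + η / 2) = lam - mu by ring,
        show lam + η / 2 + (mu + η / 2) - 2 * η = lam + mu - η by ring]
      exact dressed_reflection (isBoundary_boundaryDir bm) η ξ nodup_sites lam mu)
  rw [← transferMatrix_eq hp hm, ← transferMatrix_eq hp hm,
    show lam + η / 2 - (mu + η / 2) = lam - mu by ring,
    show lam + η / 2 + (mu + η / 2) - 2 * η = lam + mu - η by ring,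
    show lam + η / 2 + (mu + η / 2) = lam + mu + η by ring] at h1
  exact smul_right_injective _ h h1

theorem transferMatrix_fused_aux (hp : bp.1 ≠ 0) (hm : bm.1 ≠ 0) (η : ℂ) (ξ : Fin N → ℂ)
    (n : Fin N) (h : (2 * ξ n - η) * (2 * ξ n + η) ≠ 0) :
    ∃ q : ℂ, transferMatrix N η ξ bp bm (ξ n - η / 2) * transferMatrix N η ξ bp bm (ξ n + η / 2) =
      q • 1 := by
  have h1 := dressed_isFused (isBoundary_boundaryDir bm) η ξ nodup_sites (m := n) (by simp)
  obtain ⟨q, hq⟩ := transfer_fused (η := η) (g := ξ n)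
    (isBoundary_boundaryDir bp) (isMatrixUnits_siteUnit n) h
    (by rw [show 2 * ξ n - η = 2 * (ξ n - η / 2) by ring]; exact h1)
  refine ⟨q, ?_⟩
  rw [transferMatrix_eq hp hm, transferMatrix_eq hp hm, ← hq, sub_add_cancel, add_assoc (ξ n),
    add_halves]

theorem transferMatrix_neg_aux (hp : bp.1 ≠ 0) (hm : bm.1 ≠ 0) (η : ℂ) (ξ : Fin N → ℂ) (lam : ℂ) :
    (2 * lam - η) • transferMatrix N η ξ bp bm (-lam) =
      (2 * lam - η) • transferMatrix N η ξ bp bm lam := by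
  rw [transferMatrix_eq hp hm, transferMatrix_eq hp hm]
  exact parity_trace (isBoundary_boundaryDir bp) η lam
    (dressed_parity (isBoundary_boundaryDir bm) η ξ nodup_sites lam)

theorem transferMatrix_half (hp : bp.1 ≠ 0) (hm : bm.1 ≠ 0) (η : ℂ) (ξ : Fin N → ℂ) :
    ∃ q : ℂ, transferMatrix N η ξ bp bm (η / 2) = q • 1 := by
  obtain ⟨q, hq⟩ := dressed_half (numMat (Op N) (boundaryDir bm)) η ξ (List.finRange N).reverse
  refine ⟨q * 2, ?_⟩
  rw [transferMatrix_eq hp hm, hq, mul_smul_comm, mul_one, Matrix.trace_smul, Matrix.trace_add,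
    Matrix.trace_smul, Matrix.trace_fin_two (numMat _ _),
    (isBoundary_boundaryDir (N := N) bp).trace, mul_smul, add_neg_cancel, smul_zero, add_zero,
    Matrix.trace_fin_two, Matrix.one_apply_eq, Matrix.one_apply_eq, two_smul]

end Chain


/-! ### Regularity of the transfer matrix -/

section Regularity

variable {N : ℕ}

/-- The boundary transfer matrix of arbitrary numerical boundary matrices. -/
def openTransfer (N : ℕ) (η : ℂ) (ξ : Fin N → ℂ) (kp km : Matrix (Fin 2) (Fin 2) ℂ) (lam : ℂ) :
    Op N :=
  Matrix.trace (auxEmb N kp * bulkMonodromy N η ξ lam * auxEmb N km * bulkMonodromyHat N η ξ lam)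

theorem transferMatrix_eq_openTransfer (η : ℂ) (ξ : Fin N → ℂ) (bp bm : BoundaryParam) (lam : ℂ) :
    transferMatrix N η ξ bp bm lam =
      openTransfer N η ξ (kPlus η bp lam) (kMinus η bm lam) lam := rfl

theorem mul_entry (X Y : AuxOp N) (a b : Fin 2) (s t : Config N) :
    (X * Y) a b s t = ∑ c, ∑ r, X a c s r * Y c b r t := by
  rw [Matrix.mul_apply, Matrix.sum_apply]
  simp only [Matrix.mul_apply]

theorem lax_entry (η u : ℂ) (n : Fin N) (a b : Fin 2) (s t : Config N) :
    lax η (siteUnit N n) u a b s t =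
      u * (1 : AuxOp N) a b s t + η * siteUnit N n b a s t := by
  simp [lax, permSite]

section Differentiable

variable {E : Type*} [NormedAddCommGroup E] [NormedSpace ℂ E]

/-- All the matrix entries of `X` are holomorphic. -/
def EntriesDiff (X : E → AuxOp N) : Prop := ∀ a b s t, Differentiable ℂ fun p => X p a b s t

theorem EntriesDiff.mul {X Y : E → AuxOp N} (hX : EntriesDiff X) (hY : EntriesDiff Y) :
    EntriesDiff fun p => X p * Y p := by
  intro a b s t
  simp only [mul_entry]
  exact Differentiable.fun_sum fun _ _ => Differentiable.fun_sum fun _ _ =>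
    (hX _ _ _ _).mul (hY _ _ _ _)

theorem EntriesDiff.list_prod {η u : Fin N → E → ℂ} (hη : ∀ n, Differentiable ℂ (η n))
    (hu : ∀ n, Differentiable ℂ (u n)) (l : List (Fin N)) :
    EntriesDiff fun p => (l.map fun n => lax (η n p) (siteUnit N n) (u n p)).prod := by
  induction l with
  | nil => intro a b s t; simp
  | cons n l ih =>
    simp only [List.map_cons, List.prod_cons]
    refine EntriesDiff.mul (fun a b s t => ?_) ih
    simp only [lax_entry]
    exact ((hu n).mul_const _).add ((hη n).mul_const _)

theorem entriesDiff_auxEmb {k : E → Matrix (Fin 2) (Fin 2) ℂ}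
    (hk : ∀ i j, Differentiable ℂ fun p => k p i j) : EntriesDiff fun p => auxEmb N (k p) :=
  fun a b s t => (hk a b).mul_const ((1 : Op N) s t)

theorem differentiable_openTransfer (η : ℂ) {ξ : E → Fin N → ℂ}
    {kp km : E → Matrix (Fin 2) (Fin 2) ℂ} {lam : E → ℂ}
    (hξ : ∀ n, Differentiable ℂ fun p => ξ p n)
    (hp : ∀ i j, Differentiable ℂ fun p => kp p i j)
    (hm : ∀ i j, Differentiable ℂ fun p => km p i j) (hlam : Differentiable ℂ lam)
    (s t : Config N) :
    Differentiable ℂ fun p => openTransfer N η (ξ p) (kp p) (km p) (lam p) s t := by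
  have h1 : EntriesDiff fun p => bulkMonodromy N η (ξ p) (lam p) := by
    simp only [bulkMonodromy_eq]
    exact EntriesDiff.list_prod (η := fun _ _ => η) (u := fun n p => lam p - ξ p n - η / 2)
      (fun _ => differentiable_const _) (fun n => (hlam.sub (hξ n)).sub_const _) _
  have h2 : EntriesDiff fun p => bulkMonodromyHat N η (ξ p) (lam p) := by
    simp only [bulkMonodromyHat_eq]
    exact EntriesDiff.list_prod (η := fun _ _ => η) (u := fun n p => lam p + ξ p n - η / 2)
      (fun _ => differentiable_const _) (fun n => (hlam.add (hξ n)).sub_const _) _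
  have h := (((entriesDiff_auxEmb hp).mul h1).mul (entriesDiff_auxEmb hm)).mul h2
  simp only [openTransfer, Matrix.trace_fin_two, Matrix.add_apply]
  exact (h 0 0 s t).add (h 1 1 s t)

theorem differentiable_transferMatrix (η : ℂ) {ξ : E → Fin N → ℂ} (bp bm : BoundaryParam)
    {lam : E → ℂ} (hξ : ∀ n, Differentiable ℂ fun p => ξ p n) (hlam : Differentiable ℂ lam)
    (s t : Config N) :
    Differentiable ℂ fun p => transferMatrix N η (ξ p) bp bm (lam p) s t := by
  simp only [transferMatrix_eq_openTransfer]
  refine differentiable_openTransfer η hξ ?_ ?_ hlam s t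
  all_goals
    intro i j
    fin_cases i <;> fin_cases j <;> simp [kPlus, kMinus, kMatrix] <;> fun_prop

theorem continuous_transferMatrix (η : ℂ) {ξ : E → Fin N → ℂ} (bp bm : BoundaryParam)
    {lam : E → ℂ} (hξ : ∀ n, Differentiable ℂ fun p => ξ p n) (hlam : Differentiable ℂ lam) :
    Continuous fun p => transferMatrix N η (ξ p) bp bm (lam p) :=
  continuous_matrix fun s t => (differentiable_transferMatrix η bp bm hξ hlam s t).continuous

end Differentiable

variable {bp bm : BoundaryParam} (hp : bp.1 ≠ 0) (hm : bm.1 ≠ 0) (η : ℂ) (ξ : Fin N → ℂ)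

include hp hm in
/-- The boundary transfer matrices form a commuting family. -/
theorem transferMatrix_commute (lam mu : ℂ) :
    Commute (transferMatrix N η ξ bp bm lam) (transferMatrix N η ξ bp bm mu) := by
  have hc : Continuous fun x : ℂ => transferMatrix N η ξ bp bm x :=
    continuous_transferMatrix η bp bm (fun _ => differentiable_const _) differentiable_id
  -- For fixed μ only four values of λ make the prefactor of `transferMatrix_commute_aux` vanish;
  -- continuity in λ covers them.
  have hd : Dense ({mu + η, mu - η, η - mu, -mu - η} : Set ℂ)ᶜ :=
    (Set.toFinite _).countable.dense_compl ℂ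
  refine congrFun (Continuous.ext_on hd (hc.mul continuous_const) (continuous_const.mul hc)
    fun x hx => ?_) lam
  simp only [Set.mem_compl_iff, Set.mem_insert_iff, Set.mem_singleton_iff, not_or] at hx
  refine transferMatrix_commute_aux hp hm η ξ ?_
  rw [show (x - mu) ^ 2 - η ^ 2 = (x - (mu + η)) * (x - (mu - η)) by ring,
    show x + mu - η = x - (η - mu) by ring, show x + mu + η = x - (-mu - η) by ring]
  simp only [ne_eq, mul_eq_zero, sub_eq_zero, not_or]
  tauto

include hp hm in
/-- The product of the transfer matrices at `ξₙ ∓ η/2` is a scalar. -/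
theorem transferMatrix_fused (n : Fin N) :
    ∃ q : ℂ, transferMatrix N η ξ bp bm (ξ n - η / 2) * transferMatrix N η ξ bp bm (ξ n + η / 2) =
      q • 1 := by
  set F : ℂ → Op N := fun x =>
    transferMatrix N η (Function.update ξ n x) bp bm (x - η / 2) *
      transferMatrix N η (Function.update ξ n x) bp bm (x + η / 2) with hF
  have hu : ∀ m, Differentiable ℂ fun x : ℂ => Function.update ξ n x m := by
    intro m
    by_cases h : m = n
    · subst h; simp
    · simp [Function.update_of_ne h]
  have hc : Continuous F :=
    (continuous_transferMatrix η bp bm hu (differentiable_id.sub_const _)).mul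
      (continuous_transferMatrix η bp bm hu (differentiable_id.add_const _))
  have hd : Dense ({η / 2, -η / 2} : Set ℂ)ᶜ := (Set.toFinite _).countable.dense_compl ℂ
  -- Being scalar is written as equality with one's own diagonal entry times the identity, a closed
  -- condition. It thus extends from ξₙ ≠ ±η/2 to every value of ξₙ, the other inhomogeneities being
  -- fixed.
  have key : F = fun x => F x 0 0 • (1 : Op N) := by
    refine Continuous.ext_on hd hc ?_ fun x hx => ?_
    · exact ((continuous_apply 0).comp ((continuous_apply 0).comp hc)).smul continuous_const
    · simp only [Set.mem_compl_iff, Set.mem_insert_iff, Set.mem_singleton_iff, not_or] at hx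
      obtain ⟨q, hq⟩ := transferMatrix_fused_aux hp hm η (Function.update ξ n x) n (by
        rw [Function.update_self, show 2 * x - η = 2 * (x - η / 2) by ring,
          show 2 * x + η = 2 * (x - -η / 2) by ring]
        simp only [ne_eq, mul_eq_zero, sub_eq_zero, not_or]
        simpa using hx)
      rw [Function.update_self] at hq
      have hFx : F x = q • 1 := hq
      rw [hFx]; simp
  refine ⟨F (ξ n) 0 0, ?_⟩
  have h := congrFun key (ξ n)
  simpa only [hF, Function.update_eq_self] using h

end Regularity

/-! ### Polynomial dependence on the spectral parameter -/

section Polynomials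

open Polynomial

/-- `f` is a polynomial function of degree at most `d`, with coefficient `c` in degree `d`. -/
def IsPolyLE (d : ℕ) (c : ℂ) (f : ℂ → ℂ) : Prop :=
  ∃ q : ℂ[X], q.natDegree ≤ d ∧ q.coeff d = c ∧ ∀ x, q.eval x = f x

theorem IsPolyLE.mul {d d' : ℕ} {c c' : ℂ} {f f' : ℂ → ℂ} (h : IsPolyLE d c f)
    (h' : IsPolyLE d' c' f') : IsPolyLE (d + d') (c * c') fun x => f x * f' x := by
  obtain ⟨q, h1, h2, h3⟩ := h
  obtain ⟨q', h1', h2', h3'⟩ := h'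
  refine ⟨q * q', natDegree_mul_le.trans (by omega), ?_, fun x => by rw [eval_mul, h3, h3']⟩
  rw [coeff_mul_add_eq_of_natDegree_le h1 h1', h2, h2']

theorem IsPolyLE.sum {ι : Type*} {s : Finset ι} {d : ℕ} {c : ι → ℂ} {f : ι → ℂ → ℂ}
    (h : ∀ i, IsPolyLE d (c i) (f i)) : IsPolyLE d (∑ i ∈ s, c i) fun x => ∑ i ∈ s, f i x := by
  choose q h1 h2 h3 using h
  exact ⟨∑ i ∈ s, q i, natDegree_sum_le_of_forall_le _ _ fun i _ => h1 i, by
    rw [finsetSum_coeff]; exact Finset.sum_congr rfl fun i _ => h2 i, fun x => by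
    rw [eval_finsetSum]; exact Finset.sum_congr rfl fun i _ => h3 i x⟩

theorem isPolyLE_linear (a b : ℂ) : IsPolyLE 1 a fun x => x * a + b :=
  ⟨C a * X + C b, natDegree_linear_le, by simp [coeff_C], fun x => by simp; ring⟩

theorem isPolyLE_const (c : ℂ) : IsPolyLE 0 c fun _ => c :=
  ⟨C c, by simp, by simp, fun x => by simp⟩

variable {N : ℕ}

/-- All the matrix entries of `X` are polynomials of degree at most `d`, with leading
coefficients `c`. -/
def EntriesPoly (d : ℕ) (c : AuxOp N) (X : ℂ → AuxOp N) : Prop :=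
  ∀ a b s t, IsPolyLE d (c a b s t) fun x => X x a b s t

theorem EntriesPoly.mul {d d' : ℕ} {c c' : AuxOp N} {X X' : ℂ → AuxOp N}
    (h : EntriesPoly d c X) (h' : EntriesPoly d' c' X') :
    EntriesPoly (d + d') (c * c') fun x => X x * X' x := by
  intro a b s t
  simp only [mul_entry]
  exact IsPolyLE.sum fun _ => IsPolyLE.sum fun _ => (h _ _ _ _).mul (h' _ _ _ _)

theorem EntriesPoly.list_prod {η : ℂ} (u : Fin N → ℂ) (l : List (Fin N)) :
    EntriesPoly l.length 1 fun x => (l.map fun n => lax η (siteUnit N n) (x + u n)).prod := by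
  induction l with
  | nil => intro a b s t; simpa using isPolyLE_const _
  | cons n l ih =>
    simp only [List.map_cons, List.prod_cons, List.length_cons]
    rw [add_comm l.length 1, ← mul_one (1 : AuxOp N)]
    refine EntriesPoly.mul (fun a b s t => ?_) ih
    simp only [lax_entry, add_mul, add_assoc]
    exact isPolyLE_linear _ _

theorem entriesPoly_boundary (k : AuxOp N) (v : ℂ) :
    EntriesPoly 1 k fun x => 1 + (x + v) • k := by
  intro a b s t
  have h := isPolyLE_linear (k a b s t) ((1 : AuxOp N) a b s t + v * k a b s t)
  convert h using 2 with x
  simp only [Matrix.add_apply, Matrix.smul_apply, smul_eq_mul]; ring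

variable {bp bm : BoundaryParam} (hp : bp.1 ≠ 0) (hm : bm.1 ≠ 0) (η : ℂ) (ξ : Fin N → ℂ)

include hp hm in
-- Each Lax operator is λ plus a constant, so the leading term involves only the two numerical
-- boundary directions; its auxiliary trace is a number times the identity of the chain.
theorem transferMatrix_isPolyLE :
    ∃ c : ℂ, ∀ s t, IsPolyLE (2 * N + 2) ((c • (1 : Op N)) s t)
      fun x => transferMatrix N η ξ bp bm x s t := by
  set P := numMat (Op N) (boundaryDir bp)
  set M := numMat (Op N) (boundaryDir bm)
  have h1 := EntriesPoly.list_prod (η := η) (fun n => -ξ n - η / 2) (List.finRange N).reverse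
  have h2 := EntriesPoly.list_prod (η := η) (fun n => ξ n - η / 2) (List.finRange N)
  rw [List.length_reverse, List.length_finRange] at h1
  rw [List.length_finRange] at h2
  have h := (entriesPoly_boundary P (η / 2)).mul
    ((h1.mul (entriesPoly_boundary M (-(η / 2)))).mul h2)
  refine ⟨(boundaryDir bp * boundaryDir bm).trace, fun s t => ?_⟩
  have h' := IsPolyLE.sum (s := Finset.univ) fun a => h a a s t
  rw [one_mul, mul_one] at h'
  convert h' using 1
  · ring
  · rw [← map_mul, Matrix.trace, Finset.sum_smul, Matrix.sum_apply]
    simp only [numMat_apply, Algebra.algebraMap_eq_smul_one, Matrix.diag]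
  · funext x
    rw [transferMatrix_eq hp hm, dressed_eq, Matrix.trace, Matrix.sum_apply]
    simp only [List.reverse_reverse, Matrix.diag, sub_eq_add_neg, add_assoc, P, M]

theorem sum_range_two_mul (f : ℕ → ℂ) (m : ℕ) :
    ∑ i ∈ Finset.range (2 * m), f i = ∑ i ∈ Finset.range m, (f (2 * i) + f (2 * i + 1)) := by
  induction m with
  | zero => simp
  | succ m ih =>
    rw [Finset.sum_range_succ, ← ih, Nat.mul_succ, Finset.sum_range_succ, Finset.sum_range_succ,
      add_assoc]

/-- An even polynomial is a polynomial in the square of the variable. -/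
theorem IsPolyLE.even {d : ℕ} {c : ℂ} {f : ℂ → ℂ} (h : IsPolyLE (2 * d) c f) {w : ℂ}
    (hf : ∀ x, (2 * x - w) * f (-x) = (2 * x - w) * f x) :
    ∃ r : ℂ[X], r.natDegree ≤ d ∧ r.coeff d = c ∧ ∀ x, r.eval (x ^ 2) = f x := by
  obtain ⟨q, h1, h2, h3⟩ := h
  -- The factor 2x - w may vanish at a point, but it is a nonzero polynomial and can be cancelled in
  -- ℂ[X].
  have hq : q.comp (C (-1) * X) = q := by
    have hne : (C 2 * X - C w : ℂ[X]) ≠ 0 := by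
      intro h0
      have := congrArg (fun p => coeff p 1) h0
      simp [coeff_C] at this
    refine mul_left_cancel₀ hne (Polynomial.funext fun x => ?_)
    simpa [h3] using hf x
  have hodd : ∀ i, q.coeff (2 * i + 1) = 0 := by
    intro i
    have h := congrArg (fun p => coeff p (2 * i + 1)) hq
    simp only [comp_C_mul_X_coeff] at h
    rw [pow_succ, pow_mul] at h
    norm_num at h
    linear_combination (-1 / 2 : ℂ) * h
  refine ⟨∑ i ∈ Finset.range (d + 1), monomial i (q.coeff (2 * i)), ?_, ?_, fun x => ?_⟩
  · refine natDegree_sum_le_of_forall_le _ _ fun i hi => (natDegree_monomial_le _).trans ?_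
    have := Finset.mem_range.mp hi
    omega
  · rw [finsetSum_coeff]
    simp [coeff_monomial, h2]
  · rw [← h3, eval_finsetSum, eval_eq_sum_range' (n := 2 * (d + 1)) (by omega),
      sum_range_two_mul]
    refine Finset.sum_congr rfl fun i _ => ?_
    rw [hodd, eval_monomial, ← pow_mul]; ring

include hp hm in
/-- Interpolation of the transfer matrix through its values at `N` points, its asymptotics and its
value at `η/2`. -/
theorem transferMatrix_interpolate {y : Fin N → ℂ} (hy : Function.Injective fun a => y a ^ 2)
    (hy' : ∀ a, y a ^ 2 ≠ (η / 2) ^ 2) (lam : ℂ) :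
    ∃ c : ℂ, transferMatrix N η ξ bp bm lam = c • 1 +
      ∑ a, ((lam ^ 2 - (η / 2) ^ 2) / (y a ^ 2 - (η / 2) ^ 2) *
        (Lagrange.basis Finset.univ (fun a => y a ^ 2) a).eval (lam ^ 2)) •
          transferMatrix N η ξ bp bm (y a) := by
  obtain ⟨c, hc⟩ := transferMatrix_isPolyLE hp hm η ξ
  obtain ⟨c', hc'⟩ := transferMatrix_half hp hm η ξ
  have heven : ∀ s t, ∃ r : ℂ[X], r.natDegree ≤ N + 1 ∧ r.coeff (N + 1) = (c • (1 : Op N)) s t ∧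
      ∀ x, r.eval (x ^ 2) = transferMatrix N η ξ bp bm x s t := by
    intro s t
    refine (hc s t).even (w := η) fun x => ?_
    have h := congrFun (congrFun (transferMatrix_neg_aux hp hm η ξ x) s) t
    simpa using h
  -- The extra node `none` is (η/2)², where the transfer matrix is a scalar.
  let v : Option (Fin N) → ℂ := fun o => o.elim ((η / 2) ^ 2) fun a => y a ^ 2
  have hv : Function.Injective v := by
    rintro (_ | a) (_ | b) h
    · rfl
    · exact absurd h.symm (hy' b)
    · exact absurd h (hy' a)
    · exact congrArg some (hy h)
  let W : ℂ[X] := ∏ o, (X - C (v o))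
  have hWm : W.Monic := monic_prod_of_monic _ _ fun o _ => monic_X_sub_C _
  have hWd : W.natDegree = N + 1 := by
    rw [natDegree_prod_of_monic _ _ fun o _ => monic_X_sub_C _]; simp
  have hW0 : ∀ o, W.eval (v o) = 0 := fun o => by
    rw [eval_prod]; exact Finset.prod_eq_zero (Finset.mem_univ o) (by simp)
  have hbasis : ∀ a, (Lagrange.basis Finset.univ v (some a)).eval (lam ^ 2) =
      (lam ^ 2 - (η / 2) ^ 2) / (y a ^ 2 - (η / 2) ^ 2) *
        (Lagrange.basis Finset.univ (fun a => y a ^ 2) a).eval (lam ^ 2) := by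
    intro a
    have he : (Finset.univ : Finset (Option (Fin N))).erase (some a) =
        Finset.insertNone (Finset.univ.erase a) := by
      ext o; cases o <;> simp
    rw [Lagrange.basis, he, Finset.prod_insertNone, Lagrange.basis, eval_mul]
    congr 1
    simp [Lagrange.basisDivisor, v, div_eq_inv_mul]
  refine ⟨c * W.eval (lam ^ 2) + (Lagrange.basis Finset.univ v none).eval (lam ^ 2) * c', ?_⟩
  ext s t
  obtain ⟨r, hr1, hr2, hr3⟩ := heven s t
  -- In the variable λ² the degree is at most N + 1, one too many for N + 1 nodes. Subtracting the
  -- leading coefficient times the nodal polynomial W lowers it without changing any value at the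
  -- nodes.
  have hdeg : (r - C ((c • (1 : Op N)) s t) * W).degree < (Finset.univ : Finset (Option (Fin N))).card := by
    rw [Finset.card_univ, Fintype.card_option, Fintype.card_fin]
    refine lt_of_le_of_ne (degree_le_of_natDegree_le ?_) fun h0 => ?_
    · refine (natDegree_sub_le _ _).trans (max_le hr1 ((natDegree_C_mul_le _ _).trans hWd.le))
    · have hcoef : (r - C ((c • (1 : Op N)) s t) * W).coeff (N + 1) = 0 := by
        rw [coeff_sub, coeff_C_mul, hr2, ← hWd, hWm.coeff_natDegree, mul_one, sub_self]
      exact coeff_ne_zero_of_eq_degree h0 hcoef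
  have hint := Lagrange.eq_interpolate (s := Finset.univ) (v := v) hv.injOn hdeg
  have hev := congrArg (eval (lam ^ 2)) hint
  rw [Lagrange.interpolate_apply, eval_finsetSum, Fintype.sum_option] at hev
  simp only [eval_mul, eval_C, eval_sub, hW0, mul_zero, sub_zero, hbasis, hr3] at hev
  have hv0 : r.eval (v none) = c' * (1 : Op N) s t := by
    have : v none = (η / 2) ^ 2 := rfl
    rw [this, hr3, hc']; rfl
  have hva : ∀ a, r.eval (v (some a)) = transferMatrix N η ξ bp bm (y a) s t := fun a => hr3 _
  rw [hv0] at hev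
  simp only [hva] at hev
  rw [Matrix.add_apply, Matrix.sum_apply]
  simp only [Matrix.smul_apply, smul_eq_mul] at hev ⊢
  have hcomm : ∀ a, transferMatrix N η ξ bp bm (y a) s t * ((lam ^ 2 - (η / 2) ^ 2) / (y a ^ 2 - (η / 2) ^ 2) *
        (Lagrange.basis Finset.univ (fun a => y a ^ 2) a).eval (lam ^ 2)) = ((lam ^ 2 - (η / 2) ^ 2) / (y a ^ 2 - (η / 2) ^ 2) *
        (Lagrange.basis Finset.univ (fun a => y a ^ 2) a).eval (lam ^ 2)) * transferMatrix N η ξ bp bm (y a) s t := fun a => mul_comm _ _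
  simp only [hcomm] at hev
  linear_combination hev

theorem vHat_eq_vandermonde (x : Fin N → ℂ) :
    vHat x = (Matrix.vandermonde fun i => x i ^ 2).det := by
  rw [vHat]; congr 1; ext i j; simp [Matrix.vandermonde_apply, pow_mul]

theorem vHat_ne_zero {x : Fin N → ℂ} (hx : Function.Injective fun a => x a ^ 2) : vHat x ≠ 0 := by
  rw [vHat_eq_vandermonde]; exact Matrix.det_vandermonde_ne_zero_iff.mpr hx

/-- The new row is the combination of the old rows with Lagrange coefficients, because interpolation
is exact on powers below N; only the coefficient of row n survives in the determinant. -/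
theorem vHat_update {x : Fin N → ℂ} (hx : Function.Injective fun a => x a ^ 2) (n : Fin N) (z : ℂ) :
    vHat (Function.update x n z) =
      (Lagrange.basis Finset.univ (fun a => x a ^ 2) n).eval (z ^ 2) * vHat x := by
  rw [vHat_eq_vandermonde, vHat_eq_vandermonde, ← smul_eq_mul,
    ← Matrix.det_updateRow_sum (Matrix.vandermonde fun i => x i ^ 2) n
      fun k => (Lagrange.basis Finset.univ (fun a => x a ^ 2) k).eval (z ^ 2)]
  congr 1
  ext i j
  by_cases hi : i = n
  · subst hi
    have hdeg : (X ^ (j : ℕ) : ℂ[X]).degree < (Finset.univ : Finset (Fin N)).card := by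
      rw [degree_X_pow, Finset.card_univ, Fintype.card_fin]; exact_mod_cast j.2
    have h := congrArg (eval (z ^ 2)) (Lagrange.eq_interpolate (s := Finset.univ) hx.injOn hdeg)
    rw [Lagrange.interpolate_apply, eval_finsetSum] at h
    simp only [eval_mul, eval_C, eval_pow, eval_X] at h
    rw [Matrix.updateRow_self, Matrix.vandermonde_apply, Function.update_self, h, Finset.sum_apply]
    exact Finset.sum_congr rfl fun k _ => mul_comm _ _
  · rw [Matrix.updateRow_ne hi, Matrix.vandermonde_apply, Matrix.vandermonde_apply,
      Function.update_of_ne hi]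

end Polynomials


/-! ### The separation of variables bases -/

section Bases

variable {N : ℕ}

theorem list_prod_update {M : Type*} [Monoid M] {ι : Type*} [DecidableEq ι] {g : ι → M} {n : ι}
    {b : M} (hg : g n = 1) (hb : ∀ m, Commute (g m) b) {l : List ι} (hl : l.Nodup) (hn : n ∈ l) :
    (l.map (Function.update g n b)).prod = b * (l.map g).prod := by
  induction l with
  | nil => simp at hn
  | cons m l ih =>
    rw [List.nodup_cons] at hl
    rw [List.map_cons, List.prod_cons, List.map_cons, List.prod_cons]
    rcases List.mem_cons.mp hn with rfl | hn
    · have : l.map (Function.update g n b) = l.map g := List.map_congr_left fun a ha => by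
        rw [Function.update_of_ne]; rintro rfl; exact hl.1 ha
      rw [this, Function.update_self, hg, one_mul]
    · have hmn : m ≠ n := by rintro rfl; exact hl.1 hn
      rw [ih hl.2 hn, Function.update_of_ne hmn, ← mul_assoc, (hb m).eq, mul_assoc]

theorem list_ofFn_prod_update {M : Type*} [Monoid M] {g : Fin N → M} {n : Fin N}
    {b : M} (hg : g n = 1) (hb : ∀ m, Commute (g m) b) :
    (List.ofFn (Function.update g n b)).prod = b * (List.ofFn g).prod := by
  rw [List.ofFn_eq_map, List.ofFn_eq_map]
  exact list_prod_update hg hb (List.nodup_finRange N) (List.mem_finRange n)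

theorem list_ofFn_prod_commute {M : Type*} [Monoid M] {g : Fin N → M} {b : M}
    (hb : ∀ m, Commute (g m) b) : Commute (List.ofFn g).prod b :=
  Commute.list_prod_left _ _ fun x hx => by
    obtain ⟨m, rfl⟩ := (List.mem_ofFn' _ _).mp hx; exact hb m

/-- A set of covectors and a set of vectors generated from each other by commuting operators are
orthogonal to each other. -/
theorem sov_orthogonality {A B : Fin N → Op N} {cov vec : Config N → State N} {α κ : Fin N → ℂ}
    {v : Config N → ℂ} {c₀ : ℂ} (hα : ∀ n, α n ≠ 0) (hκ : ∀ n, κ n ≠ 0) (hv : ∀ h, v h ≠ 0)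
    (hA : ∀ h n, h n = 1 → Matrix.vecMul (cov h) (A n) = α n • cov (Function.update h n 0))
    (hB : ∀ h n, h n = 0 → ∃ q : ℂ, Matrix.vecMul (cov h) (B n) = q • cov (Function.update h n 1))
    (hint : ∀ h n, h n = 1 → ∃ (c : ℂ) (l : Fin N → ℂ),
      l n = κ n * (v (Function.update h n 0) / v h) ∧
        B n = c • 1 + ∑ a, l a • (if h a = 0 then B a else A a))
    (hvec : ∀ h n, h n = 0 →
      vec (Function.update h n 1) = (κ n * α n)⁻¹ • Matrix.mulVec (B n) (vec h))
    (h0 : ∀ h', cov h' ⬝ᵥ vec (fun _ => 0) = if h' = (fun _ => 0) then c₀ else 0)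
    (h' h : Config N) :
    cov h' ⬝ᵥ vec h = if h = h' then c₀ * (v (fun _ => 0) / v h) else 0 := by
  have htwo : ∀ i : Fin 2, i = 0 ∨ i = 1 := by decide
  -- Induction on the number of labels 1 in the vector, for all covectors at once.
  suffices H : ∀ (m : ℕ) (h : Config N), (Finset.univ.filter fun n => h n = 1).card = m →
      ∀ h', cov h' ⬝ᵥ vec h = if h = h' then c₀ * (v (fun _ => 0) / v h) else 0 from
    H _ h rfl h'
  intro m
  induction m with
  | zero =>
    intro h hm h'
    have : h = fun _ => 0 := by
      funext n
      rcases htwo (h n) with hn | hn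
      · exact hn
      · have := Finset.card_eq_zero.mp hm
        exact absurd (Finset.mem_filter.mpr ⟨Finset.mem_univ n, hn⟩) (by rw [this]; simp)
    subst this
    rw [h0, div_self (hv _), mul_one]
    simp only [eq_comm]
  | succ m ih =>
    intro h hm h'
    obtain ⟨n, hn⟩ := Finset.card_pos.mp (by rw [hm]; omega)
    have hn : h n = 1 := (Finset.mem_filter.mp hn).2
    set g := Function.update h n 0 with hg
    have hgn : g n = 0 := by simp [hg]
    have hgh : Function.update g n 1 = h := by
      rw [hg, Function.update_idem, ← hn, Function.update_eq_self]
    have hcard : (Finset.univ.filter fun n => g n = 1).card = m := by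
      have : (Finset.univ.filter fun a => g a = 1) =
          (Finset.univ.filter fun a => h a = 1).erase n := by
        ext a
        by_cases ha : a = n
        · subst ha; simp [hgn]
        · simp [hg, ha]
      rw [this, Finset.card_erase_of_mem (by simp [hn]), hm]; rfl
    have IH := ih g hcard
    rw [← hgh, hvec g n hgn, dotProduct_smul, Matrix.dotProduct_mulVec, hgh]
    -- The vector g has label 0 at n, so by induction it is annihilated by every covector with label
    -- 1 there.
    have hne : ∀ f : Config N, f n = 1 → cov f ⬝ᵥ vec g = 0 := fun f hf => by
      rw [IH, if_neg]; rintro rfl; rw [hgn] at hf; exact absurd hf (by decide)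
    rcases htwo (h' n) with hn' | hn'
    · obtain ⟨q, hq⟩ := hB h' n hn'
      rw [hq, smul_dotProduct, hne _ (by simp), if_neg]
      · simp
      · rintro rfl; rw [hn] at hn'; exact absurd hn' (by decide)
    · obtain ⟨c, l, hl, hBn⟩ := hint h' n hn'
      -- In the interpolation of B n at the labels h', the scalar term and the terms a ≠ n leave the
      -- label 1 at n untouched and pair to zero with g. Only A n lowers that label.
      have hsum : Matrix.vecMul (cov h') (B n) ⬝ᵥ vec g =
          l n * α n * (cov (Function.update h' n 0) ⬝ᵥ vec g) := by
        rw [hBn, Matrix.vecMul_add, Matrix.vecMul_sum, add_dotProduct, sum_dotProduct,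
          Matrix.vecMul_smul, Matrix.vecMul_one, smul_dotProduct, hne h' hn', smul_zero, zero_add,
          Finset.sum_eq_single n]
        · rw [Matrix.vecMul_smul, if_neg (by rw [hn']; decide), hA h' n hn', smul_dotProduct,
            smul_dotProduct, smul_eq_mul, smul_eq_mul, mul_assoc]
        · intro a _ han
          rw [Matrix.vecMul_smul, smul_dotProduct]
          rcases htwo (h' a) with ha | ha
          · obtain ⟨q, hq⟩ := hB h' a ha
            rw [if_pos ha, hq, smul_dotProduct, hne _ (by rw [Function.update_of_ne han.symm, hn'])]
            simp
          · rw [if_neg (by rw [ha]; decide), hA h' a ha, smul_dotProduct,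
              hne _ (by rw [Function.update_of_ne han.symm, hn'])]
            simp
        · simp
      rw [hsum, IH, hl]
      have hiff : g = Function.update h' n 0 ↔ h = h' := by
        constructor
        · intro he
          rw [← hgh, he, Function.update_idem, ← hn', Function.update_eq_self]
        · rintro rfl; rfl
      by_cases he : h = h'
      · subst he
        rw [if_pos (hiff.mpr rfl), if_pos rfl, ← hg, smul_eq_mul]
        have h1 := hα n
        have h2 := hκ n
        have h3 := hv h
        have h4 := hv g
        field_simp
      · rw [if_neg (fun h => he (hiff.mp h)), if_neg he]; simp

theorem isBasisFamily_of_linearIndependent {v : Config N → State N} (h : LinearIndependent ℂ v) :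
    IsBasisFamily v :=
  ⟨h, h.span_eq_top_of_card_eq_finrank' (by rw [Module.finrank_fintype_fun_eq_card])⟩

theorem isBasisFamily_of_biorthogonal {cov vec : Config N → State N} {d : Config N → ℂ}
    (hd : ∀ h, d h ≠ 0) (H : ∀ h' h, cov h' ⬝ᵥ vec h = if h = h' then d h else 0) :
    IsBasisFamily vec := by
  refine isBasisFamily_of_linearIndependent (Fintype.linearIndependent_iff.mpr fun g hg h' => ?_)
  have h := congrArg (fun x => cov h' ⬝ᵥ x) hg
  simp only [dotProduct_sum, dotProduct_smul, H, dotProduct_zero, smul_eq_mul, mul_ite, mul_zero,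
    Finset.sum_ite_eq', Finset.mem_univ, if_true] at h
  exact (mul_eq_zero.mp h).resolve_right (hd h')

theorem existsUnique_isReference {cov : Config N → State N} (h : IsBasisFamily cov) (c : ℂ) :
    ∃! R : State N, IsReference cov c R := by
  set C : Op N := Matrix.of cov
  have hC : IsUnit C := Matrix.linearIndependent_rows_iff_isUnit.mp h.1
  have hdet := (Matrix.isUnit_iff_isUnit_det C).mp hC
  set b : State N := fun h => if h = (fun _ => 0) then c else 0
  have hiff : ∀ R, IsReference cov c R ↔ Matrix.mulVec C R = b := fun R =>
    ⟨fun h => funext h, fun h => congrFun h⟩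
  refine ⟨Matrix.mulVec C⁻¹ b, ?_, fun R hR => ?_⟩
  · refine (hiff _).mpr ?_
    rw [Matrix.mulVec_mulVec, Matrix.mul_nonsing_inv _ hdet, Matrix.one_mulVec]
  · rw [← (hiff R).mp hR, Matrix.mulVec_mulVec, Matrix.nonsing_inv_mul _ hdet, Matrix.one_mulVec]

/-! ### The dual bases at generic inhomogeneities. -/

section Generic

variable {η : ℂ} {ξ : Fin N → ℂ}

theorem shifted_zero {h : Config N} {n : Fin N} (hn : h n = 0) :
    shifted η ξ h n = ξ n + η / 2 := by simp [shifted, hn]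

theorem shifted_one {h : Config N} {n : Fin N} (hn : h n = 1) :
    shifted η ξ h n = ξ n - η / 2 := by simp [shifted, hn]; ring

theorem shifted_update (h : Config N) (n : Fin N) :
    shifted η ξ (Function.update h n 0) =
      Function.update (shifted η ξ h) n (ξ n + η / 2) := by
  funext a
  by_cases ha : a = n
  · subst ha; rw [Function.update_self, shifted_zero (by simp)]
  · rw [Function.update_of_ne ha, shifted, shifted, Function.update_of_ne ha]

/-- Equality of two squares forces a sum or a difference of two inhomogeneities to be 0, η or -η,
which genericity excludes. These squares are the interpolation nodes. -/
theorem GenericInhom.shifted_injective (hξ : GenericInhom η ξ) (h : Config N) :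
    Function.Injective fun a => shifted η ξ h a ^ 2 := by
  intro a b hab
  by_contra hne
  obtain ⟨h1, h2⟩ := hξ.2 a b hne
  simp only [Set.mem_insert_iff, Set.mem_singleton_iff, not_or] at h1 h2
  have htwo : ∀ i : Fin 2, i = 0 ∨ i = 1 := by decide
  have key : (shifted η ξ h a - shifted η ξ h b) * (shifted η ξ h a + shifted η ξ h b) = 0 := by
    have : shifted η ξ h a ^ 2 = shifted η ξ h b ^ 2 := hab
    linear_combination this
  rcases htwo (h a) with ha | ha <;> rcases htwo (h b) with hb | hb <;>
    simp only [shifted_zero, shifted_one, ha, hb] at key <;>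
    rcases mul_eq_zero.mp key with k | k
  · exact h2.1 (by linear_combination k)
  · exact h1.2.1 (by linear_combination k)
  · exact h2.2.1 (by linear_combination k)
  · exact h1.1 (by linear_combination k)
  · exact h2.2.2 (by linear_combination k)
  · exact h1.1 (by linear_combination k)
  · exact h2.1 (by linear_combination k)
  · exact h1.2.2 (by linear_combination k)

theorem GenericInhom.injective (hξ : GenericInhom η ξ) : Function.Injective fun a => ξ a ^ 2 := by
  intro a b hab
  by_contra hne
  obtain ⟨h1, h2⟩ := hξ.2 a b hne
  simp only [Set.mem_insert_iff, Set.mem_singleton_iff, not_or] at h1 h2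
  have key : (ξ a - ξ b) * (ξ a + ξ b) = 0 := by
    have : ξ a ^ 2 = ξ b ^ 2 := hab
    linear_combination this
  rcases mul_eq_zero.mp key with k | k
  exacts [h2.1 k, h1.1 k]

theorem GenericInhom.shifted_sq_ne (hξ : GenericInhom η ξ) (h : Config N) (a : Fin N) :
    shifted η ξ h a ^ 2 ≠ (η / 2) ^ 2 := by
  have h1 := hξ.1 a
  simp only [Set.mem_insert_iff, Set.mem_singleton_iff, not_or] at h1
  have htwo : ∀ i : Fin 2, i = 0 ∨ i = 1 := by decide
  intro he
  rcases htwo (h a) with ha | ha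
  · rw [shifted_zero ha] at he
    rcases mul_eq_zero.mp (show ξ a * (ξ a + η) = 0 by linear_combination he) with k | k
    exacts [h1.1 k, h1.2.1 (by linear_combination k)]
  · rw [shifted_one ha] at he
    rcases mul_eq_zero.mp (show ξ a * (ξ a - η) = 0 by linear_combination he) with k | k
    exacts [h1.1 k, h1.2.2 (by linear_combination k)]

variable {bp bm : BoundaryParam} {εp εm : ℤˣ} {S : State N}

/-- If the covectors form a basis, their normalization factors do not vanish. -/
theorem coefA_ne_zero_of_isBasisFamily (h : IsBasisFamily (covector η ξ bp bm εp εm S))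
    (n : Fin N) : coefA η ξ (zetaBar εp bp) (zetaBar εm bm) (η / 2 - ξ n) ≠ 0 := by
  intro h0
  refine h.1.ne_zero (fun _ => 0) ?_
  rw [covector, List.prod_eq_zero, Matrix.vecMul_zero]
  exact (List.mem_ofFn' _ _).mpr ⟨n, by simp [h0]⟩

/-- The factors commute, so the one attached to n can be moved to the right end of the product. -/
theorem covector_update (hp : bp.1 ≠ 0) (hm : bm.1 ≠ 0) {h : Config N} {n : Fin N} (hn : h n = 1) :
    covector η ξ bp bm εp εm S (Function.update h n 0) =
      (coefA η ξ (zetaBar εp bp) (zetaBar εm bm) (η / 2 - ξ n))⁻¹ •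
        Matrix.vecMul (covector η ξ bp bm εp εm S h) (transferMatrix N η ξ bp bm (ξ n - η / 2)) := by
  set X : Fin N → Op N := fun n => (coefA η ξ (zetaBar εp bp) (zetaBar εm bm) (η / 2 - ξ n))⁻¹ •
    transferMatrix N η ξ bp bm (ξ n - η / 2) with hX
  set g : Fin N → Op N := fun m => X m ^ (1 - (h m : ℕ)) with hg
  have hcomm : ∀ m, Commute (g m) (X n) := fun m =>
    Commute.pow_left (((transferMatrix_commute hp hm η ξ _ _).smul_left _).smul_right _) _
  have h1 : (fun m => X m ^ (1 - (Function.update h n 0 m : ℕ))) = Function.update g n (X n) := by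
    funext m
    by_cases hmn : m = n
    · subst hmn; simp
    · rw [Function.update_of_ne hmn, Function.update_of_ne hmn]
  have h2 : (List.ofFn fun m => X m ^ (1 - (Function.update h n 0 m : ℕ))).prod =
      (List.ofFn g).prod * X n := by
    rw [h1, list_ofFn_prod_update (by simp [hg, hn]) hcomm, (list_ofFn_prod_commute hcomm).eq]
  have h3 : covector η ξ bp bm εp εm S (Function.update h n 0) =
      Matrix.vecMul S ((List.ofFn g).prod * X n) := by rw [← h2]; rfl
  rw [h3, ← Matrix.vecMul_vecMul, ← Matrix.vecMul_smul]; rfl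

theorem vector_update (hp : bp.1 ≠ 0) (hm : bm.1 ≠ 0) (R : State N) {h : Config N} {n : Fin N}
    (hn : h n = 0) :
    vector η ξ bp bm εp εm R (Function.update h n 1) =
      (kCoef η (ξ n) * coefA η ξ (zetaBar εp bp) (zetaBar εm bm) (η / 2 - ξ n))⁻¹ •
        Matrix.mulVec (transferMatrix N η ξ bp bm (ξ n + η / 2)) (vector η ξ bp bm εp εm R h) := by
  set X : Fin N → Op N := fun n =>
    (kCoef η (ξ n) * coefA η ξ (zetaBar εp bp) (zetaBar εm bm) (η / 2 - ξ n))⁻¹ •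
      transferMatrix N η ξ bp bm (ξ n + η / 2) with hX
  set g : Fin N → Op N := fun m => X m ^ (h m : ℕ) with hg
  have hcomm : ∀ m, Commute (g m) (X n) := fun m =>
    Commute.pow_left (((transferMatrix_commute hp hm η ξ _ _).smul_left _).smul_right _) _
  have h1 : (fun m => X m ^ (Function.update h n 1 m : ℕ)) = Function.update g n (X n) := by
    funext m
    by_cases hmn : m = n
    · subst hmn; simp
    · rw [Function.update_of_ne hmn, Function.update_of_ne hmn]
  have h2 : (List.ofFn fun m => X m ^ (Function.update h n 1 m : ℕ)).prod =
      X n * (List.ofFn g).prod := by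
    rw [h1, list_ofFn_prod_update (by simp [hg, hn]) hcomm]
  have h3 : vector η ξ bp bm εp εm R (Function.update h n 1) =
      Matrix.mulVec (X n * (List.ofFn g).prod) R := by rw [← h2]; rfl
  rw [h3, ← Matrix.mulVec_mulVec, ← Matrix.smul_mulVec]; rfl

/-- The pairing of the two bases, for an arbitrary normalization of the reference vector. -/
theorem covector_dotProduct_vector (hξ : GenericInhom η ξ) (hp : bp.1 ≠ 0)
    (hm : bm.1 ≠ 0) (hbasis : IsBasisFamily (covector η ξ bp bm εp εm S)) {c : ℂ} {R : State N}
    (hR : IsReference (covector η ξ bp bm εp εm S) c R) (h' h : Config N) :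
    covector η ξ bp bm εp εm S h' ⬝ᵥ vector η ξ bp bm εp εm R h =
      if h = h' then c * (vHat (shifted η ξ fun _ => 0) / vHat (shifted η ξ h)) else 0 := by
  have hα := coefA_ne_zero_of_isBasisFamily hbasis
  have hV : ∀ h, vHat (shifted η ξ h) ≠ 0 := fun h => vHat_ne_zero (hξ.shifted_injective h)
  have hgen : ∀ n, ξ n ≠ 0 ∧ ξ n ≠ -η ∧ ξ n ≠ η := fun n => by
    simpa only [Set.mem_insert_iff, Set.mem_singleton_iff, not_or] using hξ.1 n
  have hκ : ∀ n, kCoef η (ξ n) ≠ 0 := fun n => by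
    obtain ⟨_, h2, h3⟩ := hgen n
    exact div_ne_zero (fun h => h2 (by linear_combination h)) (sub_ne_zero.mpr h3)
  have hA : ∀ h n, h n = 1 → Matrix.vecMul (covector η ξ bp bm εp εm S h)
      (transferMatrix N η ξ bp bm (ξ n - η / 2)) =
        coefA η ξ (zetaBar εp bp) (zetaBar εm bm) (η / 2 - ξ n) •
          covector η ξ bp bm εp εm S (Function.update h n 0) := fun h n hn => by
    rw [covector_update hp hm hn, smul_smul, mul_inv_cancel₀ (hα n), one_smul]
  refine sov_orthogonality (A := fun n => transferMatrix N η ξ bp bm (ξ n - η / 2))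
    (B := fun n => transferMatrix N η ξ bp bm (ξ n + η / 2))
    (v := fun h => vHat (shifted η ξ h)) hα hκ hV hA ?_ ?_ ?_ ?_ h' h
  · intro h n hn
    -- With label 0 at n the covector already contains 𝒯(ξₙ - η/2); multiplying by 𝒯(ξₙ + η/2)
    -- closes the fused scalar and leaves the covector with label 1.
    obtain ⟨q, hq⟩ := transferMatrix_fused hp hm η ξ n
    have h1 := covector_update (S := S) (εp := εp) (εm := εm) (ξ := ξ) (η := η) hp hm
      (h := Function.update h n 1) (n := n) (by simp)
    have hh : Function.update h n 0 = h := by rw [← hn, Function.update_eq_self]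
    rw [Function.update_idem, hh] at h1
    refine ⟨(coefA η ξ (zetaBar εp bp) (zetaBar εm bm) (η / 2 - ξ n))⁻¹ * q, ?_⟩
    rw [h1, Matrix.smul_vecMul, Matrix.vecMul_vecMul, hq, Matrix.vecMul_smul, Matrix.vecMul_one,
      smul_smul]
  · intro h n hn
    obtain ⟨c, hc⟩ := transferMatrix_interpolate hp hm η ξ (hξ.shifted_injective h)
      (hξ.shifted_sq_ne h) (ξ n + η / 2)
    have hterm : ∀ a, transferMatrix N η ξ bp bm (shifted η ξ h a) =
        if h a = 0 then transferMatrix N η ξ bp bm (ξ a + η / 2)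
          else transferMatrix N η ξ bp bm (ξ a - η / 2) := fun a => by
      have htwo : ∀ i : Fin 2, i = 0 ∨ i = 1 := by decide
      rcases htwo (h a) with ha | ha
      · rw [shifted_zero ha, if_pos ha]
      · rw [shifted_one ha, if_neg (by rw [ha]; decide)]
    simp only [hterm] at hc
    refine ⟨c, fun a => ((ξ n + η / 2) ^ 2 - (η / 2) ^ 2) / (shifted η ξ h a ^ 2 - (η / 2) ^ 2) *
      (Lagrange.basis Finset.univ (fun a => shifted η ξ h a ^ 2) a).eval ((ξ n + η / 2) ^ 2),
      ?_, hc⟩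
    · dsimp only
      -- The ratio of Vandermonde determinants is the Lagrange factor at node n. The factor from the
      -- extra node η/2 is ξₙ(ξₙ + η) / (ξₙ(ξₙ - η)) = kₙ.
      rw [shifted_update, vHat_update (hξ.shifted_injective h), mul_div_assoc, div_self (hV h),
        mul_one]
      congr 1
      obtain ⟨h1, h2, h3⟩ := hgen n
      have h3' := sub_ne_zero.mpr h3
      rw [shifted_one hn, kCoef, show (ξ n + η / 2) ^ 2 - (η / 2) ^ 2 = ξ n * (ξ n + η) by ring,
        show (ξ n - η / 2) ^ 2 - (η / 2) ^ 2 = ξ n * (ξ n - η) by ring, mul_div_mul_left _ _ h1]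
  · exact fun h n hn => vector_update hp hm R hn
  · intro h'
    have : vector η ξ bp bm εp εm R (fun _ => 0) = R := by
      simp [vector, List.ofFn_const]
    rw [this]
    exact hR h'

end Generic

end Bases


/-! ### Zero sets of holomorphic functions -/

/-- On each real line through a point where f is nonzero, f is real analytic and not identically
zero, hence nonzero almost everywhere. Fubini gives a t ≠ 0 such that f(x₀ + t(y - x₀)) ≠ 0 for
almost every y, and the affine map y ↦ x₀ + t(y - x₀) is invertible and respects null sets. -/
theorem ae_ne_zero_of_differentiable {E : Type*} [NormedAddCommGroup E] [NormedSpace ℂ E]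
    [NormedSpace ℝ E] [IsScalarTower ℝ ℂ E] [FiniteDimensional ℝ E] [MeasurableSpace E]
    [BorelSpace E] (μ : Measure E) [μ.IsAddHaarMeasure] {f : E → ℂ} (hf : Differentiable ℂ f)
    (h : ∃ x, f x ≠ 0) : ∀ᵐ x ∂μ, f x ≠ 0 := by
  obtain ⟨x₀, h₀⟩ := h
  have : ProperSpace E := FiniteDimensional.proper_real E
  have line : ∀ y, ∀ᵐ t : ℝ, f (x₀ + t • (y - x₀)) ≠ 0 := by
    intro y
    have hG : Differentiable ℂ fun t : ℂ => f (x₀ + t • (y - x₀)) :=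
      hf.comp ((differentiable_id.smul_const _).const_add _)
    have hg : AnalyticOnNhd ℝ (fun t : ℝ => f (x₀ + (t : ℂ) • (y - x₀))) Set.univ := fun t _ =>
      (hG.analyticAt (t : ℂ)).restrictScalars.comp (Complex.ofRealCLM.analyticAt t)
    rcases hg.eqOn_zero_or_eventually_ne_zero_of_preconnected isPreconnected_univ with h | h
    · exact absurd (h (Set.mem_univ 0)) (by simpa using h₀)
    · have h' := ae_restrict_le_codiscreteWithin (μ := (volume : Measure ℝ)) MeasurableSet.univ h
      rw [Measure.restrict_univ] at h'
      filter_upwards [h'] with t ht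
      rw [← algebraMap_smul ℂ t (y - x₀)]
      exact ht
  have hm : MeasurableSet {p : E × ℝ | f (x₀ + p.2 • (p.1 - x₀)) ≠ 0} := by
    refine (isOpen_ne_fun ?_ continuous_const).measurableSet
    exact hf.continuous.comp (by fun_prop)
  have hae := (Measure.ae_ae_comm (μ := μ) (ν := (volume : Measure ℝ)) hm).mp
    (Filter.Eventually.of_forall line)
  obtain ⟨t, ht, ht0⟩ := (hae.and (Measure.ae_ne volume (0 : ℝ))).exists
  have hq : Measure.QuasiMeasurePreserving (fun x : E => t⁻¹ • x + (x₀ - t⁻¹ • x₀)) μ μ :=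
    (measurePreserving_add_right μ _).quasiMeasurePreserving.comp
      (Measure.quasiMeasurePreserving_smul μ (inv_ne_zero ht0))
  filter_upwards [hq.ae ht] with x hx
  have : x₀ + t • (t⁻¹ • x + (x₀ - t⁻¹ • x₀) - x₀) = x := by
    rw [smul_sub, smul_add, smul_sub, smul_smul, smul_smul, mul_inv_cancel₀ ht0, one_smul, one_smul]
    abel
  rwa [this] at hx

/-! ### Covectors built on a family of operators -/

section RawCovectors

variable {N : ℕ}

/-- The covectors `⟨S| ∏ₙ Xₙ^{1 - hₙ}`. -/
def rawCovector (X : Fin N → Op N) (S : State N) (h : Config N) : State N :=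
  Matrix.vecMul S (List.ofFn fun n => X n ^ (1 - (h n : ℕ))).prod

theorem list_prod_smul {A ι : Type*} [Ring A] [Algebra ℂ A] (b : ι → ℂ) (x : ι → A) (l : List ι) :
    (l.map fun n => b n • x n).prod = (l.map b).prod • (l.map x).prod := by
  induction l with
  | nil => simp
  | cons n l ih => simp only [List.map_cons, List.prod_cons, ih, smul_mul_smul_comm]

/-- Each covector is only multiplied by a nonzero number. This allows normalizations and
denominators to be removed, so that the determinant becomes an entire function. -/
theorem linearIndependent_rawCovector_smul {b : Fin N → ℂ} (hb : ∀ n, b n ≠ 0)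
    {X : Fin N → Op N} {S : State N} :
    LinearIndependent ℂ (rawCovector (fun n => b n • X n) S) ↔
      LinearIndependent ℂ (rawCovector X S) := by
  have key : ∀ {b : Fin N → ℂ}, (∀ n, b n ≠ 0) → ∀ {X : Fin N → Op N},
      LinearIndependent ℂ (rawCovector X S) →
        LinearIndependent ℂ (rawCovector (fun n => b n • X n) S) := by
    intro b hb X hX
    have hne : ∀ h : Config N, ((List.finRange N).map fun n => b n ^ (1 - (h n : ℕ))).prod ≠ 0 := by
      intro h h0
      obtain ⟨n, _, hn⟩ := List.mem_map.mp (List.prod_eq_zero_iff.mp h0)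
      exact pow_ne_zero _ (hb n) hn
    have h := hX.units_smul fun h => Units.mk0 _ (hne h)
    convert h using 1
    funext h
    rw [rawCovector, List.ofFn_eq_map]
    simp only [smul_pow]
    rw [list_prod_smul, Matrix.vecMul_smul]
    simp [rawCovector, List.ofFn_eq_map, Units.smul_def]
  refine ⟨fun h => ?_, key hb⟩
  have h' := key (fun n => inv_ne_zero (hb n)) h
  simpa only [smul_smul, inv_mul_cancel₀ (hb _), one_smul] using h'

theorem linearIndependent_rawCovector_iff {X : Fin N → Op N} {S : State N} :
    LinearIndependent ℂ (rawCovector X S) ↔ (Matrix.of (rawCovector X S)).det ≠ 0 := by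
  rw [← isUnit_iff_ne_zero, ← Matrix.isUnit_iff_isUnit_det,
    ← Matrix.linearIndependent_rows_iff_isUnit]
  rfl

theorem differentiable_det_rawCovector {E : Type*} [NormedAddCommGroup E] [NormedSpace ℂ E]
    {X : E → Fin N → Op N} {S : E → State N}
    (hX : ∀ n s t, Differentiable ℂ fun p => X p n s t)
    (hS : ∀ s, Differentiable ℂ fun p => S p s) :
    Differentiable ℂ fun p => (Matrix.of (rawCovector (X p) (S p))).det := by
  have hpow : ∀ n (e : ℕ) s t, Differentiable ℂ fun p => (X p n ^ e) s t := by
    intro n e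
    induction e with
    | zero => intro s t; simp
    | succ e ih =>
      intro s t
      simp only [pow_succ, Matrix.mul_apply]
      exact Differentiable.fun_sum fun _ _ => (ih _ _).mul (hX _ _ _)
  have hprod : ∀ (e : Fin N → ℕ) (l : List (Fin N)) s t,
      Differentiable ℂ fun p => (l.map fun n => X p n ^ e n).prod s t := by
    intro e l
    induction l with
    | nil => intro s t; simp
    | cons n l ih =>
      intro s t
      simp only [List.map_cons, List.prod_cons, Matrix.mul_apply]
      exact Differentiable.fun_sum fun _ _ => (hpow _ _ _ _).mul (ih _ _)
  simp only [Matrix.det_apply', Matrix.of_apply, rawCovector, Matrix.vecMul, dotProduct,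
    List.ofFn_eq_map]
  have hfin : ∀ {g : Config N → E → ℂ}, (∀ i, Differentiable ℂ (g i)) →
      Differentiable ℂ fun p => ∏ i, g i p := fun hg x =>
    (HasFDerivAt.finsetProd fun i _ => (hg i x).hasFDerivAt).differentiableAt
  refine Differentiable.fun_sum fun σ _ => (hfin fun i => ?_).const_mul _
  exact Differentiable.fun_sum fun _ _ => (hS _).mul (hprod _ _ _ _)

/-- The matrix `k` acting on site `n`. -/
def siteOp (n : Fin N) (k : Matrix (Fin 2) (Fin 2) ℂ) : Op N :=
  ∑ a, ∑ b, k a b • siteUnit N n a b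

/-- The product covector `⊗ₙ wₙ`. -/
def productState (w : Fin N → Fin 2 → ℂ) : State N := fun s => ∏ n, w n (s n)

theorem vecMul_siteUnit (S : State N) (n : Fin N) (a b : Fin 2) (t : Config N) :
    Matrix.vecMul S (siteUnit N n a b) t = if t n = b then S (Function.update t n a) else 0 := by
  simp only [Matrix.vecMul, dotProduct, siteUnit, Matrix.of_apply, mul_ite, mul_one, mul_zero]
  by_cases hb : t n = b
  · rw [if_pos hb, Finset.sum_eq_single (Function.update t n a)]
    · rw [if_pos]; simp [← hb]
    · intro s _ hs
      rw [if_neg]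
      rintro ⟨h1, h2⟩
      apply hs
      rw [h2, Function.update_idem, ← h1, Function.update_eq_self]
    · simp
  · rw [if_neg hb]
    refine Finset.sum_eq_zero fun s _ => if_neg ?_
    rintro ⟨_, h2⟩
    exact hb (by rw [h2]; simp)

theorem vecMul_siteOp (w : Fin N → Fin 2 → ℂ) (n : Fin N) (k : Matrix (Fin 2) (Fin 2) ℂ) :
    Matrix.vecMul (productState w) (siteOp n k) =
      productState (Function.update w n (Matrix.vecMul (w n) k)) := by
  have hsplit : ∀ (w : Fin N → Fin 2 → ℂ) (t : Config N),
      productState w t = w n (t n) * ∏ m ∈ Finset.univ.erase n, w m (t m) := fun w t =>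
    (Finset.mul_prod_erase _ _ (Finset.mem_univ n)).symm
  funext t
  simp only [siteOp, Matrix.vecMul_sum, Matrix.vecMul_smul, Finset.sum_apply, Pi.smul_apply,
    vecMul_siteUnit, smul_eq_mul, mul_ite, mul_zero, Finset.sum_ite_eq, Finset.mem_univ, if_true]
  have h1 : ∀ a, ∏ m ∈ Finset.univ.erase n, w m (Function.update t n a m) =
      ∏ m ∈ Finset.univ.erase n, w m (t m) := fun a => Finset.prod_congr rfl fun m hm => by
    rw [Function.update_of_ne (Finset.ne_of_mem_erase hm)]
  have h2 : ∏ m ∈ Finset.univ.erase n, (Function.update w n (Matrix.vecMul (w n) k)) m (t m) =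
      ∏ m ∈ Finset.univ.erase n, w m (t m) := Finset.prod_congr rfl fun m hm => by
    rw [Function.update_of_ne (Finset.ne_of_mem_erase hm)]
  simp only [hsplit, Function.update_self, h1, h2]
  rw [Matrix.vecMul, dotProduct, Finset.sum_mul]
  exact Finset.sum_congr rfl fun a _ => by ring

theorem rawCovector_siteOp (k : Matrix (Fin 2) (Fin 2) ℂ) (s : Fin 2 → ℂ) (h : Config N) :
    rawCovector (fun n => siteOp n k) (productState fun _ => s) h =
      productState fun n => if h n = 0 then Matrix.vecMul s k else s := by
  have htwo : ∀ i : Fin 2, i = 0 ∨ i = 1 := by decide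
  have key : ∀ (l : List (Fin N)), l.Nodup → ∀ w : Fin N → Fin 2 → ℂ,
      Matrix.vecMul (productState w) (l.map fun n => siteOp n k ^ (1 - (h n : ℕ))).prod =
        productState fun n => if n ∈ l ∧ h n = 0 then Matrix.vecMul (w n) k else w n := by
    intro l
    induction l with
    | nil => intro _ w; simp
    | cons n l ih =>
      intro hl w
      rw [List.nodup_cons] at hl
      rw [List.map_cons, List.prod_cons, ← Matrix.vecMul_vecMul]
      rcases htwo (h n) with hn | hn
      · have : siteOp n k ^ (1 - (h n : ℕ)) = siteOp n k := by rw [hn]; simp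
        rw [this, vecMul_siteOp, ih hl.2]
        congr 1
        funext m
        by_cases hm : m = n
        · subst hm; simp [hl.1, hn]
        · simp [hm]
      · have : siteOp n k ^ (1 - (h n : ℕ)) = 1 := by rw [hn]; simp
        rw [this, Matrix.vecMul_one, ih hl.2]
        congr 1
        funext m
        by_cases hm : m = n
        · subst hm; simp [hn]
        · simp [hm]
  rw [rawCovector, List.ofFn_eq_map, key _ (List.nodup_finRange N)]
  simp

/-- The matrix of these covectors is the N-fold Kronecker power of W, with inverse the Kronecker
power of W⁻¹. -/
theorem linearIndependent_productState {W : Matrix (Fin 2) (Fin 2) ℂ} (hW : W.det ≠ 0) :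
    LinearIndependent ℂ fun h : Config N => productState fun n => W (h n) := by
  have hu : IsUnit W.det := isUnit_iff_ne_zero.mpr hW
  set P : Op N := Matrix.of fun h => productState fun n => W (h n) with hP
  set Q : Op N := Matrix.of fun h => productState fun n => W⁻¹ (h n) with hQ
  have hPQ : P * Q = 1 := by
    ext h g
    have h1 : (P * Q) h g = ∏ n, (W * W⁻¹) (h n) (g n) := by
      simp only [Matrix.mul_apply, hP, hQ, Matrix.of_apply, productState, ← Finset.prod_mul_distrib]
      rw [Fintype.prod_sum]
    rw [h1, Matrix.mul_nonsing_inv _ hu]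
    simp only [Matrix.one_apply]
    by_cases hhg : h = g
    · subst hhg; simp
    · rw [if_neg hhg]
      obtain ⟨n, hn⟩ := Function.ne_iff.mp hhg
      exact Finset.prod_eq_zero (Finset.mem_univ n) (if_neg hn)
  have : IsUnit P := IsUnit.of_mul_eq_one Q hPQ
  exact Matrix.linearIndependent_rows_iff_isUnit.mpr this

/-- A traceless matrix `k ≠ 0` has a covector which is not an eigenvector. -/
theorem exists_cyclic_covector (b c : ℂ) :
    ∃ s : Fin 2 → ℂ, (Matrix.of fun i : Fin 2 => if i = 0 then Matrix.vecMul s !![1, b; c, -1]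
      else s).det ≠ 0 := by
  by_cases hb : b = 0
  · by_cases hc : c = 0
    · refine ⟨![1, 1], ?_⟩
      simp [Matrix.det_fin_two, hb, hc]
    · refine ⟨![0, 1], ?_⟩
      simp [Matrix.det_fin_two, hb, hc]
  · refine ⟨![1, 0], ?_⟩
    simp [Matrix.det_fin_two, hb]

end RawCovectors


/-! ### Independence of the covectors for almost all parameters. -/

section Existence

variable {N : ℕ}

/-- The boundary matrix `ζ K(λ; ζ, κ, τ)`. -/
def rawBoundary (b : BoundaryParam) (lam : ℂ) : Matrix (Fin 2) (Fin 2) ℂ :=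
  !![b.1 + lam, 2 * b.2.1 * Complex.exp b.2.2 * lam;
     2 * b.2.1 * Complex.exp (-b.2.2) * lam, b.1 - lam]

/-- The transfer matrix `𝒯(ξₙ - η/2)`, multiplied by `ζ₊ ζ₋`. -/
def rawTransfer (η : ℂ) (ξ : Fin N → ℂ) (bp bm : BoundaryParam) (n : Fin N) : Op N :=
  openTransfer N η ξ (rawBoundary bp (ξ n)) (rawBoundary bm (ξ n - η)) (ξ n - η / 2)

theorem auxEmb_smul (c : ℂ) (k : Matrix (Fin 2) (Fin 2) ℂ) :
    auxEmb N (c • k) = c • auxEmb N k := by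
  rw [auxEmb_eq_numMat, auxEmb_eq_numMat, numMat_smul]

theorem openTransfer_smul (η : ℂ) (ξ : Fin N → ℂ) (c d : ℂ) (kp km : Matrix (Fin 2) (Fin 2) ℂ)
    (lam : ℂ) :
    openTransfer N η ξ (c • kp) (d • km) lam = (c * d) • openTransfer N η ξ kp km lam := by
  simp only [openTransfer, auxEmb_smul, smul_mul_assoc, mul_smul_comm, Matrix.trace_smul,
    smul_smul]
  rw [mul_comm]

/-- Without the factors 1/ζ± the entries are entire in all the parameters. -/
theorem transferMatrix_eq_rawTransfer (η : ℂ) (ξ : Fin N → ℂ) (bp bm : BoundaryParam) (n : Fin N) :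
    transferMatrix N η ξ bp bm (ξ n - η / 2) =
      (1 / bp.1 * (1 / bm.1)) • rawTransfer η ξ bp bm n := by
  have hp : kPlus η bp (ξ n - η / 2) = (1 / bp.1) • rawBoundary bp (ξ n) := by
    rw [kPlus, kMatrix, sub_add_cancel, rawBoundary]
  have hm : kMinus η bm (ξ n - η / 2) = (1 / bm.1) • rawBoundary bm (ξ n - η) := by
    rw [kMinus, kMatrix, show ξ n - η / 2 - η / 2 = ξ n - η by ring, rawBoundary]
  rw [transferMatrix_eq_openTransfer, hp, hm, openTransfer_smul, rawTransfer]

theorem isBasisFamily_covector {η : ℂ} {ξ : Fin N → ℂ} {bp bm : BoundaryParam} {εp εm : ℤˣ}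
    {S : State N} (hp : bp.1 ≠ 0) (hm : bm.1 ≠ 0)
    (hα : ∀ n, coefA η ξ (zetaBar εp bp) (zetaBar εm bm) (η / 2 - ξ n) ≠ 0)
    (hdet : (Matrix.of (rawCovector (rawTransfer η ξ bp bm) S)).det ≠ 0) :
    IsBasisFamily (covector η ξ bp bm εp εm S) := by
  apply isBasisFamily_of_linearIndependent
  have h := (linearIndependent_rawCovector_smul
    (b := fun n => (coefA η ξ (zetaBar εp bp) (zetaBar εm bm) (η / 2 - ξ n))⁻¹ *
      (1 / bp.1 * (1 / bm.1)))
    (fun n => mul_ne_zero (inv_ne_zero (hα n))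
      (mul_ne_zero (one_div_ne_zero hp) (one_div_ne_zero hm)))).mpr
    (linearIndependent_rawCovector_iff.mpr hdet)
  simp only [mul_smul _ (1 / bp.1 * (1 / bm.1)), ← transferMatrix_eq_rawTransfer] at h
  exact h

theorem smul_lax (w η u : ℂ) (n : Fin N) :
    lax (w * η) (siteUnit N n) (w * u) = w • lax η (siteUnit N n) u := by
  rw [lax, lax, smul_add, smul_smul, smul_smul]

/-- The scalar part of the Lax operator drops out because the boundary matrix is traceless; the
permutation part transfers this matrix to site n. -/
theorem trace_boundary_mul_lax (b c η : ℂ) (n : Fin N) :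
    (auxEmb N !![1, b; c, -1] * lax η (siteUnit N n) (-η)).trace =
      η • siteOp n !![1, b; c, -1] := by
  simp only [lax, mul_add, mul_smul_comm, mul_one, Matrix.trace_add, Matrix.trace_smul]
  have h1 : (auxEmb N !![1, b; c, -1]).trace = 0 := by
    simp [Matrix.trace_fin_two, auxEmb]
  have h2 : (auxEmb N !![1, b; c, -1] * permSite (siteUnit N n)).trace =
      siteOp n !![1, b; c, -1] := by
    simp [Matrix.trace_fin_two, auxEmb, siteOp, Matrix.mul_apply, permSite]
  rw [h1, h2, smul_zero, zero_add]

/-- The inhomogeneities `c n / u` are well separated as `u → 0`. -/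
def sepPoint (n : Fin N) : ℂ := (n : ℕ) + 1

theorem sepPoint_sub_ne_zero {n m : Fin N} (h : m ≠ n) : sepPoint n - sepPoint m ≠ 0 := by
  intro h0
  have h1 : ((n : ℕ) : ℂ) = ((m : ℕ) : ℂ) := by
    unfold sepPoint at h0; linear_combination h0
  exact h (Fin.ext (Nat.cast_injective h1.symm))

theorem sepPoint_add_ne_zero (n m : Fin N) : sepPoint n + sepPoint m ≠ 0 := by
  have : sepPoint n + sepPoint m = (((n : ℕ) + 1 + ((m : ℕ) + 1) : ℕ) : ℂ) := by
    simp [sepPoint]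
  rw [this]; exact Nat.cast_ne_zero.mpr (by omega)

theorem sepPoint_ne_zero (n : Fin N) : sepPoint n ≠ 0 := by
  have : sepPoint n = (((n : ℕ) + 1 : ℕ) : ℂ) := by simp [sepPoint]
  rw [this]; exact Nat.cast_ne_zero.mpr (by omega)

/-- The rescaled transfer matrix at inhomogeneities `c n / u` and for `ζ₊ = 1`, `ζ₋ = u⁻²`. -/
def scaledTransfer (η : ℂ) (a b a' b' : ℂ) (u : ℂ) (n : Fin N) : Op N :=
  Matrix.trace
    (auxEmb N !![u + sepPoint n, a * sepPoint n; b * sepPoint n, u - sepPoint n] *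
      ((List.finRange N).reverse.map fun m => lax (if m = n then η else u * η) (siteUnit N m)
        (if m = n then -η else sepPoint n - sepPoint m - u * η)).prod *
      auxEmb N !![1 + u * (sepPoint n - u * η), a' * (u * (sepPoint n - u * η));
        b' * (u * (sepPoint n - u * η)), 1 - u * (sepPoint n - u * η)] *
      ((List.finRange N).map fun m => lax (u * η) (siteUnit N m)
        (sepPoint n + sepPoint m - u * η)).prod)

theorem differentiable_scaledTransfer (η a b a' b' : ℂ) (n : Fin N) (s t : Config N) :
    Differentiable ℂ fun u => scaledTransfer η a b a' b' u n s t := by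
  have h1 : EntriesDiff fun u : ℂ => ((List.finRange N).reverse.map fun m =>
      lax (if m = n then η else u * η) (siteUnit N m)
        (if m = n then -η else sepPoint n - sepPoint m - u * η)).prod :=
    EntriesDiff.list_prod (η := fun m u => if m = n then η else u * η)
      (u := fun m u => if m = n then -η else sepPoint n - sepPoint m - u * η)
      (fun m => by by_cases h : m = n <;> simp only [h, if_true, if_false] <;> fun_prop)
      (fun m => by by_cases h : m = n <;> simp only [h, if_true, if_false] <;> fun_prop) _
  have h2 : EntriesDiff fun u : ℂ => ((List.finRange N).map fun m =>
      lax (u * η) (siteUnit N m) (sepPoint n + sepPoint m - u * η)).prod :=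
    EntriesDiff.list_prod (η := fun _ u => u * η)
      (u := fun m u => sepPoint n + sepPoint m - u * η)
      (fun m => by fun_prop) (fun m => by fun_prop) _
  have h3 : EntriesDiff fun u : ℂ =>
      auxEmb N !![u + sepPoint n, a * sepPoint n; b * sepPoint n, u - sepPoint n] :=
    entriesDiff_auxEmb fun i j => by fin_cases i <;> fin_cases j <;> simp
  have h4 : EntriesDiff fun u : ℂ =>
      auxEmb N !![1 + u * (sepPoint n - u * η), a' * (u * (sepPoint n - u * η));
        b' * (u * (sepPoint n - u * η)), 1 - u * (sepPoint n - u * η)] :=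
    entriesDiff_auxEmb fun i j => by fin_cases i <;> fin_cases j <;> simp <;> fun_prop
  have h := ((h3.mul h1).mul h4).mul h2
  simp only [scaledTransfer, Matrix.trace_fin_two, Matrix.add_apply]
  exact (h 0 0 s t).add (h 1 1 s t)

theorem list_prod_ne_zero {ι : Type*} {f : ι → ℂ} (hf : ∀ i, f i ≠ 0) (l : List ι) :
    (l.map f).prod ≠ 0 := by
  intro h
  obtain ⟨i, _, hi⟩ := List.mem_map.mp (List.prod_eq_zero_iff.mp h)
  exact hf i hi

/-- At u = 0 every Lax operator except the left one of site n is a scalar, K₋ is the identity and K₊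
is cₙ times its direction. The scalars are nonzero since the cₙ are nonzero with nonvanishing sums
and distinct values. -/
theorem scaledTransfer_zero {η : ℂ} (hη : η ≠ 0) (a b a' b' : ℂ) (n : Fin N) :
    ∃ γ : ℂ, γ ≠ 0 ∧ scaledTransfer η a b a' b' 0 n = γ • siteOp n !![1, a; b, -1] := by
  have hlax : ∀ (m : Fin N) (x : ℂ), lax 0 (siteUnit N m) x = x • 1 := fun m x => by simp [lax]
  have h1 : ((List.finRange N).reverse.map fun m => lax (if m = n then η else 0 * η) (siteUnit N m)
        (if m = n then -η else sepPoint n - sepPoint m - 0 * η)).prod =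
      ((List.finRange N).reverse.map fun m =>
        if m = n then (1 : ℂ) else sepPoint n - sepPoint m).prod • lax η (siteUnit N n) (-η) := by
    have h : ∀ m, lax (if m = n then η else 0 * η) (siteUnit N m)
        (if m = n then -η else sepPoint n - sepPoint m - 0 * η) =
        (if m = n then (1 : ℂ) else sepPoint n - sepPoint m) •
          (Function.update (fun _ => (1 : AuxOp N)) n (lax η (siteUnit N n) (-η))) m := by
      intro m
      by_cases hm : m = n
      · subst hm; simp
      · simp [hm, hlax]
    simp only [h]
    have hmem : n ∈ (List.finRange N).reverse := by simp
    rw [list_prod_smul, list_prod_update (g := fun _ => (1 : AuxOp N)) rfl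
      (fun _ => Commute.one_left _) nodup_sites hmem]
    simp
  have h2 : ((List.finRange N).map fun m => lax (0 * η) (siteUnit N m)
        (sepPoint n + sepPoint m - 0 * η)).prod =
      ((List.finRange N).map fun m => sepPoint n + sepPoint m).prod • (1 : AuxOp N) := by
    simp only [zero_mul, sub_zero, hlax]
    rw [list_prod_smul]
    simp
  have h3 : (!![1 + 0 * (sepPoint n - 0 * η), a' * (0 * (sepPoint n - 0 * η));
        b' * (0 * (sepPoint n - 0 * η)), 1 - 0 * (sepPoint n - 0 * η)] :
          Matrix (Fin 2) (Fin 2) ℂ) = 1 := by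
    ext i j; fin_cases i <;> fin_cases j <;> simp
  have h4 : (!![0 + sepPoint n, a * sepPoint n; b * sepPoint n, 0 - sepPoint n] :
      Matrix (Fin 2) (Fin 2) ℂ) = sepPoint n • !![1, a; b, -1] := by
    ext i j; fin_cases i <;> fin_cases j <;> simp [mul_comm]
  have h5 : auxEmb N 1 = 1 := by rw [auxEmb_eq_numMat, map_one]
  rw [scaledTransfer, h1, h2, h3, h4, h5, auxEmb_smul]
  simp only [mul_one, mul_smul_comm, smul_mul_assoc, Matrix.trace_smul, trace_boundary_mul_lax,
    smul_smul]
  refine ⟨_, ?_, rfl⟩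
  refine mul_ne_zero (mul_ne_zero (list_prod_ne_zero (fun m => sepPoint_add_ne_zero n m) _)
    (mul_ne_zero (list_prod_ne_zero (fun m => ?_) _) (sepPoint_ne_zero n))) hη
  by_cases hm : m = n
  · simp [hm]
  · rw [if_neg hm]; exact sepPoint_sub_ne_zero hm

/-- Each Lax operator is rescaled by u except the left one of site n, whose argument -η does not
depend on ξ. K₊ is rescaled by u and K₋ by u², which clears ζ₋ = u⁻². -/
theorem scaledTransfer_eq (η κp τp κm τm : ℂ) {u : ℂ} (hu : u ≠ 0) (n : Fin N) :
    ∃ β : ℂ, β ≠ 0 ∧ scaledTransfer η (2 * κp * Complex.exp τp) (2 * κp * Complex.exp (-τp))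
        (2 * κm * Complex.exp τm) (2 * κm * Complex.exp (-τm)) u n =
      β • rawTransfer η (fun n => sepPoint n / u) (1, κp, τp) ((u ^ 2)⁻¹, κm, τm) n := by
  have h1 : ((List.finRange N).reverse.map fun m => lax (if m = n then η else u * η) (siteUnit N m)
        (if m = n then -η else sepPoint n - sepPoint m - u * η)).prod =
      ((List.finRange N).reverse.map fun m => if m = n then (1 : ℂ) else u).prod •
        bulkMonodromy N η (fun n => sepPoint n / u) (sepPoint n / u - η / 2) := by
    rw [bulkMonodromy_eq, ← list_prod_smul]
    congr 2
    funext m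
    by_cases hm : m = n
    · subst hm
      simp only [if_true, one_smul]
      congr 1; ring
    · simp only [hm, if_false]
      rw [← smul_lax]
      congr 1
      field_simp
      ring
  have h2 : ((List.finRange N).map fun m => lax (u * η) (siteUnit N m)
        (sepPoint n + sepPoint m - u * η)).prod =
      ((List.finRange N).map fun _ => u).prod •
        bulkMonodromyHat N η (fun n => sepPoint n / u) (sepPoint n / u - η / 2) := by
    rw [bulkMonodromyHat_eq, ← list_prod_smul]
    congr 2
    funext m
    rw [← smul_lax]
    congr 1
    field_simp
    ring
  have h3 : (!![1 + u * (sepPoint n - u * η),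
        2 * κm * Complex.exp τm * (u * (sepPoint n - u * η));
        2 * κm * Complex.exp (-τm) * (u * (sepPoint n - u * η)),
        1 - u * (sepPoint n - u * η)] : Matrix (Fin 2) (Fin 2) ℂ) =
      u ^ 2 • rawBoundary ((u ^ 2)⁻¹, κm, τm) (sepPoint n / u - η) := by
    ext i j
    fin_cases i <;> fin_cases j <;> simp [rawBoundary] <;> field_simp
  have h4 : (!![u + sepPoint n, 2 * κp * Complex.exp τp * sepPoint n;
        2 * κp * Complex.exp (-τp) * sepPoint n, u - sepPoint n] :
      Matrix (Fin 2) (Fin 2) ℂ) = u • rawBoundary (1, κp, τp) (sepPoint n / u) := by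
    ext i j
    fin_cases i <;> fin_cases j <;> simp [rawBoundary] <;> field_simp
  rw [scaledTransfer, h1, h2, h3, h4, auxEmb_smul, auxEmb_smul]
  simp only [mul_smul_comm, smul_mul_assoc, Matrix.trace_smul, smul_smul]
  refine ⟨_, ?_, rfl⟩
  refine mul_ne_zero (list_prod_ne_zero (fun _ => hu) _) (mul_ne_zero (pow_ne_zero 2 hu)
    (mul_ne_zero (list_prod_ne_zero (fun m => ?_) _) hu))
  split_ifs
  exacts [one_ne_zero, hu]

/-- For any directions of the boundary fields the covectors are independent at some point. -/
theorem exists_det_rawCovector_ne_zero {η : ℂ} (hη : η ≠ 0) (κp τp κm τm : ℂ) :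
    ∃ (ξ : Fin N → ℂ) (ζp ζm : ℂ) (S : State N),
      (Matrix.of (rawCovector (rawTransfer η ξ (ζp, κp, τp) (ζm, κm, τm)) S)).det ≠ 0 := by
  obtain ⟨s, hs⟩ := exists_cyclic_covector (2 * κp * Complex.exp τp) (2 * κp * Complex.exp (-τp))
  set S : State N := productState fun _ => s
  set F : ℂ → Fin N → Op N := scaledTransfer η (2 * κp * Complex.exp τp)
    (2 * κp * Complex.exp (-τp)) (2 * κm * Complex.exp τm) (2 * κm * Complex.exp (-τm)) with hF
  have hd : Differentiable ℂ fun u => (Matrix.of (rawCovector (F u) S)).det :=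
    differentiable_det_rawCovector (fun n s t => differentiable_scaledTransfer _ _ _ _ _ n s t)
      fun _ => differentiable_const _
  have h0 : (Matrix.of (rawCovector (F 0) S)).det ≠ 0 := by
    rw [← linearIndependent_rawCovector_iff]
    choose γ hγ hγ' using fun n : Fin N => scaledTransfer_zero hη (2 * κp * Complex.exp τp)
      (2 * κp * Complex.exp (-τp)) (2 * κm * Complex.exp τm) (2 * κm * Complex.exp (-τm)) n
    have hF0 : F 0 = fun n => γ n •
        siteOp n !![1, 2 * κp * Complex.exp τp; 2 * κp * Complex.exp (-τp), -1] :=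
      funext hγ'
    rw [hF0, linearIndependent_rawCovector_smul hγ]
    have h := linearIndependent_productState (N := N) hs
    convert h using 1
    funext h
    rw [rawCovector_siteOp]
    rfl
  -- The value u = 0 itself corresponds to no actual parameters; continuity gives a nearby u ≠ 0.
  obtain ⟨u, hu, hu0⟩ := ((hd.continuous.continuousAt.eventually_ne h0).filter_mono
    nhdsWithin_le_nhds |>.and (self_mem_nhdsWithin (s := {(0 : ℂ)}ᶜ))).exists
  refine ⟨fun n => sepPoint n / u, 1, (u ^ 2)⁻¹, S, ?_⟩
  choose β hβ hβ' using fun n : Fin N => scaledTransfer_eq η κp τp κm τm hu0 n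
  rw [← linearIndependent_rawCovector_iff] at hu ⊢
  have hFu : F u = fun n => β n •
      rawTransfer η (fun n => sepPoint n / u) (1, κp, τp) ((u ^ 2)⁻¹, κm, τm) n := funext hβ'
  rwa [hFu, linearIndependent_rawCovector_smul hβ] at hu

theorem zetaBar_sq (ε : ℤˣ) (b : BoundaryParam) (hb : 1 + 4 * b.2.1 ^ 2 ≠ 0) :
    zetaBar ε b ^ 2 * (1 + 4 * b.2.1 ^ 2) = b.1 ^ 2 := by
  have h1 : (((ε : ℤ) : ℂ)) ^ 2 = 1 := by
    rcases Int.units_eq_one_or ε with rfl | rfl <;> simp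
  have h2 : ((1 + 4 * b.2.1 ^ 2 : ℂ) ^ (1 / 2 : ℂ)) ^ 2 = 1 + 4 * b.2.1 ^ 2 := by
    rw [← Complex.cpow_nat_mul]; norm_num
  rw [zetaBar, div_pow, mul_pow, h1, h2, one_mul, div_mul_cancel₀ _ hb]

/-- The conditions ζ̄± ≠ ξₙ are imposed through their squares: these are polynomial in the
parameters and free of the sign ε and of the branch of the square root. -/
theorem coefA_ne_zero {η : ℂ} (hη : η ≠ 0) {ξ : Fin N → ℂ} {bp bm : BoundaryParam} (εp εm : ℤˣ)
    (hξ : GenericInhom η ξ) (hp : bp.1 ≠ 0) (hm : bm.1 ≠ 0)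
    (hκp : 1 + 4 * bp.2.1 ^ 2 ≠ 0) (hκm : 1 + 4 * bm.2.1 ^ 2 ≠ 0) (n : Fin N)
    (hn : η - 2 * ξ n ≠ 0) (hnp : ξ n ^ 2 * (1 + 4 * bp.2.1 ^ 2) - bp.1 ^ 2 ≠ 0)
    (hnm : ξ n ^ 2 * (1 + 4 * bm.2.1 ^ 2) - bm.1 ^ 2 ≠ 0) :
    coefA η ξ (zetaBar εp bp) (zetaBar εm bm) (η / 2 - ξ n) ≠ 0 := by
  have h1 := hξ.1 n
  simp only [Set.mem_insert_iff, Set.mem_singleton_iff, not_or] at h1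
  have hz : ∀ (ε : ℤˣ) (b : BoundaryParam), b.1 ≠ 0 → 1 + 4 * b.2.1 ^ 2 ≠ 0 →
      ξ n ^ 2 * (1 + 4 * b.2.1 ^ 2) - b.1 ^ 2 ≠ 0 →
      zetaBar ε b ≠ 0 ∧ η / 2 - ξ n - η / 2 + zetaBar ε b ≠ 0 := by
    intro ε b hb hκ hne
    have h := zetaBar_sq ε b hκ
    constructor
    · intro h0
      rw [h0] at h
      exact hb (by simpa using h.symm)
    · intro h0
      have : zetaBar ε b = ξ n := by linear_combination h0
      rw [this] at h
      exact hne (sub_eq_zero.mpr h)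
  obtain ⟨p1, p2⟩ := hz εp bp hp hκp hnp
  obtain ⟨m1, m2⟩ := hz εm bm hm hκm hnm
  have hgen : ∀ m, m ≠ n → ξ n + ξ m ≠ η ∧ ξ n - ξ m ≠ η := fun m hmn => by
    obtain ⟨g1, g2⟩ := hξ.2 n m hmn.symm
    simp only [Set.mem_insert_iff, Set.mem_singleton_iff, not_or] at g1 g2
    exact ⟨g1.2.2, g2.2.2⟩
  have ha : aFun η ξ (η / 2 - ξ n) ≠ 0 := by
    refine Finset.prod_ne_zero_iff.mpr fun m _ => ?_
    by_cases hmn : m = n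
    · subst hmn
      intro h; exact hn (by linear_combination h)
    · intro h; exact (hgen m hmn).1 (by linear_combination -h)
  have hd : dFun η ξ (-(η / 2 - ξ n)) ≠ 0 := by
    refine Finset.prod_ne_zero_iff.mpr fun m _ => ?_
    by_cases hmn : m = n
    · subst hmn
      intro h
      exact hη (by linear_combination -h)
    · intro h; exact (hgen m hmn).2 (by linear_combination h)
  have hq : (2 * (η / 2 - ξ n) + η) / (2 * (η / 2 - ξ n)) ≠ 0 := by
    refine div_ne_zero (fun h => h1.2.2 ?_) (fun h => hn (by linear_combination h))
    linear_combination (-1 / 2 : ℂ) * h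
  rw [coefA]
  exact mul_ne_zero (mul_ne_zero (mul_ne_zero (mul_ne_zero (pow_ne_zero _ (by norm_num)) hq)
    (div_ne_zero (mul_ne_zero p2 m2) (mul_ne_zero p1 m1))) ha) hd

/-- The covectors form a basis almost everywhere in a space of parameters which is not too
degenerate. -/
theorem ae_isBasisFamily_covector {E : Type*} [NormedAddCommGroup E] [NormedSpace ℂ E]
    [NormedSpace ℝ E] [IsScalarTower ℝ ℂ E] [FiniteDimensional ℝ E] [MeasurableSpace E]
    [BorelSpace E] (μ : Measure E) [μ.IsAddHaarMeasure] {η : ℂ} (hη : η ≠ 0) (εp εm : ℤˣ)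
    {ξ : E → Fin N → ℂ} {bp bm : E → BoundaryParam} {S : E → State N}
    (hξ : Differentiable ℂ ξ) (hbp : Differentiable ℂ bp) (hbm : Differentiable ℂ bm)
    (hS : Differentiable ℂ S)
    (h0 : ∃ x, ξ x = 0 ∧ (bp x).1 = 1 ∧ (bm x).1 = 1)
    (hκp : ∃ x, 1 + 4 * (bp x).2.1 ^ 2 ≠ 0) (hκm : ∃ x, 1 + 4 * (bm x).2.1 ^ 2 ≠ 0)
    (hdet : ∃ x, (Matrix.of (rawCovector (rawTransfer η (ξ x) (bp x) (bm x)) (S x))).det ≠ 0) :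
    ∀ᵐ x ∂μ, GenericInhom η (ξ x) →
      IsBasisFamily (covector η (ξ x) (bp x) (bm x) εp εm (S x)) := by
  have hξ' : ∀ n, Differentiable ℂ fun x => ξ x n := fun n => by fun_prop
  have hdiff : Differentiable ℂ fun x =>
      (Matrix.of (rawCovector (rawTransfer η (ξ x) (bp x) (bm x)) (S x))).det := by
    refine differentiable_det_rawCovector (fun n s t => ?_) fun s => by fun_prop
    refine differentiable_openTransfer η hξ' ?_ ?_ ((hξ' n).sub_const _) s t
    all_goals
      intro i j
      have := hξ' n
      fin_cases i <;> fin_cases j <;> simp [rawBoundary] <;> fun_prop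
  -- At ξ = 0, ζ± = 1 the polynomials in `e1`, `e2`, `e5`, `e6`, `e7` are nonzero. Genericity is not
  -- needed at this point, since it is only used at the final x.
  obtain ⟨x₀, hx1, hx2, hx3⟩ := h0
  have e1 : ∀ᵐ x ∂μ, (bp x).1 ≠ 0 :=
    ae_ne_zero_of_differentiable μ (by fun_prop) ⟨x₀, by rw [hx2]; exact one_ne_zero⟩
  have e2 : ∀ᵐ x ∂μ, (bm x).1 ≠ 0 :=
    ae_ne_zero_of_differentiable μ (by fun_prop) ⟨x₀, by rw [hx3]; exact one_ne_zero⟩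
  have e3 : ∀ᵐ x ∂μ, 1 + 4 * (bp x).2.1 ^ 2 ≠ 0 :=
    ae_ne_zero_of_differentiable μ (by fun_prop) hκp
  have e4 : ∀ᵐ x ∂μ, 1 + 4 * (bm x).2.1 ^ 2 ≠ 0 :=
    ae_ne_zero_of_differentiable μ (by fun_prop) hκm
  have e5 : ∀ᵐ x ∂μ, ∀ n, η - 2 * ξ x n ≠ 0 := ae_all_iff.mpr fun n =>
    ae_ne_zero_of_differentiable μ (by fun_prop) ⟨x₀, by simpa [hx1] using hη⟩
  have e6 : ∀ᵐ x ∂μ, ∀ n, ξ x n ^ 2 * (1 + 4 * (bp x).2.1 ^ 2) - (bp x).1 ^ 2 ≠ 0 :=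
    ae_all_iff.mpr fun n =>
      ae_ne_zero_of_differentiable μ (by fun_prop) ⟨x₀, by simp [hx1, hx2]⟩
  have e7 : ∀ᵐ x ∂μ, ∀ n, ξ x n ^ 2 * (1 + 4 * (bm x).2.1 ^ 2) - (bm x).1 ^ 2 ≠ 0 :=
    ae_all_iff.mpr fun n =>
      ae_ne_zero_of_differentiable μ (by fun_prop) ⟨x₀, by simp [hx1, hx3]⟩
  filter_upwards [e1, e2, e3, e4, e5, e6, e7, ae_ne_zero_of_differentiable μ hdiff hdet] with
    x h1 h2 h3 h4 h5 h6 h7 h8 hgen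
  exact isBasisFamily_covector h1 h2
    (fun n => coefA_ne_zero hη εp εm hgen h1 h2 h3 h4 n (h5 n) (h6 n) (h7 n)) h8

/-- The standard volume of a space of parameters is a Borel Haar measure. -/
class IsHaarSpace (E : Type*) [NormedAddCommGroup E] [MeasureSpace E] : Prop where
  borel : BorelSpace E
  haar : (volume : Measure E).IsAddHaarMeasure
  countable : SecondCountableTopology E
  sigmaFinite : SigmaFinite (volume : Measure E)

instance isHaarSpace_complex : IsHaarSpace ℂ :=
  ⟨inferInstance, inferInstance, inferInstance, inferInstance⟩

instance isHaarSpace_pi (ι : Type*) [Fintype ι] : IsHaarSpace (ι → ℂ) :=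
  ⟨inferInstance, inferInstance, inferInstance, inferInstance⟩

instance isHaarSpace_prod {E F : Type*} [NormedAddCommGroup E] [MeasureSpace E]
    [NormedAddCommGroup F] [MeasureSpace F] [hE : IsHaarSpace E] [hF : IsHaarSpace F] :
    IsHaarSpace (E × F) := by
  obtain ⟨h1, h2, h3, h4⟩ := hE
  obtain ⟨k1, k2, k3, k4⟩ := hF
  exact ⟨inferInstance, Measure.prod.instIsAddHaarMeasure volume volume, inferInstance,
    inferInstance⟩

/-- Both normalizations of the reference vector are covered: c is its pairing with ⟨𝟎|, and d = c
V̂(ξ^{(𝟎)}) is the resulting numerator of the measure. -/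
theorem sov_bases {η : ℂ} {ξ : Fin N → ℂ} {bp bm : BoundaryParam} {εp εm : ℤˣ} {S : State N}
    (hξ : GenericInhom η ξ) (hp : bp.1 ≠ 0) (hm : bm.1 ≠ 0)
    (hbasis : IsBasisFamily (covector η ξ bp bm εp εm S)) {c d : ℂ} (hc : c ≠ 0)
    (hd : c * vHat (shifted η ξ fun _ => 0) = d) :
    (∃! R : State N, IsReference (covector η ξ bp bm εp εm S) c R) ∧
      ∀ R : State N, IsReference (covector η ξ bp bm εp εm S) c R →
        IsBasisFamily (vector η ξ bp bm εp εm R) ∧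
          ∀ h' h : Config N,
            covector η ξ bp bm εp εm S h' ⬝ᵥ vector η ξ bp bm εp εm R h =
              if h = h' then d / vHat (shifted η ξ h) else 0 := by
  refine ⟨existsUnique_isReference hbasis c, fun R hR => ?_⟩
  have H : ∀ h' h : Config N, covector η ξ bp bm εp εm S h' ⬝ᵥ vector η ξ bp bm εp εm R h =
      if h = h' then d / vHat (shifted η ξ h) else 0 := fun h' h => by
    rw [covector_dotProduct_vector hξ hp hm hbasis hR, ← hd, mul_div_assoc]
  have hV : ∀ h, vHat (shifted η ξ h) ≠ 0 := fun h => vHat_ne_zero (hξ.shifted_injective h)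
  exact ⟨isBasisFamily_of_biorthogonal
    (fun h => div_ne_zero (by rw [← hd]; exact mul_ne_zero hc (hV _)) (hV h)) H, H⟩

end Existence

end
end OpenXXX

open OpenXXX in
theorem mainTheorem9 (N : ℕ) (η : ℂ) (hη : η ≠ 0) (εp εm : ℤˣ) :
    -- the covectors form a basis for almost every choice of all the parameters
    (∀ᵐ p : (Fin N → ℂ) × BoundaryParam × BoundaryParam × State N,
      GenericInhom η p.1 →
      ¬ (IsScalarFun (kMinus η p.2.2.1) ∧ IsScalarFun (kPlus η p.2.1)) →
      IsBasisFamily (covector η p.1 p.2.1 p.2.2.1 εp εm p.2.2.2)) ∧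
    -- the same for fixed directions `(κ±, τ±)` of the boundary fields, e.g. parallel ones
    (∀ κp τp κm τm : ℂ, 1 + 4 * κp ^ 2 ≠ 0 → 1 + 4 * κm ^ 2 ≠ 0 →
      ∀ᵐ p : (Fin N → ℂ) × ℂ × ℂ × State N,
        GenericInhom η p.1 →
        ¬ (IsScalarFun (kMinus η (p.2.2.1, κm, τm)) ∧ IsScalarFun (kPlus η (p.2.1, κp, τp))) →
        IsBasisFamily
          (covector η p.1 (p.2.1, κp, τp) (p.2.2.1, κm, τm) εp εm p.2.2.2)) ∧
    -- whenever they form a basis: the reference vector, the dual basis and the SoV measure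
    (∀ (ξ : Fin N → ℂ) (bp bm : BoundaryParam) (S : State N),
      GenericInhom η ξ →
      bp.1 ≠ 0 → bm.1 ≠ 0 → 1 + 4 * bp.2.1 ^ 2 ≠ 0 → 1 + 4 * bm.2.1 ^ 2 ≠ 0 →
      (∀ n, ξ n ≠ η / 2) →
      IsBasisFamily (covector η ξ bp bm εp εm S) →
      -- `|R⟩` normalized so that the SoV measure is `N_ξ / V̂(ξ^{(𝐡)})`
      ((∃! R : State N, IsReference (covector η ξ bp bm εp εm S)
          (vHat ξ / vHat (shifted η ξ (fun _ => 1))) R) ∧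
        ∀ R : State N, IsReference (covector η ξ bp bm εp εm S)
            (vHat ξ / vHat (shifted η ξ (fun _ => 1))) R →
          IsBasisFamily (vector η ξ bp bm εp εm R) ∧
          ∀ h' h : Config N,
            covector η ξ bp bm εp εm S h' ⬝ᵥ vector η ξ bp bm εp εm R h =
              if h = h' then normXi η ξ / vHat (shifted η ξ h) else 0) ∧
      -- `|R⟩` normalized with `V̂(ξ^{(𝟎)})` instead: the measure is `V̂(ξ) / V̂(ξ^{(𝐡)})`
      ((∃! R : State N, IsReference (covector η ξ bp bm εp εm S)
          (vHat ξ / vHat (shifted η ξ (fun _ => 0))) R) ∧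
        ∀ R : State N, IsReference (covector η ξ bp bm εp εm S)
            (vHat ξ / vHat (shifted η ξ (fun _ => 0))) R →
          IsBasisFamily (vector η ξ bp bm εp εm R) ∧
          ∀ h' h : Config N,
            covector η ξ bp bm εp εm S h' ⬝ᵥ vector η ξ bp bm εp εm R h =
              if h = h' then vHat ξ / vHat (shifted η ξ h) else 0)) := by
  refine ⟨?_, fun κp τp κm τm hκp hκm => ?_, ?_⟩
  -- A single nonvanishing point suffices when all parameters vary, so diagonal boundary fields
  -- serve as the witness.
  · obtain ⟨ξ, ζp, ζm, S, h⟩ := exists_det_rawCovector_ne_zero (N := N) hη 0 0 0 0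
    have hE : IsHaarSpace ((Fin N → ℂ) × BoundaryParam × BoundaryParam × State N) := inferInstance
    have := hE.borel
    have := hE.haar
    have H := ae_isBasisFamily_covector (volume :
        Measure ((Fin N → ℂ) × BoundaryParam × BoundaryParam × State N)) hη εp εm
      (ξ := fun p => p.1) (bp := fun p => p.2.1) (bm := fun p => p.2.2.1)
      (S := fun p => p.2.2.2) (by fun_prop) (by fun_prop) (by fun_prop) (by fun_prop)
      ⟨(0, (1, 0, 0), (1, 0, 0), 0), rfl, rfl, rfl⟩
      ⟨0, by simp⟩ ⟨0, by simp⟩ ⟨(ξ, (ζp, 0, 0), (ζm, 0, 0), S), h⟩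
    filter_upwards [H] with p hp hgen _ using hp hgen
  · obtain ⟨ξ, ζp, ζm, S, h⟩ := exists_det_rawCovector_ne_zero (N := N) hη κp τp κm τm
    have hE : IsHaarSpace ((Fin N → ℂ) × ℂ × ℂ × State N) := inferInstance
    have := hE.borel
    have := hE.haar
    have H := ae_isBasisFamily_covector (volume :
        Measure ((Fin N → ℂ) × ℂ × ℂ × State N)) hη εp εm
      (ξ := fun p => p.1) (bp := fun p => (p.2.1, κp, τp)) (bm := fun p => (p.2.2.1, κm, τm))
      (S := fun p => p.2.2.2) (by fun_prop) (by fun_prop) (by fun_prop) (by fun_prop)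
      ⟨(0, 1, 1, 0), rfl, rfl, rfl⟩ ⟨0, hκp⟩ ⟨0, hκm⟩ ⟨(ξ, ζp, ζm, S), h⟩
    filter_upwards [H] with p hp hgen _ using hp hgen
  · intro ξ bp bm S hξ hp hm _ _ _ hbasis
    have hV := fun h => vHat_ne_zero (hξ.shifted_injective h)
    have hV0 := vHat_ne_zero hξ.injective
    refine ⟨sov_bases hξ hp hm hbasis (div_ne_zero hV0 (hV _)) ?_,
      sov_bases hξ hp hm hbasis (div_ne_zero hV0 (hV _)) (div_mul_cancel₀ _ (hV _))⟩
    rw [normXi]; ring
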